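/- **Theorem (deciding half-turn factorizations).** A *polyomino* is a nonempty finite set of unit cells of the square grid that is connected through edges and simply connected. Its *boundary word* is the circular word over $\{\mathbf u,\mathbf r,\mathbf d,\mathbf l\}$ (up, right, down, left) that records the directions of the unit edges in a clockwise traversal of its boundary. For a word $A$, let $\overline{A}$ be the word obtained by reversing $A$ and replacing each letter by the opposite direction ($\mathbf u\leftrightarrow\mathbf d$, $\mathbf l\leftrightarrow\mathbf r$). A circular word $W$ has a *half-turn factorization* if some shift of it (reading from some first letter) can be written as $$A\,B\,C\,\overline{A}\,D\,E$$ with $B, C, D, E$ palindromes; each of the factors may be empty. There is an algorithm (a single program for a random access machine with unit-cost operations on words of $O(\log n)$ bits) which, given the boundary word of a polyomino $P$, read from an arbitrary first letter, decides in $O(n\log^2 n)$ time whether it has a half-turn factorization, where $n$ is the length of the boundary word. -/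

import Mathlib

/-! ### Letters and words -/

/-- The four directions: up, right, down, left. -/
inductive Letter where
  | u | r | d | l
  deriving DecidableEq

namespace Letter

/-- The complement of a letter: its rotation by 180 degrees. -/
def comp : Letter → Letter
  | u => d
  | r => l
  | d => u
  | l => r

/-- The unit step of the plane lattice in the direction of the letter. -/
def vec : Letter → ℤ × ℤ
  | u => (0, 1)
  | r => (1, 0)
  | d => (0, -1)
  | l => (-1, 0)

/-- The number that represents the letter in the memory of a machine. -/
def code : Letter → ℕ
  | u => 0
  | r => 1
  | d => 2
  | l => 3

end Letter

/-- The backtrack of a word: the complement of its reverse. -/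
def backtrack (w : List Letter) : List Letter := w.reverse.map Letter.comp

/-- The circular word represented by `w` has a half-turn factorization: some shift of `w` is
`A B C (backtrack A) D E` with `B`, `C`, `D`, `E` palindromes. Each factor may be empty. -/
def HasHalfTurnFactorization (w : List Letter) : Prop :=
  ∃ A B C D E : List Letter,
    B.Palindrome ∧ C.Palindrome ∧ D.Palindrome ∧ E.Palindrome ∧
      w ~r (A ++ B ++ C ++ backtrack A ++ D ++ E)

/-! ### Polyominoes and their boundary words -/

/-- Two unit cells of the square grid are adjacent if they share an edge. The pair `(x, y)`
stands for the cell `[x, x + 1] × [y, y + 1]`. -/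
def cellGraph : SimpleGraph (ℤ × ℤ) where
  Adj a b := |a.1 - b.1| + |a.2 - b.2| = 1
  symm := ⟨fun a b h => by rw [abs_sub_comm b.1, abs_sub_comm b.2]; exact h⟩
  loopless := ⟨fun a h => by simp at h⟩

/-- A polyomino: a nonempty finite set of unit cells, connected through edges and simply
connected. A finite edge-connected set of closed cells is simply connected exactly when its
complement in the plane is connected, that is, when the cells outside of it are connected
through edges. -/
structure Polyomino where
  cells : Finset (ℤ × ℤ)
  connected : (cellGraph.induce (cells : Set (ℤ × ℤ))).Connected
  simplyConnected : (cellGraph.induce ((cells : Set (ℤ × ℤ))ᶜ)).Connected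

/-- The cell on the right-hand side of the unit edge that leaves the vertex `v` in
direction `a`. -/
def rightCell (v : ℤ × ℤ) : Letter → ℤ × ℤ
  | .u => (v.1, v.2)
  | .r => (v.1, v.2 - 1)
  | .d => (v.1 - 1, v.2 - 1)
  | .l => (v.1 - 1, v.2)

/-- The cell on the left-hand side of the unit edge that leaves the vertex `v` in
direction `a`. -/
def leftCell (v : ℤ × ℤ) : Letter → ℤ × ℤ
  | .u => (v.1 - 1, v.2)
  | .r => (v.1, v.2)
  | .d => (v.1, v.2 - 1)
  | .l => (v.1 - 1, v.2 - 1)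

/-- The vertex reached from `p` after the first `i` steps of the word `w`. -/
def pathVertex (p : ℤ × ℤ) (w : List Letter) (i : ℕ) : ℤ × ℤ :=
  p + ((w.take i).map Letter.vec).sum

/-- `w` is the boundary word of `P`, read from some boundary vertex `p`: the path that starts
at `p` and follows `w` is closed, does not pass twice through a vertex, and traverses exactly
the edges between a cell of `P` and a cell outside of `P`, with `P` on the right-hand side
(clockwise). -/
def Polyomino.IsBoundaryWord (P : Polyomino) (w : List Letter) : Prop :=
  ∃ p : ℤ × ℤ,
    pathVertex p w w.length = p ∧
    (∀ i j, i < j → j < w.length → pathVertex p w i ≠ pathVertex p w j) ∧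
    ∀ (v : ℤ × ℤ) (a : Letter),
      (rightCell v a ∈ P.cells ∧ leftCell v a ∉ P.cells) ↔
        ∃ i, w[i]? = some a ∧ pathVertex p w i = v

/-! ### The word RAM

A random access machine with unit-cost operations on words of a bounded number of bits,
programmed in a language with assignments, conditionals and loops. -/

namespace WordRAM

/-- The memory of the machine: registers, and arrays with random access. -/
structure State where
  reg : ℕ → ℕ
  arr : ℕ → ℕ → ℕ

/-- The operations of the machine: truncated subtraction, division rounded down, and
comparisons with value `1` or `0`. -/
inductive Op where
  | add | sub | mul | div | mod | lt | eq

/-- The value of an operation. -/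
def Op.eval : Op → ℕ → ℕ → ℕ
  | add, a, b => a + b
  | sub, a, b => a - b
  | mul, a, b => a * b
  | div, a, b => a / b
  | mod, a, b => a % b
  | lt, a, b => if a < b then 1 else 0
  | eq, a, b => if a = b then 1 else 0

/-- Expressions: constants, registers, entries of arrays, operations. -/
inductive Expr where
  | const (k : ℕ)
  | reg (x : ℕ)
  | read (a : ℕ) (i : Expr)
  | op (o : Op) (e f : Expr)

namespace Expr

/-- The value of an expression. -/
def eval (σ : State) : Expr → ℕ
  | const k => k
  | reg x => σ.reg x
  | read a i => σ.arr a (i.eval σ)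
  | op o e f => o.eval (e.eval σ) (f.eval σ)

/-- The time to evaluate an expression: one step for each constant, each access to a register
or an array, and each operation. -/
def cost : Expr → ℕ
  | const _ => 1
  | reg _ => 1
  | read _ i => i.cost + 1
  | op _ e f => e.cost + f.cost + 1

/-- The evaluation of the expression does not overflow: each value that occurs in it is less
than `M`. -/
def Fits (M : ℕ) (σ : State) : Expr → Prop
  | const k => k < M
  | reg x => σ.reg x < M
  | read a i => i.Fits M σ ∧ σ.arr a (i.eval σ) < M
  | op o e f => e.Fits M σ ∧ f.Fits M σ ∧ o.eval (e.eval σ) (f.eval σ) < M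

end Expr

/-- Programs. A test succeeds if the value of its expression is not `0`. -/
inductive Prog where
  | skip
  | set (x : ℕ) (e : Expr)
  | store (a : ℕ) (i e : Expr)
  | seq (p q : Prog)
  | ite (e : Expr) (p q : Prog)
  | loop (e : Expr) (p : Prog)

/-- `Exec M p σ t τ`: on words with values less than `M`, the program `p` started in the state
`σ` halts after `t` steps in the state `τ`, and no overflow occurs. A computation with an
overflow has no result. -/
inductive Exec (M : ℕ) : Prog → State → ℕ → State → Prop
  | skip (σ : State) : Exec M .skip σ 1 σ
  | set (x : ℕ) (e : Expr) (σ : State) (he : e.Fits M σ) :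
      Exec M (.set x e) σ (e.cost + 1)
        ⟨Function.update σ.reg x (e.eval σ), σ.arr⟩
  | store (a : ℕ) (i e : Expr) (σ : State) (hi : i.Fits M σ) (he : e.Fits M σ) :
      Exec M (.store a i e) σ (i.cost + e.cost + 1)
        ⟨σ.reg, Function.update σ.arr a (Function.update (σ.arr a) (i.eval σ) (e.eval σ))⟩
  | seq (p q : Prog) (σ τ ρ : State) (s t : ℕ) (hp : Exec M p σ s τ) (hq : Exec M q τ t ρ) :
      Exec M (.seq p q) σ (s + t) ρ
  | ite_true (e : Expr) (p q : Prog) (σ τ : State) (t : ℕ) (he : e.Fits M σ)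
      (h : e.eval σ ≠ 0) (hp : Exec M p σ t τ) :
      Exec M (.ite e p q) σ (e.cost + 1 + t) τ
  | ite_false (e : Expr) (p q : Prog) (σ τ : State) (t : ℕ) (he : e.Fits M σ)
      (h : e.eval σ = 0) (hq : Exec M q σ t τ) :
      Exec M (.ite e p q) σ (e.cost + 1 + t) τ
  | loop_done (e : Expr) (p : Prog) (σ : State) (he : e.Fits M σ) (h : e.eval σ = 0) :
      Exec M (.loop e p) σ (e.cost + 1) σ
  | loop_step (e : Expr) (p : Prog) (σ τ ρ : State) (s t : ℕ) (he : e.Fits M σ)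
      (h : e.eval σ ≠ 0) (hp : Exec M p σ s τ) (hl : Exec M (.loop e p) τ t ρ) :
      Exec M (.loop e p) σ (e.cost + 1 + s + t) ρ

/-- The initial state on the input `w`: the length of `w` in register `0`, the codes of its
letters in the first entries of array `0`, and `0` everywhere else. -/
def input (w : List Letter) : State where
  reg x := if x = 0 then w.length else 0
  arr a i := if a = 0 then ((w[i]?).map Letter.code).getD 0 else 0

/-- On each input `w` with the property `Promise`, the program `p`, run with words of
`c * (⌊log₂ n⌋ + 1)` bits where `n` is the length of `w`, halts within `T n` steps without
overflow, and its answer (in register `0`) is `1` if `w` has the property `Q`, and `0` if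
not. -/
def DecidesWithin (p : Prog) (c : ℕ) (T : ℕ → ℕ) (Promise Q : List Letter → Prop) : Prop :=
  ∀ w : List Letter, Promise w →
    ∃ (t : ℕ) (τ : State),
      Exec (2 ^ (c * (Nat.log 2 w.length + 1))) p (input w) t τ ∧
      t ≤ T w.length ∧
      (Q w → τ.reg 0 = 1) ∧ (¬ Q w → τ.reg 0 = 0)

end WordRAM

/-!
The circular word is represented by the `n`-periodic word `f : ℤ → Letter`, and a factorization by
the positions at which its factors start (`HT`). Of the geometry of polyominoes, only two facts
are used: the boundary word never turns back, and it is not a power of a shorter word, as the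
boundary is closed but visits no vertex twice (`simple_of_isBoundaryWord`).

*Factorizations with a nonempty factor `A`.* As the word does not turn back, `A` and its backtrack
cannot be extended on either side, and hence `B`, `C`, `D`, `E` are maximal palindromes
(`HT.outer_ne`, `HT.maximal_C`). So there are `2 n` candidates for `C`, one for each center, and
`B` and `C` determine `A` as the longest possible one; what is left is whether a given factor is a
product of two palindromes `D E`. By the theorem of Fine and Wilf, the longest palindromic suffix
or the longest palindromic prefix then cuts it into two palindromes (`pal_pal_longest`). To bound
the number of candidates for `B`, its length is put into one of `O(log n)` dyadic classes. The
palindromic suffixes of the prefix that ends where `C` starts have, within a class, lengths that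
form an arithmetic progression, with a period `d` of the word as its difference. All but `O(1)` of
them are *loose*: much longer than `d`, and far from both ends of the run of period `d`
(`exists_loose_of_far`, where the exceptions lie in three windows of 17 terms). If `B`, `C`, `D`
and `E` were all loose, then `E A B` or its counterpart `C (backtrack A) D` would be contained in
a run, and the factor `A` could be moved by a period, which makes `B C` shorter. Hence a
factorization with the shortest possible `B C` has a palindrome that is not loose
(`exists_not_loose`); after rotation and reversal of the word, it is `B`. This gives
`O(n log n)` candidates.

*Factorizations into four palindromes.* One of the palindromes can be taken to be maximal and of
length at least `n / 4` (`exists_long_maximal`): a longest palindrome that is not maximal can be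
extended at the expense of its neighbours. The centers are divided into eight blocks. All such
palindromes with centers in a block and to the left of a longest one start at the same position,
because they share a run, and those to the right of it end at the same position
(`left_eq_of_longest`, `right_eq_of_longest`). So each block gives three positions at which the
circular word can be cut, and for each of them the `n + 1` ways to divide the word into two
factors are tried, each of which has to be a product of two palindromes.

*The program.* Each candidate is decided in time `O(log n)`. The factors of length `2 ^ k` of the
word, its reversal and its complement have names, computed by doubling (`names`), so that longest
common prefixes are found by binary search (`lce`). The radii of the maximal palindromes (`radii`)
are such longest common prefixes, and longest palindromic suffixes are found by binary search in a
table of maxima of the positions that palindromes reach (`maxima`, `longestSuffix`). All this is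
computed for the word and for its reversal. Programs are verified with a logic of total
correctness with time bounds (`Run`), and searches, which may only set the answer, with a variant
of it (`Search`).

*The memory.* Register `9` holds the answer and registers `1` to `6` hold constants (`Ctx`).
Arrays `0` and `1` hold the word and its reversal. The tables for the word in array `o`, where `o`
is `0` or `1`, are in the arrays `2 + o` (names), `6 + o` (radii) and `8 + o` (maxima), and array
`4 + o` is the dictionary used for naming. Array `10` holds the powers of two. Positions in the
word are natural numbers, shifted by multiples of `n` such that truncated subtraction is exact.
-/
/-! ### Periods and palindromes of two-sided infinite words -/

namespace HalfTurn

variable {α : Type*}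

/-- The factor of `f` on the interval `[x, y)` has period `d`. -/
def Per (f : ℤ → α) (d x y : ℤ) : Prop := ∀ t, x ≤ t → t + d < y → f t = f (t + d)

/-- The factor of `f` on the interval `[x, y)` is a palindrome. -/
def Pal (f : ℤ → α) (x y : ℤ) : Prop := ∀ t, x ≤ t → t < y → f t = f (x + y - 1 - t)

/-- The reversal of a two-sided infinite word. The position `x` between two letters becomes the
position `-x`. -/
def rev (f : ℤ → α) : ℤ → α := fun x => f (-1 - x)

theorem rev_rev (f : ℤ → α) : rev (rev f) = f := by
  funext x; simp [rev]

theorem Per.mono {f : ℤ → α} {d x y x' y' : ℤ} (h : Per f d x y) (hx : x ≤ x') (hy : y' ≤ y) :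
    Per f d x' y' := fun t h1 h2 => h t (by omega) (by omega)

theorem Per.eq_add_mul {f : ℤ → α} {d x y : ℤ} (h : Per f d x y) (hd : 0 < d) (m : ℕ) :
    ∀ t, x ≤ t → t + m * d < y → f t = f (t + m * d) := by
  induction m with
  | zero => intro t _ _; simp
  | succ m ih =>
    intro t h1 h2
    push_cast at h2 ⊢
    have h3 : (m : ℤ) * d ≥ 0 := by positivity
    rw [ih t h1 (by nlinarith), h (t + m * d) (by omega) (by nlinarith)]
    congr 1; ring

theorem Per.eq_of_dvd {f : ℤ → α} {d x y : ℤ} (h : Per f d x y) (hd : 0 < d) {s t : ℤ}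
    (hs : x ≤ s) (hs' : s < y) (ht : x ≤ t) (ht' : t < y) (hdvd : d ∣ t - s) : f s = f t := by
  obtain ⟨m, hm⟩ := hdvd
  rcases le_total 0 m with h0 | h0
  · lift m to ℕ using h0
    have : t = s + m * d := by linarith [mul_comm d (m : ℤ)]
    rw [this]; exact h.eq_add_mul hd m s hs (by omega)
  · obtain ⟨k, hk⟩ : ∃ k : ℕ, m = -(k : ℤ) := ⟨m.natAbs, by omega⟩
    have : s = t + k * d := by subst hk; linarith [mul_comm d (k : ℤ)]
    rw [this]; exact (h.eq_add_mul hd k t ht (by omega)).symm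

theorem Per.of_dvd {f : ℤ → α} {g d x y : ℤ} (h : Per f g x y) (hg : 0 < g) (hd : 0 < d)
    (hdvd : g ∣ d) : Per f d x y := fun t h1 h2 =>
  h.eq_of_dvd hg h1 (by omega) (by omega) h2 (by simpa using hdvd)

/-- The theorem of Fine and Wilf. -/
theorem Per.gcd {f : ℤ → α} {x y : ℤ} : ∀ (N : ℕ) (d e : ℤ), d + e ≤ N → 0 < d → 0 < e →
    Per f d x y → Per f e x y → d + e ≤ y - x → Per f (Int.gcd d e) x y := by
  intro N
  induction N with
  | zero => intro d e h h1 h2; push_cast at h; omega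
  | succ N ih =>
    intro d e hN hd he hpd hpe hl
    push_cast at hN
    rcases lt_trichotomy d e with h | h | h
    · have key : Per f (e - d) x y := by
        intro t h1 h2
        by_cases h3 : t + e < y
        · rw [hpe t h1 h3, hpd (t + (e - d)) (by omega) (by omega)]
          congr 1; ring
        · have h4 := hpd (t - d) (by omega) (by omega)
          have h5 := hpe (t - d) (by omega) (by omega)
          rw [show t - d + d = t by ring] at h4
          rw [← h4, h5]; congr 1; ring
      have := ih d (e - d) (by omega) hd (by omega) hpd key (by omega)
      rwa [Int.gcd_sub_self_right] at this
    · subst h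
      have h3 : ((Int.gcd d d : ℕ) : ℤ) = d := by simp; omega
      rw [h3]; exact hpd
    · have key : Per f (d - e) x y := by
        intro t h1 h2
        by_cases h3 : t + d < y
        · rw [hpd t h1 h3, hpe (t + (d - e)) (by omega) (by omega)]
          congr 1; ring
        · have h4 := hpe (t - e) (by omega) (by omega)
          have h5 := hpd (t - e) (by omega) (by omega)
          rw [show t - e + e = t by ring] at h4
          rw [← h4, h5]; congr 1; ring
      have := ih (d - e) e (by omega) (by omega) he key hpe (by omega)
      rwa [Int.gcd_sub_self_left] at this

/-- A period of a factor of length `d + g` of a word with period `d` is a period of the whole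
word, if it divides `d`. -/
theorem Per.extend {f : ℤ → α} {g d x y x' y' : ℤ} (h : Per f g x y) (h' : Per f d x' y')
    (hg : 0 < g) (hd : 0 < d) (hx : x' ≤ x) (hy : y ≤ y') (hl : d + g ≤ y - x) :
    Per f g x' y' := by
  intro t h1 h2
  -- the position in `[x, x + d)` that is congruent to `t` modulo `d`
  obtain ⟨u, hu1, hu2, hu3⟩ : ∃ u, x ≤ u ∧ u < x + d ∧ d ∣ u - t := by
    refine ⟨x + (t - x) % d, ?_, ?_, ?_⟩
    · have := Int.emod_nonneg (t - x) hd.ne'; omega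
    · have := Int.emod_lt_of_pos (t - x) hd; omega
    · have h3 := Int.emod_add_mul_ediv (t - x) d
      exact ⟨-((t - x) / d), by linarith [h3]⟩
  have e1 : f t = f u := h'.eq_of_dvd hd h1 (by omega) (by omega) (by omega) hu3
  have e2 : f (t + g) = f (u + g) := h'.eq_of_dvd hd (by omega) h2 (by omega) (by omega)
    (by simpa using hu3)
  rw [e1, e2]; exact h u hu1 (by omega)

/-- If two factors with periods `d` and `e` overlap in at least `d + e` letters, then both are
periods of their union. -/
theorem Per.union {f : ℤ → α} {d e x y x' y' : ℤ} (h : Per f d x y) (h' : Per f e x' y')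
    (hd : 0 < d) (he : 0 < e) (hl : d + e ≤ min y y' - max x x') :
    Per f d (min x x') (max y y') ∧ Per f e (min x x') (max y y') := by
  have hg : (0 : ℤ) < Int.gcd d e := by
    have := Int.gcd_pos_of_ne_zero_left e hd.ne'; omega
  have hgd : (Int.gcd d e : ℤ) ∣ d := Int.gcd_dvd_left ..
  have hge : (Int.gcd d e : ℤ) ∣ e := Int.gcd_dvd_right ..
  have hgd' := Int.le_of_dvd hd hgd
  have hge' := Int.le_of_dvd he hge
  have h0 : Per f (Int.gcd d e) (max x x') (min y y') :=
    Per.gcd (d + e).toNat d e (by omega) hd he (h.mono (by omega) (by omega))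
      (h'.mono (by omega) (by omega)) (by omega)
  have h1 : Per f (Int.gcd d e) x y := h0.extend h hg hd (by omega) (by omega) (by omega)
  have h2 : Per f (Int.gcd d e) x' y' := h0.extend h' hg he (by omega) (by omega) (by omega)
  have h3 : Per f (Int.gcd d e) (min x x') (max y y') := by
    intro t ht1 ht2
    by_cases c : x ≤ t ∧ t + (Int.gcd d e : ℤ) < y
    · exact h1 t c.1 c.2
    · exact h2 t (by omega) (by omega)
  exact ⟨h3.of_dvd hg hd hgd, h3.of_dvd hg he hge⟩

theorem Pal.empty (f : ℤ → α) {x y : ℤ} (h : y ≤ x) : Pal f x y := fun t h1 h2 => by omega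

theorem Pal.single (f : ℤ → α) (x : ℤ) : Pal f x (x + 1) := fun t h1 h2 => by
  congr 1; omega

theorem Pal.inner {f : ℤ → α} {x y r : ℤ} (h : Pal f x y) (hr : 0 ≤ r) :
    Pal f (x + r) (y - r) := fun t h1 h2 => by
  rw [h t (by omega) (by omega)]; congr 1; ring

theorem Pal.outer {f : ℤ → α} {x y : ℤ} (h : Pal f x y) (he : f (x - 1) = f y) :
    Pal f (x - 1) (y + 1) := fun t h1 h2 => by
  rcases eq_or_lt_of_le h1 with c | c
  · subst c; rw [he]; congr 1; ring
  · rcases eq_or_lt_of_le (show t ≤ y by omega) with c' | c'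
    · subst c'; rw [← he]; congr 1; ring
    · rw [h t (by omega) (by omega)]; congr 1; ring

theorem Pal.shift {f : ℤ → α} {n : ℤ} (hf : ∀ x, f (x + n) = f x) {x y : ℤ} (h : Pal f x y) :
    Pal f (x + n) (y + n) := fun t h1 h2 => by
  have h3 := h (t - n) (by omega) (by omega)
  rw [← hf, ← hf (x + y - 1 - (t - n))] at h3
  rw [show t - n + n = t by ring] at h3
  rw [h3]; congr 1; ring

theorem Per.shift {f : ℤ → α} {n : ℤ} (hf : ∀ x, f (x + n) = f x) {d x y : ℤ}
    (h : Per f d x y) : Per f d (x + n) (y + n) := fun t h1 h2 => by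
  have h3 := h (t - n) (by omega) (by omega)
  rw [← hf, ← hf (t - n + d)] at h3
  rw [show t - n + n = t by ring] at h3
  rw [h3]; congr 1; ring

theorem pal_rev {f : ℤ → α} {x y : ℤ} : Pal (rev f) x y ↔ Pal f (-y) (-x) := by
  constructor
  · intro h t h1 h2
    have := h (-1 - t) (by omega) (by omega)
    simp only [rev] at this
    rw [show -1 - (-1 - t) = t by ring] at this
    rw [this]; congr 1; ring
  · intro h t h1 h2
    have := h (-1 - t) (by omega) (by omega)
    simp only [rev]
    rw [this]; congr 1; ring

theorem per_rev {f : ℤ → α} {d x y : ℤ} : Per (rev f) d x y ↔ Per f d (-y) (-x) := by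
  constructor
  · intro h t h1 h2
    have := h (-1 - t - d) (by omega) (by omega)
    simp only [rev] at this
    rw [show -1 - (-1 - t - d) = t + d by ring, show -1 - (-1 - t - d + d) = t by ring] at this
    exact this.symm
  · intro h t h1 h2
    have := h (-1 - t - d) (by omega) (by omega)
    simp only [rev]
    rw [show -1 - (t + d) = -1 - t - d by ring, this]; congr 1; ring

/-- The difference of the lengths of two palindromic suffixes is a period. -/
theorem Pal.per {f : ℤ → α} {x x' y : ℤ} (h : Pal f x y) (h' : Pal f x' y) (hx : x ≤ x') :
    Per f (x' - x) x y := fun t h1 h2 => by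
  rw [h t (by omega) (by omega), h' (x + y - 1 - t) (by omega) (by omega)]
  congr 1; ring

/-- The difference of the lengths of two palindromic prefixes is a period. -/
theorem Pal.per_prefix {f : ℤ → α} {x y y' : ℤ} (h : Pal f x y) (h' : Pal f x y')
    (hy : y' ≤ y) : Per f (y - y') x y := fun t h1 h2 => by
  rw [h' t (by omega) (by omega), h (x + y' - 1 - t) (by omega) (by omega)]
  congr 1; ring

theorem Pal.drop {f : ℤ → α} {d x y : ℤ} (h : Pal f x y) (hp : Per f d x y) (hd : 0 ≤ d) :
    Pal f (x + d) y := fun t h1 h2 => by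
  have := hp (t - d) (by omega) (by omega)
  rw [show t - d + d = t by ring] at this
  rw [← this, h (t - d) (by omega) (by omega)]; congr 1; ring

theorem Pal.extend_left {f : ℤ → α} {d x y : ℤ} (h : Pal f x y) (hp : Per f d (x - d) y)
    (hl : d ≤ y - x) : Pal f (x - d) y := fun t h1 h2 => by
  by_cases c : t + d < y
  · rw [hp t h1 c, h (t + d) (by omega) (by omega)]; congr 1; ring
  · rw [h t (by omega) h2]
    have := hp (x - d + y - 1 - t) (by omega) (by omega)
    rw [this]; congr 1; ring

theorem Pal.extend_right {f : ℤ → α} {d x y : ℤ} (h : Pal f x y) (hp : Per f d x (y + d))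
    (hl : d ≤ y - x) : Pal f x (y + d) := by
  have h1 : Pal (rev f) (-y) (-x) := by rw [pal_rev]; simpa using h
  have h2 : Per (rev f) d (-y - d) (-x) := by
    rw [per_rev]; convert hp using 1 <;> ring
  have h3 := h1.extend_left h2 (by omega)
  rw [pal_rev] at h3
  convert h3 using 1 <;> ring

/-- If a word is a product of two palindromes, then its longest palindromic suffix `[i, y)`
leaves a palindrome, or its longest palindromic prefix `[x, k)` does. -/
theorem pal_pal_longest {f : ℤ → α} {x y m i k : ℤ}
    (h1 : Pal f x m) (h2 : Pal f m y) (hi : Pal f i y) (hk : Pal f x k) (hxi : x ≤ i)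
    (him : i ≤ m) (hmk : m ≤ k) (hky : k ≤ y) : Pal f x i ∨ Pal f k y := by
  rcases eq_or_lt_of_le him with c | c
  · left; rwa [c]
  rcases eq_or_lt_of_le hmk with c' | c'
  · right; rwa [← c']
  right
  have p1 := hk.per_prefix h1 hmk
  have p2 := hi.per h2 him
  have p3 := (p1.union p2 (by omega) (by omega) (by omega)).1
  rw [min_eq_left hxi, max_eq_right hky] at p3
  have := h2.drop (d := k - m) (p3.mono (by omega) le_rfl) (by omega)
  rwa [show m + (k - m) = k by ring] at this

/-- A period of a long factor of a periodic word is a period of the whole word. -/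
theorem Per.global {f : ℤ → α} {n : ℤ} (hn : 0 < n) (hf : ∀ x, f (x + n) = f x) {d x y : ℤ}
    (h : Per f d x y) (hl : n + d ≤ y - x) : ∀ t, f (t + d) = f t := by
  have hp : ∀ x y, Per f n x y := fun x y t _ _ => (hf t).symm
  intro t
  have hu0 := Int.emod_nonneg (t - x) hn.ne'
  have hu1 := Int.emod_lt_of_pos (t - x) hn
  have h3 := Int.emod_add_mul_ediv (t - x) n
  have hdv : n ∣ x + (t - x) % n - t := ⟨-((t - x) / n), by linarith⟩
  have e : ∀ s u, n ∣ u - s → f s = f u := fun s u hsu =>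
    (hp (min s u) (max s u + 1)).eq_of_dvd hn (by omega) (by omega) (by omega) (by omega) hsu
  rw [e t _ hdv, e (t + d) (x + (t - x) % n + d) (by simpa using hdv)]
  exact (h _ (by omega) (by omega)).symm

end HalfTurn

/-! ### Half-turn factorizations of periodic words -/

namespace HalfTurn

/-- A half-turn factorization, by positions, of the circular word of length `n` that the
`n`-periodic word `f` represents. The factors `A`, `B`, `C`, `backtrack A`, `D`, `E` are the
factors of `f` on `[i - a, i)`, `[i, j)`, `[j, k)`, `[k, k + a)`, `[k + a, p)` and
`[p, i + n - a)`. -/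
structure HT (f : ℤ → Letter) (n i j k a p : ℤ) : Prop where
  hij : i ≤ j
  hjk : j ≤ k
  ha : 0 ≤ a
  hkp : k + a ≤ p
  hpi : p ≤ i + n - a
  B : Pal f i j
  C : Pal f j k
  A : ∀ t, 0 ≤ t → t < a → f (i - 1 - t) = (f (k + t)).comp
  D : Pal f (k + a) p
  E : Pal f p (i + n - a)

/-- The properties of the boundary words of polyominoes on which the algorithm relies: the word of
length `n` is not a power of a shorter one, and does not turn back. -/
structure Simple (f : ℤ → Letter) (n : ℤ) : Prop where
  pos : 0 < n
  periodic : ∀ x, f (x + n) = f x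
  aperiodic : ∀ d, 0 < d → d < n → ¬ ∀ x, f (x + d) = f x
  noBack : ∀ x, f (x + 1) ≠ (f x).comp

theorem comp_comp (a : Letter) : a.comp.comp = a := by cases a <;> rfl

theorem comp_ne (a : Letter) : a ≠ a.comp := by cases a <;> simp [Letter.comp]

theorem Simple.rev {f : ℤ → Letter} {n : ℤ} (h : Simple f n) : Simple (rev f) n where
  pos := h.pos
  periodic x := by
    have := h.periodic (-1 - (x + n))
    rw [show -1 - (x + n) + n = -1 - x by ring] at this
    exact this.symm
  aperiodic d h1 h2 h3 := h.aperiodic d h1 h2 fun x => by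
    have := h3 (-1 - x - d)
    simp only [HalfTurn.rev] at this
    rw [show -1 - (-1 - x - d + d) = x by ring, show -1 - (-1 - x - d) = x + d by ring] at this
    exact this.symm
  noBack x e := h.noBack (-1 - (x + 1)) (by
    simp only [HalfTurn.rev] at e
    rw [show -1 - (x + 1) + 1 = -1 - x by ring, e, comp_comp])

namespace HT

variable {f : ℤ → Letter} {n i j k a p : ℤ}

/-- The rotation of a factorization that exchanges `A` with its backtrack. -/
theorem rot (hf : ∀ x, f (x + n) = f x) (h : HT f n i j k a p) :
    HT f n (k + a) p (i + n - a) a (j + n) where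
  hij := h.hkp
  hjk := h.hpi
  ha := h.ha
  hkp := by have := h.hij; omega
  hpi := by have := h.hjk; omega
  B := h.D
  C := h.E
  A t h1 h2 := by
    have := h.A (a - 1 - t) (by omega) (by omega)
    rw [← hf (i - 1 - (a - 1 - t))] at this
    rw [show i + n - a + t = i - 1 - (a - 1 - t) + n by ring, this, comp_comp]
    congr 1; ring
  D := by rw [show i + n - a + a = i + n by ring]; exact h.B.shift hf
  E := by rw [show k + a + n - a = k + n by ring]; exact h.C.shift hf

theorem reverse (hf : ∀ x, f (x + n) = f x) (h : HT f n i j k a p) :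
    HT (HalfTurn.rev f) n (-k) (-j) (-i) a (n - p) where
  hij := by have := h.hjk; omega
  hjk := by have := h.hij; omega
  ha := h.ha
  hkp := by have := h.hpi; omega
  hpi := by have := h.hkp; omega
  B := by rw [pal_rev]; simpa using h.C
  C := by rw [pal_rev]; simpa using h.B
  A t h1 h2 := by
    have := h.A t h1 h2
    simp only [HalfTurn.rev]
    rw [show -1 - (-i + t) = i - 1 - t by ring, this, comp_comp]; congr 1; ring
  D := by
    rw [pal_rev]
    have := h.E.shift (n := -n) (fun x => by rw [← hf (x + -n)]; congr 1; ring)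
    convert this using 1 <;> ring
  E := by
    rw [pal_rev]
    have := h.D.shift (n := -n) (fun x => by rw [← hf (x + -n)]; congr 1; ring)
    convert this using 1 <;> ring

theorem translate {m : ℤ} (hf : ∀ x, f (x + m) = f x) (h : HT f n i j k a p) :
    HT f n (i + m) (j + m) (k + m) a (p + m) where
  hij := by have := h.hij; omega
  hjk := by have := h.hjk; omega
  ha := h.ha
  hkp := by have := h.hkp; omega
  hpi := by have := h.hpi; omega
  B := h.B.shift hf
  C := h.C.shift hf
  A t h1 h2 := by
    have := h.A t h1 h2
    rw [← hf, ← hf (k + t)] at this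
    rw [show i + m - 1 - t = i - 1 - t + m by ring, this]; congr 2; ring
  D := by rw [show k + m + a = k + a + m by ring]; exact h.D.shift hf
  E := by rw [show i + m + n - a = i + n - a + m by ring]; exact h.E.shift hf

theorem lt_ik (hs : Simple f n) (h : HT f n i j k a p) (ha : 0 < a) : i < k := by
  rcases eq_or_lt_of_le (h.hij.trans h.hjk) with c | c
  · exfalso
    have := h.A 0 le_rfl ha
    apply hs.noBack (i - 1)
    rw [c] at this
    rw [show i - 1 + 1 = k by omega, show i - 1 = k - 1 - 0 by omega, this, comp_comp]; simp
  · exact c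

/-- The pair of factors `A` and `backtrack A` cannot be extended inwards. -/
theorem inner_ne (hs : Simple f n) (h : HT f n i j k a p) (hik : i < k) :
    f i ≠ (f (k - 1)).comp := by
  intro e
  rcases eq_or_lt_of_le h.hij with c | c
  · have := h.C i (by omega) hik
    rw [e, show j + k - 1 - i = k - 1 by omega] at this
    exact comp_ne _ this.symm
  rcases eq_or_lt_of_le h.hjk with c' | c'
  · have := h.B i le_rfl (by omega)
    rw [e, show i + j - 1 - i = k - 1 by omega] at this
    exact comp_ne _ this.symm
  have h1 := h.B i le_rfl (by omega)
  have h2 := h.C j le_rfl (by omega)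
  rw [show i + j - 1 - i = j - 1 by omega] at h1
  rw [show j + k - 1 - j = k - 1 by omega] at h2
  apply hs.noBack (j - 1)
  rw [show j - 1 + 1 = j by omega, h2, ← h1, e, comp_comp]

/-- The pair of factors `A` and `backtrack A` cannot be extended outwards. -/
theorem outer_ne (hs : Simple f n) (h : HT f n i j k a p) (ha : 0 < a) :
    f (i - a - 1) ≠ (f (k + a)).comp := by
  intro e
  apply (h.rot hs.periodic).inner_ne hs ((h.rot hs.periodic).lt_ik hs ha)
  rw [show i + n - a - 1 = i - a - 1 + n by ring, hs.periodic, e, comp_comp]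

/-- If `A` is not empty, then the palindrome `B` cannot be extended. -/
theorem maximal_B (hs : Simple f n) (h : HT f n i j k a p) (ha : 0 < a) : f (i - 1) ≠ f j := by
  intro e
  have h1 := h.A 0 le_rfl ha
  simp only [sub_zero, add_zero] at h1
  rcases eq_or_lt_of_le h.hjk with c | c
  · rw [← c, ← e] at h1
    exact comp_ne _ h1
  · have h2 := h.C j le_rfl c
    rw [show j + k - 1 - j = k - 1 by omega] at h2
    apply hs.noBack (k - 1)
    rw [← h2, ← e, h1, comp_comp]; simp

/-- If `A` is not empty, then the palindrome `C` cannot be extended. -/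
theorem maximal_C (hs : Simple f n) (h : HT f n i j k a p) (ha : 0 < a) : f (j - 1) ≠ f k := by
  have := (h.reverse hs.periodic).maximal_B hs.rev ha
  simp only [HalfTurn.rev] at this
  rw [show -1 - (-k - 1) = k by ring, show -1 - -j = j - 1 by ring] at this
  exact this.symm

/-- If the factor `E A B` has period `d`, then `A` can be moved by `d`. -/
theorem slide (hf : ∀ x, f (x + n) = f x) (h : HT f n i j k a p) {d : ℤ}
    (hp : Per f d (p - n) j) (hd : 0 ≤ d) (hl : d ≤ j - i) (hl' : d ≤ i - a + n - p) :
    HT f n (i + d) j k a p where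
  hij := by omega
  hjk := h.hjk
  ha := h.ha
  hkp := h.hkp
  hpi := by have := h.hpi; omega
  B := h.B.drop (hp.mono (by have := h.hpi; have := h.ha; omega) le_rfl) hd
  C := h.C
  A t h1 h2 := by
    rw [← h.A t h1 h2, show i + d - 1 - t = i - 1 - t + d by ring]
    exact (hp _ (by have := h.hpi; omega) (by omega)).symm
  D := h.D
  E := by
    have h1 := h.E.extend_right (d := d)
      ((hp.shift hf).mono (by omega) (by have := h.ha; omega)) (by omega)
    convert h1 using 1; ring

end HT

/-! ### Loose palindromes -/

/-- The palindrome `B`, on `[i, j)`, is loose with respect to the palindrome `C`, on `[j, k)`: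
it is many times longer than a period `d` of it, the maximal factor `[j - l, j)` with this period
starts far before `i` and does not nearly wrap around to `C`, and the length of the part of this
factor before `i` is not close to the length `r` of the maximal factor with period `d` that
starts at `k`. The search visits all the palindromes `B` that are not loose. -/
structure Loose (f : ℤ → Letter) (n i j k d l r : ℤ) : Prop where
  pos : 0 < d
  long : 8 * d < j - i
  per : Per f d (j - l) j
  ne : f (j - l - 1) ≠ f (j - l - 1 + d)
  room : j - i + 8 * d < l
  room' : k - i + 8 * d < n
  le : d ≤ r
  per' : Per f d k (k + r)
  ne' : f (k + r - d) ≠ f (k + r)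
  far : l - (j - i) + 8 * d < r ∨ r + 8 * d < l - (j - i)

namespace Loose

variable {f : ℤ → Letter} {n i j k a p d l r : ℤ}

theorem translate {m : ℤ} (hf : ∀ x, f (x + m) = f x) (h : Loose f n i j k d l r) :
    Loose f n (i + m) (j + m) (k + m) d l r where
  pos := h.pos
  long := by have := h.long; omega
  per := by rw [show j + m - l = j - l + m by ring]; exact h.per.shift hf
  ne := by
    have := h.ne
    rwa [← hf, ← hf (j - l - 1 + d), show j - l - 1 + m = j + m - l - 1 by ring,
      show j - l - 1 + d + m = j + m - l - 1 + d by ring] at this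
  room := by have := h.room; omega
  room' := by have := h.room'; omega
  le := h.le
  per' := by rw [show k + m + r = k + r + m by ring]; exact h.per'.shift hf
  ne' := by
    have := h.ne'
    rwa [← hf, ← hf (k + r), show k + r - d + m = k + m + r - d by ring,
      show k + r + m = k + m + r by ring] at this
  far := by have := h.far; omega

/-- If `B` is loose, then either `A` ends exactly where the run of `B` ends, or the run of `B`
goes far beyond `A`. -/
theorem eq_or_lt (hs : Simple f n) (h : HT f n i j k a p) (ha : 0 < a)
    (hl : Loose f n i j k d l r) : a = l - (j - i) ∨ a + 7 * d < l - (j - i) := by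
  obtain ⟨hd, h1, h2, h3, h4, h5, h6, h7, h8, h9⟩ := hl
  set R := l - (j - i) with hR
  have hmir : ∀ t, 0 ≤ t → t < a → f (k + t) = (f (i - 1 - t)).comp := fun t ht ht' => by
    rw [h.A t ht ht', comp_comp]
  rcases lt_trichotomy a R with c | c | c
  · right
    by_cases hda : d ≤ a
    · -- the run at `k` ends together with the backtrack of `A`
      have hout := h.outer_ne hs ha
      have hr : r = a := by
        by_contra hne
        rcases lt_or_gt_of_ne hne with hlt | hgt
        · apply h8
          rw [show k + r - d = k + (r - d) by ring, hmir _ (by omega) (by omega),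
            hmir _ (by omega) hlt]
          congr 1
          have := h2 (i - 1 - r) (by omega) (by omega)
          rw [this]; congr 1; ring
        · apply hout
          have e1 := h7 (k + a - d) (by omega) (by omega)
          rw [show k + a - d + d = k + a by ring] at e1
          have e2 := h2 (i - a - 1) (by omega) (by omega)
          rw [e2, ← e1, show k + a - d = k + (a - d) by ring, ← h.A _ (by omega) (by omega)]
          congr 1; ring
      omega
    · omega
  · left; exact c
  · exfalso
    -- the run at `k` is the reflection of the run of `B`
    have hr : r = R := by
      by_contra hne
      rcases lt_or_gt_of_ne hne with hlt | hgt
      · apply h8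
        rw [show k + r - d = k + (r - d) by ring, hmir _ (by omega) (by omega),
          hmir _ (by omega) (by omega)]
        congr 1
        have := h2 (i - 1 - r) (by omega) (by omega)
        rw [this]; congr 1; ring
      · apply h3
        have e1 := h7 (k + R - d) (by omega) (by omega)
        rw [show j - l - 1 = i - 1 - R by omega, show i - 1 - R + d = i - 1 - (R - d) by ring,
          h.A _ (by omega) c, h.A _ (by omega) (by omega)]
        congr 1
        rw [show k + R - d + d = k + R by ring] at e1
        rw [← e1]; congr 1; ring
    omega

/-- The run of the loose palindrome `B` ends where `B` ends. -/
theorem ne_right (hs : Simple f n) (h : HT f n i j k a p) (ha : 0 < a)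
    (hl : Loose f n i j k d l r) : f (j - d) ≠ f j := by
  intro e
  apply h.maximal_B hs ha
  obtain ⟨hd, h1, h2, h3, h4, h5, h6, h7, h8, h9⟩ := hl
  rw [← e, h2 (i - 1) (by omega) (by omega), h.B (j - d) (by omega) (by omega)]
  congr 1; ring

end Loose

/-- If `B`, `D` and `E` are loose, and `B` has the largest period of them, then `E A B` is
contained in the runs of `B` and of `E`. -/
theorem HT.per_of_loose {f : ℤ → Letter} {n i j k a p dB lB rB dD lD rD dE lE rE : ℤ}
    (hs : Simple f n) (h : HT f n i j k a p) (ha : 0 < a)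
    (hB : Loose f n i j k dB lB rB) (hD : Loose f n (k + a) p (i + n - a) dD lD rD)
    (hE : Loose (rev f) n (-(i + n - a)) (-p) (-(k + a)) dE lE rE)
    (hDB : dD ≤ dB) (hEB : dE ≤ dB) :
    Per f dB (p - n) j ∧ Per f dE (p - n) j := by
  have hrot := h.rot hs.periodic
  have hrr := hrot.reverse hs.periodic
  have cB := hB.eq_or_lt hs h ha
  have cD := hD.eq_or_lt hs hrot ha
  have cE := hE.eq_or_lt hs.rev hrr ha
  have eD := hD.ne_right hs hrot ha
  have eE := hE.ne_right hs.rev hrr ha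
  obtain ⟨b1, b2, b3, b4, b5, b6, -, -, -, -⟩ := hB
  obtain ⟨d1, d2, d3, d4, d5, -, -, -, -, -⟩ := hD
  obtain ⟨e1, e2, e3, e4, e5, -, -, -, -, -⟩ := hE
  have := h.hij
  have := h.hjk
  have := h.hkp
  have := h.hpi
  -- the run of `E`, one period earlier
  have rE : Per f dE (p - n) (p - n + lE) := by
    rw [per_rev] at e3
    have := e3.shift (n := -n) (fun x => by rw [← hs.periodic (x + -n)]; congr 1; ring)
    convert this using 1 <;> ring
  have bE : f (p - n - 1) ≠ f (p - n - 1 + dE) := by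
    intro e
    apply eE
    rw [← hs.periodic, ← hs.periodic (p - n - 1 + dE)] at e
    simp only [rev]
    rw [show -1 - (-p - dE) = p - n - 1 + dE + n by ring,
      show -1 - -p = p - n - 1 + n by ring, e]
  -- the run of `D`, one period earlier
  have rD : Per f dD (p - n - lD) (p - n) := by
    have := d3.shift (n := -n) (fun x => by rw [← hs.periodic (x + -n)]; congr 1; ring)
    convert this using 1 <;> ring
  have bD : f (p - n - dD) ≠ f (p - n) := by
    intro e
    apply eD
    rw [← hs.periodic, ← hs.periodic (p - n)] at e
    rw [show p - dD = p - n - dD + n by ring, e]; congr 1; ring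
  -- `A` does not end where the run of `B` ends
  have sB : a + 7 * dB < lB - (j - i) := by
    rcases cB with c | c
    · exfalso
      by_cases ho : dB + dE ≤ min j (p - n + lE) - max (j - lB) (p - n)
      · have := (b3.union rE b1 e1 ho).1
        exact b4 (this _ (by omega) (by omega))
      · omega
    · exact c
  by_cases ho : dB + dE ≤ min j (p - n + lE) - max (j - lB) (p - n)
  · obtain ⟨u1, u2⟩ := b3.union rE b1 e1 ho
    exact ⟨u1.mono (by omega) (by omega), u2.mono (by omega) (by omega)⟩
  · exfalso
    by_cases ho' : dB + dD ≤ min j (p - n) - max (j - lB) (p - n - lD)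
    · have := (b3.union rD b1 d1 ho').2
      apply bD
      have h5 := this (p - n - dD) (by omega) (by omega)
      rw [h5]; congr 1; ring
    · omega

/-- If there is a half-turn factorization with a nonempty factor `A`, then there is one in which
one of the four palindromes is not loose, and by rotation and reversal this palindrome is `B`. If
all four were loose, then `A` could be moved by a period, such that `B C` becomes shorter. -/
theorem exists_not_loose {f : ℤ → Letter} {n : ℤ} (hs : Simple f n)
    (hex : ∃ i j k a p, 0 < a ∧ HT f n i j k a p) :
    ∃ i j k a p, 0 < a ∧ ∃ g, (g = f ∨ g = rev f) ∧ HT g n i j k a p ∧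
      ¬ ∃ d l r, Loose g n i j k d l r := by
  by_contra hcon
  push Not at hcon
  -- a factorization in which `B C` is shortest
  obtain ⟨m, hm⟩ : ∃ m : ℕ, ∃ i j k a p, 0 < a ∧ HT f n i j k a p ∧ (k - i).toNat = m := by
    obtain ⟨i, j, k, a, p, ha, h⟩ := hex
    exact ⟨_, i, j, k, a, p, ha, h, rfl⟩
  induction m using Nat.strong_induction_on with
  | _ m ih =>
    obtain ⟨i, j, k, a, p, ha, h, hkm⟩ := hm
    have hrot := h.rot hs.periodic
    have hrev := h.reverse hs.periodic
    have hrr := hrot.reverse hs.periodic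
    obtain ⟨dB, lB, rB, hB⟩ := hcon _ _ _ _ _ ha f (.inl rfl) h
    obtain ⟨dC, lC, rC, hC⟩ := hcon _ _ _ _ _ ha _ (.inr rfl) hrev
    obtain ⟨dD, lD, rD, hD⟩ := hcon _ _ _ _ _ ha f (.inl rfl) hrot
    obtain ⟨dE, lE, rE, hE⟩ := hcon _ _ _ _ _ ha _ (.inr rfl) hrr
    have h1 := h.hij
    have h2 := h.hjk
    have h3 := h.hkp
    have h4 := h.hpi
    have hneg : ∀ x, f (x + -n) = f x := fun x => by
      rw [← hs.periodic (x + -n)]; congr 1; ring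
    have hneg' : ∀ x, rev f (x + -n) = rev f x := fun x => by
      rw [← hs.rev.periodic (x + -n)]; congr 1; ring
    by_cases hmax : max dC dD ≤ max dB dE
    · -- `E A B` is periodic: move `A` towards `C`
      have hp : Per f dB (p - n) j ∧ Per f dE (p - n) j := by
        rcases le_total dE dB with c | c
        · exact h.per_of_loose hs ha hB hD hE (by omega) c
        · have := hrr.per_of_loose hs.rev ha hE (dD := dC) (lD := lC) (rD := rC)
            (dE := dB) (lE := lB) (rE := rB) (by convert hC using 1 <;> ring)
            (by rw [rev_rev]; convert hB using 1 <;> ring) (by omega) c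
          rw [per_rev, per_rev] at this
          constructor
          · convert this.2.shift hneg using 1 <;> ring
          · convert this.1.shift hneg using 1 <;> ring
      have hl := hB.long
      have hl' := hE.long
      have hpos := hB.pos
      have hpos' := hE.pos
      by_cases hdd : dB ≤ dE
      · exact ih _ (by omega) ⟨_, _, _, _, _, ha,
          h.slide hs.periodic hp.1 (by omega) (by omega) (by omega), rfl⟩
      · exact ih _ (by omega) ⟨_, _, _, _, _, ha,
          h.slide hs.periodic hp.2 (by omega) (by omega) (by omega), rfl⟩
    · -- `C (backtrack A) D` is periodic: move `backtrack A` towards `B`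
      have hp : Per f dC j p ∧ Per f dD j p := by
        rcases le_total dC dD with c | c
        · have := (hrot.translate hneg).per_of_loose hs ha (hD.translate hneg)
            (dD := dB) (lD := lB) (rD := rB)
            (dE := dC) (lE := lC) (rE := rC) (by convert hB using 1 <;> ring)
            (by convert hC using 1 <;> ring) (by omega) c
          constructor
          · convert this.2.shift hs.periodic using 1 <;> ring
          · convert this.1.shift hs.periodic using 1 <;> ring
        · have := hrev.per_of_loose hs.rev ha hC
            (dD := dE) (lD := lE) (rD := rE)
            (dE := dD) (lE := lD) (rE := rD)
            (by convert hE.translate hs.rev.periodic using 1 <;> ring)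
            (by rw [rev_rev]; convert hD.translate hneg using 1 <;> ring) (by omega) c
          rw [per_rev, per_rev] at this
          constructor
          · convert this.1 using 1 <;> ring
          · convert this.2 using 1 <;> ring
      have hl := hC.long
      have hl' := hD.long
      have hpos := hC.pos
      have hpos' := hD.pos
      -- the slide takes place in the reversed word
      have fin : ∀ d, Per f d j p → 0 < d → d ≤ k - j → d ≤ p - (k + a) → False := by
        intro d hd h0 hd1 hd2
        have h5 := hrev.slide hs.rev.periodic (d := d)
          (by rw [per_rev]; convert hd using 1 <;> ring) (by omega) (by omega) (by omega)
        have h6 := h5.reverse hs.rev.periodic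
        rw [rev_rev] at h6
        exact ih _ (by omega) ⟨_, _, _, _, _, ha, h6, rfl⟩
      by_cases hdd : dC ≤ dD
      · exact fin _ hp.1 hpos (by omega) (by omega)
      · exact fin _ hp.2 hpos' (by omega) (by omega)

end HalfTurn

/-! ### The palindromes that the search visits -/

namespace HalfTurn

/-- A palindrome `B` of length between `L / 2` and `L` that is not loose has a length close to one
of three targets: the length `m` of the longest palindromic suffix of length at most `L`, and two
lengths determined by the run of `B` and by the run that starts at `k`. Lengths are counted in
units of the difference of `m` and the length `m'` of the next shorter palindromic suffix. The
statement is the contrapositive: a palindrome that is far from the targets is loose. -/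
theorem exists_loose_of_far {f : ℤ → Letter} {n i j k a p : ℤ} (hs : Simple f n)
    (h : HT f n i j k a p) {L m m' r r' : ℤ}
    (hL : j - i ≤ L) (hL' : L < 2 * (j - i) ∨ L = 0) (hm : m ≤ L)
    (hmp : Pal f (j - m) j) (hmmax : ∀ l, m < l → l ≤ L → ¬ Pal f (j - l) j)
    (hmp' : Pal f (j - m') j)
    (hmmax' : ∀ l, m' < l → l < m → ¬ Pal f (j - l) j)
    (hmm : m' < m ∨ m ≤ 0) (hr0 : 0 ≤ r) (hr0' : 0 ≤ r')
    (hr : ∀ u, 0 ≤ u → u < r → f (j - 1 - u) = f (j - (m - m') - 1 - u))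
    (hrne : f (j - 1 - r) ≠ f (j - (m - m') - 1 - r) ∨ n ≤ r)
    (hr' : ∀ u, 0 ≤ u → u < r' → f (k + u) = f (k + (m - m') + u))
    (hrne' : f (k + r') ≠ f (k + (m - m') + r') ∨ n ≤ r')
    (hfar : ∀ t, (t = m ∨ t = min (m - m' + r) (n - (k - j)) ∨
      t = max 0 (m - m' + r - (m - m' + r'))) → (j - i) % (m - m') = m % (m - m') →
      (j - i) / (m - m') + 8 < t / (m - m') ∨ t / (m - m') + 8 < (j - i) / (m - m')) :
    ∃ d l r, Loose f n i j k d l r := by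
  have hij := h.hij
  have hjk := h.hjk
  have hkp := h.hkp
  have hpi := h.hpi
  have ha := h.ha
  have hBp : Pal f (j - (j - i)) j := by simpa using h.B
  have hm0 : j - i ≤ m := by
    by_contra hc
    exact hmmax (j - i) (by omega) hL hBp
  -- the palindrome is not the longest one
  rcases eq_or_lt_of_le hm0 with c | c
  · exfalso
    have := hfar m (.inl rfl) (by rw [c])
    rw [c] at this; omega
  have hm1 : j - i ≤ m' := by
    by_contra hc
    exact hmmax' (j - i) (by omega) c hBp
  have hLL : L < 2 * (j - i) := by omega
  obtain ⟨d, hd⟩ : ∃ d, d = m - m' := ⟨_, rfl⟩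
  simp only [← hd] at hr hrne hr' hrne' hfar
  have hd0 : 0 < d := by omega
  have per1 : Per f d (j - m) j := by
    have := hmp.per hmp' (by omega)
    rwa [show j - m' - (j - m) = d by omega] at this
  have per2 : Per f (m - (j - i)) (j - m) j := by
    have := hmp.per h.B (by omega)
    rwa [show i - (j - m) = m - (j - i) by omega] at this
  -- the lengths of the palindromic suffixes differ by multiples of `d`
  have hdvd : d ∣ m - (j - i) := by
    have hg := Per.gcd (d + (m - (j - i))).toNat _ _ (by omega) hd0 (by omega) per1 per2
      (by omega)
    have hgd : (Int.gcd d (m - (j - i)) : ℤ) ∣ d := Int.gcd_dvd_left ..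
    have hge : (Int.gcd d (m - (j - i)) : ℤ) ∣ m - (j - i) := Int.gcd_dvd_right ..
    have hg0 : (0 : ℤ) < Int.gcd d (m - (j - i)) := by
      have := Int.gcd_pos_of_ne_zero_left (m - (j - i)) hd0.ne'; omega
    have hgle := Int.le_of_dvd hd0 hgd
    rcases eq_or_lt_of_le hgle with e | e
    · rwa [e] at hge
    · exfalso
      apply hmmax' (m - Int.gcd d (m - (j - i))) (by omega) (by omega)
      have := hmp.drop hg (by omega)
      rwa [show j - m + (Int.gcd d (m - (j - i)) : ℤ) = j - (m - Int.gcd d (m - (j - i))) by ring]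
        at this
  have hmod : (j - i) % d = m % d := Int.modEq_iff_dvd.2 hdvd
  have conv : ∀ t, ((j - i) / d + 8 < t / d ∨ t / d + 8 < (j - i) / d) →
      j - i + 8 * d < t ∨ t + 8 * d < j - i := by
    intro t ht
    have e1 := Int.emod_add_mul_ediv t d
    have e2 := Int.emod_add_mul_ediv (j - i) d
    have e3 := Int.emod_nonneg t hd0.ne'
    have e4 := Int.emod_nonneg (j - i) hd0.ne'
    have e5 := Int.emod_lt_of_pos t hd0
    have e6 := Int.emod_lt_of_pos (j - i) hd0
    rcases ht with ht | ht
    · left; nlinarith [mul_le_mul_of_nonneg_left (show (j - i) / d + 9 ≤ t / d by omega) hd0.le]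
    · right; nlinarith [mul_le_mul_of_nonneg_left (show t / d + 9 ≤ (j - i) / d by omega) hd0.le]
  have f1 := conv _ (hfar _ (.inl rfl) hmod)
  have f2 := conv _ (hfar _ (.inr (.inl rfl)) hmod)
  have f3 := conv _ (hfar _ (.inr (.inr rfl)) hmod)
  -- the runs of period `d` to the left of `j` and to the right of `k`
  have perl : Per f d (j - (d + r)) j := by
    intro t h1 h2
    have := hr (j - 1 - d - t) (by omega) (by omega)
    rw [show j - 1 - (j - 1 - d - t) = t + d by ring,
      show j - d - 1 - (j - 1 - d - t) = t by ring] at this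
    exact this.symm
  have perr : Per f d k (k + (d + r')) := by
    intro t h1 h2
    have := hr' (t - k) (by omega) (by omega)
    rw [show k + (t - k) = t by ring, show k + d + (t - k) = t + d by ring] at this
    exact this
  have hdn : d < n := by omega
  have nel : f (j - (d + r) - 1) ≠ f (j - (d + r) - 1 + d) := by
    rcases hrne with e | e
    · rw [show j - (d + r) - 1 + d = j - 1 - r by ring,
        show j - (d + r) - 1 = j - d - 1 - r by ring]
      exact fun e' => e e'.symm
    · exact (hs.aperiodic d hd0 hdn (perl.global hs.pos hs.periodic (by omega))).elim
  have ner : f (k + (d + r') - d) ≠ f (k + (d + r')) := by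
    rcases hrne' with e | e
    · rwa [show k + (d + r') - d = k + r' by ring, show k + (d + r') = k + d + r' by ring]
    · exact (hs.aperiodic d hd0 hdn (perr.global hs.pos hs.periodic (by omega))).elim
  have hrm : m ≤ d + r := by
    by_contra hc
    exact nel (per1 _ (by omega) (by omega))
  exact ⟨d, d + r, d + r', hd0, by omega, perl, nel, by omega, by omega, by omega, perr, ner,
    by omega⟩

/-! ### Products of four palindromes -/

/-- If a product of three palindromes starts and ends with the same letter, then it remains a
product of three palindromes without them. -/
theorem three_pal_inner {α : Type*} {f : ℤ → α} {x u v y : ℤ} (hxu : x ≤ u) (huv : u ≤ v)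
    (hvy : v ≤ y) (h1 : Pal f x u) (h2 : Pal f u v) (h3 : Pal f v y) (hl : x + 2 ≤ y)
    (he : f x = f (y - 1)) :
    ∃ u' v', x + 1 ≤ u' ∧ u' ≤ v' ∧ v' ≤ y - 1 ∧ Pal f (x + 1) u' ∧ Pal f u' v' ∧
      Pal f v' (y - 1) := by
  have whole : Pal f x y → ∃ u' v', x + 1 ≤ u' ∧ u' ≤ v' ∧ v' ≤ y - 1 ∧ Pal f (x + 1) u' ∧
      Pal f u' v' ∧ Pal f v' (y - 1) := fun h =>
    ⟨y - 1, y - 1, by omega, le_rfl, le_rfl, h.inner (r := 1) (by omega), Pal.empty _ le_rfl,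
      Pal.empty _ le_rfl⟩
  have main : ∀ u v, x < u → u ≤ v → v < y → Pal f x u → Pal f u v → Pal f v y →
      ∃ u' v', x + 1 ≤ u' ∧ u' ≤ v' ∧ v' ≤ y - 1 ∧ Pal f (x + 1) u' ∧
      Pal f u' v' ∧ Pal f v' (y - 1) := by
    intro u v hxu huv hvy h1 h2 h3
    rcases eq_or_lt_of_le (show x + 1 ≤ u by omega) with c | c
    · rcases eq_or_lt_of_le (show v + 1 ≤ y by omega) with c' | c'
      · exact ⟨v, v, by omega, le_rfl, by omega, c ▸ h2, Pal.empty _ le_rfl,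
          Pal.empty _ (by omega)⟩
      · exact ⟨v, v + 1, by omega, by omega, by omega, c ▸ h2, Pal.single _ _,
          h3.inner (r := 1) (by omega)⟩
    · rcases eq_or_lt_of_le (show v + 1 ≤ y by omega) with c' | c'
      · refine ⟨u - 1, u, by omega, by omega, by omega, h1.inner (r := 1) (by omega), ?_, ?_⟩
        · have := Pal.single f (u - 1); rwa [sub_add_cancel] at this
        · rw [← c']; simpa using h2
      · refine ⟨u - 1, v + 1, by omega, by omega, by omega, h1.inner (r := 1) (by omega),
          h2.outer ?_, h3.inner (r := 1) (by omega)⟩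
        have e1 := h1 x le_rfl hxu
        have e2 := h3 v le_rfl hvy
        rw [show x + u - 1 - x = u - 1 by ring] at e1
        rw [show v + y - 1 - v = y - 1 by ring] at e2
        rw [← e1, he, e2]
  rcases eq_or_lt_of_le hxu with c | c
  · subst c
    rcases eq_or_lt_of_le huv with c | c
    · subst c; exact whole h3
    rcases eq_or_lt_of_le hvy with c' | c'
    · subst c'; exact whole h2
    exact main v v c le_rfl c' h2 (Pal.empty _ le_rfl) h3
  rcases eq_or_lt_of_le hvy with c' | c'
  · subst c'
    rcases eq_or_lt_of_le huv with c' | c'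
    · subst c'; exact whole h1
    exact main u u c le_rfl c' h1 (Pal.empty _ le_rfl) h2
  exact main u v c huv c' h1 h2 h3

/-- If the circular word is a product of four palindromes, then one of them can be taken to be
maximal, and at least a quarter of the word. -/
theorem exists_long_maximal {f : ℤ → Letter} {n : ℤ} (hs : Simple f n)
    (hex : ∃ i j k p, HT f n i j k 0 p) :
    ∃ i j k p, HT f n i j k 0 p ∧ n ≤ 4 * (j - i) ∧ (n - 1 ≤ j - i ∨ f (i - 1) ≠ f j) := by
  by_contra hcon
  push Not at hcon
  obtain ⟨m, hm⟩ : ∃ m : ℕ, ∃ i j k p, HT f n i j k 0 p ∧ (n - (j - i)).toNat = m := by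
    obtain ⟨i, j, k, p, h⟩ := hex
    exact ⟨_, i, j, k, p, h, rfl⟩
  induction m using Nat.strong_induction_on with
  | _ m ih =>
    obtain ⟨i, j, k, p, h, hkm⟩ := hm
    have h1 := h.hij
    have h2 := h.hjk
    have h3 := h.hkp
    have h4 := h.hpi
    have hD := h.D
    have hE := h.E
    simp only [add_zero, sub_zero] at h3 h4 hD hE
    have noA : ∀ (i k : ℤ) t, 0 ≤ t → t < 0 → f (i - 1 - t) = (f (k + t)).comp :=
      fun _ _ t _ _ => by omega
    by_cases hlong : n ≤ 4 * (j - i)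
    · obtain ⟨c1, c2⟩ := hcon i j k p h hlong
      obtain ⟨u, v, hu, huv, hv, p1, p2, p3⟩ := three_pal_inner (x := j) (y := i + n) h2 h3 h4
        h.C hD hE (by omega)
        (by rw [← c2, ← hs.periodic]; congr 1; ring)
      refine ih ((n - (j + 1 - (i - 1))).toNat) (by omega)
        ⟨i - 1, j + 1, u, v, ?_, rfl⟩
      exact ⟨by omega, hu, le_rfl, by omega, by omega, h.B.outer c2, p1, noA _ _,
        by simpa using p2, by convert p3 using 1; ring⟩
    · -- rotate the factorization
      have r1 : HT f n j k p 0 (i + n) :=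
        ⟨h2, h3, le_rfl, by omega, by omega, h.C, hD, noA _ _, by simpa using hE,
          by simpa using h.B.shift hs.periodic⟩
      have r2 : HT f n k p (i + n) 0 (j + n) :=
        ⟨h3, h4, le_rfl, by omega, by omega, hD, hE, noA _ _,
          by simpa using h.B.shift hs.periodic, by simpa using h.C.shift hs.periodic⟩
      have r3 : HT f n p (i + n) (j + n) 0 (k + n) :=
        ⟨h4, by omega, le_rfl, by omega, by omega, hE, h.B.shift hs.periodic, noA _ _,
          by simpa using h.C.shift hs.periodic, by simpa using hD.shift hs.periodic⟩
      -- one of the other three palindromes is longer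
      by_cases c1 : j - i < k - j
      · exact ih _ (by omega) ⟨_, _, _, _, r1, rfl⟩
      by_cases c2 : j - i < p - k
      · exact ih _ (by omega) ⟨_, _, _, _, r2, rfl⟩
      · exact ih _ (by omega) ⟨_, _, _, _, r3, rfl⟩

/-- The composition of the reflections of two palindromes is a period. -/
theorem Pal.per_of_centers {α : Type*} {f : ℤ → α} {x y x' y' e : ℤ} (h : Pal f x y)
    (h' : Pal f x' y') (he : e = x' + y' - (x + y)) :
    Per f e (max x (x' - e)) (min (y + e) y') := fun t h1 h2 => by
  rw [h t (by omega) (by omega), h' _ (by omega) (by omega)]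
  congr 1; omega

theorem Pal.global {α : Type*} {f : ℤ → α} {n x y : ℤ} (hn : 0 < n)
    (hf : ∀ x, f (x + n) = f x) (h : Pal f x y) (hl : n - 1 ≤ y - x) :
    ∀ t, f t = f (x + y - 1 - t) := by
  have hp : ∀ s u, n ∣ u - s → f s = f u := fun s u hsu => by
    have hp : ∀ x y, Per f n x y := fun x y t _ _ => (hf t).symm
    exact (hp (min s u) (max s u + 1)).eq_of_dvd hn (by omega) (by omega) (by omega) (by omega) hsu
  intro t
  have hu0 := Int.emod_nonneg (t - x) hn.ne'
  have hu1 := Int.emod_lt_of_pos (t - x) hn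
  have h3 := Int.emod_add_mul_ediv (t - x) n
  have hdv : n ∣ x + (t - x) % n - t := ⟨-((t - x) / n), by linarith⟩
  have hdv' : n ∣ x + y - 1 - t - (x + y - 1 - (x + (t - x) % n)) :=
    ⟨-((t - x) / n), by linarith⟩
  rw [hp t _ hdv, ← hp _ _ hdv']
  by_cases c : x + (t - x) % n < y
  · exact h _ (by omega) c
  · apply hp
    exact ⟨-1, by omega⟩

/-- Two different palindromes cannot both cover the whole circular word, or all but one letter
of it. -/
theorem Simple.not_two_global {f : ℤ → Letter} {n x y x' y' : ℤ} (hs : Simple f n)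
    (h : Pal f x y) (h' : Pal f x' y') (hl : n - 1 ≤ y - x) (hl' : n - 1 ≤ y' - x')
    (h0 : x + y < x' + y') (h1 : x' + y' < x + y + n) : False := by
  apply hs.aperiodic (x' + y' - (x + y)) (by omega) (by omega)
  intro t
  rw [h'.global hs.pos hs.periodic hl', h.global hs.pos hs.periodic hl t]
  congr 1; ring

/-- Among maximal long palindromes with close centers, each one to the left of a longest one
starts where the first one starts: this is where their common run starts. -/
theorem left_eq_of_longest {f : ℤ → Letter} {n i j i₁ j₁ i' j' : ℤ} (hs : Simple f n)
    (h : Pal f i j) (h₁ : Pal f i₁ j₁) (h' : Pal f i' j')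
    (hmax : n - 1 ≤ j - i ∨ f (i - 1) ≠ f j) (hmax₁ : n - 1 ≤ j₁ - i₁ ∨ f (i₁ - 1) ≠ f j₁)
    (hl : n ≤ 4 * (j - i)) (hl₁ : n ≤ 4 * (j₁ - i₁))
    (hle : j - i ≤ j' - i') (hle₁ : j₁ - i₁ ≤ j' - i')
    (hc₁ : i₁ + j₁ ≤ i + j) (hc' : i + j < i' + j') (hc : 4 * (i' + j' - (i₁ + j₁)) < n) :
    i = i₁ := by
  have hn := hs.pos
  have hmax : f (i - 1) ≠ f j := hmax.resolve_left fun hh =>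
    hs.not_two_global h h' hh (by omega) (by omega) (by omega)
  have hmax₁ : f (i₁ - 1) ≠ f j₁ := hmax₁.resolve_left fun hh =>
    hs.not_two_global h₁ h' hh (by omega) (by omega) (by omega)
  obtain ⟨e, he⟩ : ∃ e, e = i' + j' - (i + j) := ⟨_, rfl⟩
  obtain ⟨e₁, he₁⟩ : ∃ e₁, e₁ = i + j - (i₁ + j₁) := ⟨_, rfl⟩
  have per : Per f e i (j + 1) := (h.per_of_centers h' he).mono (by omega) (by omega)
  have per₁ := h₁.per_of_centers h he₁
  rcases lt_trichotomy i i₁ with c | c | c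
  · exfalso
    apply hmax₁
    have e1 := h (i₁ - 1) (by omega) (by omega)
    rcases eq_or_lt_of_le hc₁ with c0 | c0
    · rw [e1]; congr 1; omega
    have u := (per.union per₁ (by omega) (by omega) (by omega)).2
    have e2 := u j₁ (by omega) (by omega)
    rw [e1, e2]; congr 1; omega
  · exact c
  · exfalso
    apply hmax
    rcases eq_or_lt_of_le hc₁ with c0 | c0
    · rw [h₁ (i - 1) (by omega) (by omega)]; congr 1; omega
    have u := (per.union per₁ (by omega) (by omega) (by omega)).1
    have e1 := u (i - 1) (by omega) (by omega)
    have e2 := h (i - 1 + e) (by omega) (by omega)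
    have e3 := per (j - e) (by omega) (by omega)
    rw [e1, e2, show i + j - 1 - (i - 1 + e) = j - e by ring, e3]; congr 1; ring

/-- Among maximal long palindromes with close centers, each one to the right of a longest one
ends where the last one ends. -/
theorem right_eq_of_longest {f : ℤ → Letter} {n i j i₁ j₁ i' j' : ℤ} (hs : Simple f n)
    (h : Pal f i j) (h₁ : Pal f i₁ j₁) (h' : Pal f i' j')
    (hmax : n - 1 ≤ j - i ∨ f (i - 1) ≠ f j) (hmax₁ : n - 1 ≤ j₁ - i₁ ∨ f (i₁ - 1) ≠ f j₁)
    (hl : n ≤ 4 * (j - i)) (hl₁ : n ≤ 4 * (j₁ - i₁))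
    (hle : j - i ≤ j' - i') (hle₁ : j₁ - i₁ ≤ j' - i')
    (hc₁ : i + j ≤ i₁ + j₁) (hc' : i' + j' < i + j) (hc : 4 * (i₁ + j₁ - (i' + j')) < n) :
    j = j₁ := by
  have conv : ∀ {x y}, Pal f x y → Pal (rev f) (-y) (-x) := fun {x y} hp => by
    rw [pal_rev]; simpa using hp
  have convm : ∀ {x y}, (n - 1 ≤ y - x ∨ f (x - 1) ≠ f y) →
      (n - 1 ≤ -x - -y ∨ rev f (-y - 1) ≠ rev f (-x)) := fun {x y} hp => by
    rcases hp with hp | hp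
    · left; omega
    · right
      simp only [rev]
      rw [show -1 - (-y - 1) = y by ring, show -1 - -x = x - 1 by ring]
      exact hp.symm
  have := left_eq_of_longest hs.rev (conv h) (conv h₁) (conv h') (convm hmax) (convm hmax₁)
    (by omega) (by omega) (by omega) (by omega) (by omega) (by omega) (by omega)
  omega

end HalfTurn

/-! ### Lists and periodic words -/

namespace HalfTurn

/-- The periodic word that repeats the list `w`, which is nonempty where this is used. -/
def wordFun (w : List Letter) (x : ℤ) : Letter := w.getD (x % w.length).toNat .u

/-- The factor of length `l` of `f` that starts at `x`. -/
def seg {α : Type*} (f : ℤ → α) (x : ℤ) (l : ℕ) : List α :=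
  (List.range l).map fun t : ℕ => f (x + (t : ℤ))

section seg

variable {α : Type*} (f : ℤ → α)

@[simp] theorem length_seg (x : ℤ) (l : ℕ) : (seg f x l).length = l := by simp [seg]

theorem getElem_seg (x : ℤ) (l t : ℕ) (h : t < (seg f x l).length) :
    (seg f x l)[t] = f (x + t) := by simp [seg]

theorem seg_add (x : ℤ) (a b : ℕ) : seg f x (a + b) = seg f x a ++ seg f (x + a) b := by
  simp only [seg, List.range_add, List.map_append, List.map_map]
  congr 1
  apply List.map_congr_left
  intro t _
  simp [add_assoc]

theorem palindrome_seg (x : ℤ) (l : ℕ) : (seg f x l).Palindrome ↔ Pal f x (x + l) := by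
  constructor
  · intro h t h1 h2
    have h3 := h.reverse_eq
    have h4 : (seg f x l).reverse[(t - x).toNat]? = (seg f x l)[(t - x).toNat]? := by rw [h3]
    rw [List.getElem?_reverse (by simp; omega), List.getElem?_eq_getElem (by simp; omega),
      List.getElem?_eq_getElem (by simp; omega), getElem_seg, getElem_seg, Option.some_inj] at h4
    simp only [length_seg] at h4
    rw [show x + ((t - x).toNat : ℤ) = t by omega] at h4
    rw [← h4]; congr 1; omega
  · intro h
    apply List.Palindrome.of_reverse_eq
    apply List.ext_getElem (by simp)
    intro t h1 h2
    rw [List.getElem_reverse, getElem_seg, getElem_seg]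
    simp only [length_seg, List.length_reverse] at *
    rw [h (x + t) (by omega) (by omega)]; congr 1; omega

end seg

theorem backtrack_eq_iff (f : ℤ → Letter) (x y : ℤ) (a : ℕ) :
    backtrack (seg f x a) = seg f y a ↔
      ∀ t : ℤ, 0 ≤ t → t < a → f (x + a - 1 - t) = (f (y + t)).comp := by
  constructor
  · intro h t h1 h2
    have h4 : (backtrack (seg f x a))[t.toNat]? = (seg f y a)[t.toNat]? := by rw [h]
    rw [backtrack, List.getElem?_map, List.getElem?_reverse (by simp; omega),
      List.getElem?_eq_getElem (by simp; omega), List.getElem?_eq_getElem (by simp; omega),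
      getElem_seg, getElem_seg, Option.map_some, Option.some_inj] at h4
    simp only [length_seg] at h4
    rw [show y + (t.toNat : ℤ) = y + t by omega] at h4
    rw [← h4, comp_comp]; congr 1; omega
  · intro h
    apply List.ext_getElem (by simp [backtrack])
    intro t h1 h2
    simp only [backtrack, List.getElem_map, List.getElem_reverse, getElem_seg]
    simp only [length_seg, backtrack, List.length_map, List.length_reverse] at *
    have := h t (by omega) (by omega)
    rw [← comp_comp (f (y + t)), ← this]; congr 2; omega

theorem wordFun_periodic (w : List Letter) (x : ℤ) :
    wordFun w (x + w.length) = wordFun w x := by simp [wordFun]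

theorem wordFun_natCast {w : List Letter} {t : ℕ} (h : t < w.length) :
    wordFun w t = w[t] := by
  have : ((t : ℤ) % w.length).toNat = t := by
    rw [Int.emod_eq_of_lt (by omega) (by omega)]; rfl
  simp [wordFun, this, h]

theorem seg_wordFun_isRotated {w : List Letter} (hw : w ≠ []) (x : ℤ) :
    w ~r seg (wordFun w) x w.length := by
  have hpos : (0 : ℤ) < w.length := by have := List.length_pos_of_ne_nil hw; omega
  refine ⟨(x % w.length).toNat, ?_⟩
  apply List.ext_getElem (by simp)
  intro t h1 h2
  rw [List.getElem_rotate, getElem_seg]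
  have h3 : (((t + (x % w.length).toNat) % w.length : ℕ) : ℤ) = (x + t) % w.length := by
    have := Int.emod_nonneg x hpos.ne'
    rw [Int.natCast_emod, Nat.cast_add, Int.toNat_of_nonneg this, Int.add_emod_emod, add_comm]
  have h4 : (t + (x % w.length).toNat) % w.length < w.length := Nat.mod_lt _ (by omega)
  simp only [wordFun, ← h3, Int.toNat_natCast]
  rw [List.getD_eq_getElem _ _ h4]

theorem hasHalfTurnFactorization_iff {w : List Letter} (hw : w ≠ []) :
    HasHalfTurnFactorization w ↔ ∃ i j k a p, HT (wordFun w) w.length i j k a p := by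
  constructor
  · rintro ⟨A, B, C, D, E, hB, hC, hD, hE, m, hm⟩
    have hlen : w.length = A.length + B.length + C.length + A.length + D.length + E.length := by
      have := congrArg List.length hm
      simp [backtrack] at this
      omega
    have hseg : seg (wordFun w) m w.length = A ++ B ++ C ++ backtrack A ++ D ++ E := by
      rw [← hm]
      apply List.ext_getElem (by simp)
      intro t h1 h2
      rw [List.getElem_rotate, getElem_seg]
      simp only [wordFun]
      have : ((m + t : ℤ) % w.length).toNat = (t + m) % w.length := by
        rw [add_comm, ← Nat.cast_add, ← Int.natCast_emod]; rfl
      rw [this, List.getD_eq_getElem]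
    rw [hlen] at hseg
    simp only [seg_add] at hseg
    have i5 := List.append_inj hseg (by simp [backtrack])
    have i4 := List.append_inj i5.1 (by simp [backtrack])
    have i3 := List.append_inj i4.1 (by simp)
    have i2 := List.append_inj i3.1 (by simp)
    have i1 := List.append_inj i2.1 (by simp)
    have hA := i3.2
    rw [← i1.1] at hA
    simp only [length_seg] at hA
    have hn : (w.length : ℤ) =
        A.length + B.length + C.length + A.length + D.length + E.length := by exact_mod_cast hlen
    refine ⟨m + A.length, m + A.length + B.length, m + A.length + B.length + C.length, A.length,
      m + A.length + B.length + C.length + A.length + D.length,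
      by omega, by omega, by omega, by omega, by omega, ?_, ?_, ?_, ?_, ?_⟩
    · rw [← i1.2, palindrome_seg] at hB; exact hB
    · rw [← i2.2, palindrome_seg] at hC; convert hC using 1 <;> (push_cast; ring)
    · have := (backtrack_eq_iff _ _ _ _).1 hA.symm
      intro t h1 h2
      rw [this t h1 h2]; congr 2; push_cast; ring
    · rw [← i4.2, palindrome_seg] at hD; convert hD using 1 <;> (push_cast; ring)
    · rw [← i5.2, palindrome_seg] at hE; convert hE using 1 <;> (push_cast; omega)
  · rintro ⟨i, j, k, a, p, h⟩
    obtain ⟨h1, h2, h3, h4, h5, hB, hC, hA, hD, hE⟩ := h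
    refine ⟨seg (wordFun w) (i - a) a.toNat, seg (wordFun w) i (j - i).toNat,
      seg (wordFun w) j (k - j).toNat, seg (wordFun w) (k + a) (p - (k + a)).toNat,
      seg (wordFun w) p (i + w.length - a - p).toNat, ?_, ?_, ?_, ?_, ?_⟩
    · rw [palindrome_seg]; convert hB using 1; omega
    · rw [palindrome_seg]; convert hC using 1; omega
    · rw [palindrome_seg]; convert hD using 1; omega
    · rw [palindrome_seg]; convert hE using 1; omega
    · have hb : backtrack (seg (wordFun w) (i - a) a.toNat) = seg (wordFun w) k a.toNat := by
        rw [backtrack_eq_iff]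
        intro t ht1 ht2
        rw [← hA t ht1 (by omega)]; congr 1; omega
      have hn : w.length = a.toNat + (j - i).toNat + (k - j).toNat + a.toNat +
          (p - (k + a)).toNat + (i + w.length - a - p).toNat := by omega
      have := seg_wordFun_isRotated hw (i - a)
      rw [hb]
      convert this using 1
      conv_rhs => rw [hn]
      simp only [seg_add]
      congr 1
      · congr 1
        · congr 1
          · congr 1
            · congr 1
              congr 1; omega
            · congr 1; push_cast; omega
          · congr 1; push_cast; omega
        · congr 1; push_cast; omega
      · congr 1; push_cast; omega

/-! ### Boundary words of polyominoes -/

theorem ne_nil_of_isBoundaryWord {P : Polyomino} {w : List Letter} (h : P.IsBoundaryWord w) :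
    w ≠ [] := by
  rintro rfl
  obtain ⟨p, -, -, hedge⟩ := h
  obtain ⟨⟨c, hc⟩⟩ := P.connected.nonempty
  -- the upper edge of a highest cell belongs to the boundary
  obtain ⟨b, hb, hmax⟩ := P.cells.exists_max_image (fun c => c.2) ⟨c, hc⟩
  obtain ⟨i, hi, -⟩ := (hedge (b.1, b.2 + 1) .r).1 (by
    refine ⟨by simpa [rightCell] using hb, fun hh => ?_⟩
    have := hmax _ hh
    simp [leftCell] at this)
  simp at hi

/-- A period `d < n` of the boundary word would make the displacement of `d` steps a zero vector, as
`n` times this displacement is `d` times that of the closed path, and so the path would return too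
early. -/
theorem simple_of_isBoundaryWord {P : Polyomino} {w : List Letter} (h : P.IsBoundaryWord w) :
    Simple (wordFun w) w.length := by
  have hw := ne_nil_of_isBoundaryWord h
  have hlen := List.length_pos_of_ne_nil hw
  obtain ⟨p, hclosed, hinj, hedge⟩ := h
  -- the displacement of the first `m` steps of the periodic path
  let S : ℕ → ℤ × ℤ := fun m => ∑ t ∈ Finset.range m, (wordFun w t).vec
  have hS : ∀ m ≤ w.length, pathVertex p w m = p + S m := by
    intro m hm
    rw [pathVertex]
    congr 1
    induction m with
    | zero => simp [S]
    | succ m ih =>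
      have hm' : m < w.length := by omega
      have := ih (by omega)
      simp only [S, Finset.sum_range_succ] at this ⊢
      rw [← this, wordFun_natCast hm', List.take_add_one, List.getElem?_eq_getElem hm',
        List.map_append, List.sum_append]
      simp
  have hS0 : S w.length = 0 := by
    have := hS w.length le_rfl
    rw [hclosed] at this
    simpa using this.symm
  have hmul : ∀ e : ℕ, (∀ x : ℤ, wordFun w (x + e) = wordFun w x) → ∀ m : ℕ,
      S (m * e) = m • S e := by
    intro e he m
    induction m with
    | zero => simp [S]
    | succ m ih =>
      have : S (m * e + e) = S (m * e) + S e := by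
        simp only [S, Finset.sum_range_add]
        congr 1
        apply Finset.sum_congr rfl
        intro t _
        congr 1
        have hk : ∀ (k : ℕ) (x : ℤ), wordFun w (x + k * e) = wordFun w x := by
          intro k
          induction k with
          | zero => simp
          | succ k ih' =>
            intro x
            rw [← ih' x, ← he (x + k * e)]; congr 1; push_cast; ring
        rw [← hk m (t : ℤ)]; congr 1; push_cast; ring
      rw [add_mul, one_mul, this, ih, add_smul, one_smul]
  refine ⟨by omega, wordFun_periodic w, ?_, ?_⟩
  · intro d h0 hd hper
    lift d to ℕ using h0.le
    have e1 := hmul d hper w.length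
    have e2 := hmul w.length (wordFun_periodic w) d
    rw [mul_comm, e2, hS0, smul_zero] at e1
    have e3 : S d = 0 := (smul_eq_zero.1 e1.symm).resolve_left (by omega)
    have := hinj 0 d (by omega) (by omega)
    rw [hS d (by omega), e3] at this
    simp [pathVertex] at this
  · intro x hx
    -- turning back, the path would have the same cell on both sides
    obtain ⟨t, ht, hxt⟩ : ∃ t : ℕ, t < w.length ∧ (x % w.length) = t := by
      have h1 := Int.emod_nonneg x (show (w.length : ℤ) ≠ 0 by omega)
      have h2 := Int.emod_lt_of_pos x (show (0 : ℤ) < w.length by omega)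
      exact ⟨(x % w.length).toNat, by omega, by omega⟩
    have hft : wordFun w x = w[t] := by
      rw [← wordFun_natCast ht]; simp [wordFun, hxt.symm]
    have hfs : wordFun w (x + 1) = wordFun w (t + 1) := by
      simp only [wordFun]; rw [← hxt]; simp
    have hstep : pathVertex p w (t + 1) = pathVertex p w t + (w[t]).vec := by
      simp only [pathVertex]
      rw [List.take_add_one, List.getElem?_eq_getElem ht, List.map_append, List.sum_append]
      simp [add_assoc]
    obtain ⟨s, hs, hsv⟩ : ∃ s, w[s]? = some (wordFun w (x + 1)) ∧
        pathVertex p w s = pathVertex p w (t + 1) := by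
      rcases Nat.lt_or_ge (t + 1) w.length with c | c
      · refine ⟨t + 1, ?_, rfl⟩
        rw [hfs, List.getElem?_eq_getElem c, ← wordFun_natCast c]; push_cast; rfl
      · have : t + 1 = w.length := by omega
        refine ⟨0, ?_, ?_⟩
        · rw [hfs, List.getElem?_eq_getElem hlen, ← wordFun_natCast hlen]
          have h5 := wordFun_periodic w 0
          rw [zero_add] at h5
          rw [Nat.cast_zero, ← h5, ← this]; push_cast; rfl
        · rw [this, hclosed]; simp [pathVertex]
    have e1 := (hedge (pathVertex p w t) w[t]).2 ⟨t, by simp [ht], rfl⟩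
    have e2 := (hedge _ _).2 ⟨s, hs, hsv⟩
    rw [hstep, hx, hft] at e2
    apply e1.2
    have e3 := e2.1
    cases hwt : w[t] <;> rw [hwt] at e3 <;>
      simpa [rightCell, leftCell, Letter.comp, Letter.vec, sub_eq_add_neg, add_assoc] using e3

end HalfTurn

/-! ### Reasoning about programs of the word RAM -/

namespace WordRAM

instance : Add Expr := ⟨.op .add⟩
instance : Sub Expr := ⟨.op .sub⟩
instance : Mul Expr := ⟨.op .mul⟩
instance : Div Expr := ⟨.op .div⟩
instance : Mod Expr := ⟨.op .mod⟩
instance (k : ℕ) : OfNat Expr k := ⟨.const k⟩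

namespace Expr

/-- The comparison `e < f`. -/
def lt (e f : Expr) : Expr := .op .lt e f

/-- The comparison `e = f`. -/
def eq (e f : Expr) : Expr := .op .eq e f

variable (σ : State) (M : ℕ) (e f : Expr)

@[simp] theorem eval_const (k : ℕ) : (const k).eval σ = k := rfl
@[simp] theorem eval_reg (k : ℕ) : (reg k).eval σ = σ.reg k := rfl
@[simp] theorem eval_read (a : ℕ) : (read a e).eval σ = σ.arr a (e.eval σ) := rfl
@[simp] theorem eval_ofNat (k : ℕ) : (no_index (OfNat.ofNat k) : Expr).eval σ = k := rfl
@[simp] theorem eval_add : (e + f).eval σ = e.eval σ + f.eval σ := rfl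
@[simp] theorem eval_sub : (e - f).eval σ = e.eval σ - f.eval σ := rfl
@[simp] theorem eval_mul : (e * f).eval σ = e.eval σ * f.eval σ := rfl
@[simp] theorem eval_div : (e / f).eval σ = e.eval σ / f.eval σ := rfl
@[simp] theorem eval_mod : (e % f).eval σ = e.eval σ % f.eval σ := rfl
@[simp] theorem eval_lt : (lt e f).eval σ = if e.eval σ < f.eval σ then 1 else 0 := rfl
@[simp] theorem eval_eq : (eq e f).eval σ = if e.eval σ = f.eval σ then 1 else 0 := rfl

@[simp] theorem fits_const (k : ℕ) : (const k).Fits M σ ↔ k < M := Iff.rfl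
@[simp] theorem fits_reg (k : ℕ) : (reg k).Fits M σ ↔ σ.reg k < M := Iff.rfl
@[simp] theorem fits_read (a : ℕ) :
    (read a e).Fits M σ ↔ e.Fits M σ ∧ σ.arr a (e.eval σ) < M := Iff.rfl
@[simp] theorem fits_ofNat (k : ℕ) : (no_index (OfNat.ofNat k) : Expr).Fits M σ ↔ k < M := Iff.rfl
@[simp] theorem fits_add :
    (e + f).Fits M σ ↔ e.Fits M σ ∧ f.Fits M σ ∧ e.eval σ + f.eval σ < M := Iff.rfl
@[simp] theorem fits_mul :
    (e * f).Fits M σ ↔ e.Fits M σ ∧ f.Fits M σ ∧ e.eval σ * f.eval σ < M := Iff.rfl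

@[simp] theorem fits_sub : (e - f).Fits M σ ↔ e.Fits M σ ∧ f.Fits M σ :=
  ⟨fun h => ⟨h.1, h.2.1⟩, fun h => ⟨h.1, h.2, by
    have : e.eval σ < M := by
      cases e <;> first | exact h.1 | exact h.1.2 | exact h.1.2.2
    exact lt_of_le_of_lt (Nat.sub_le _ _) this⟩⟩

theorem Fits.eval_lt {σ : State} {M : ℕ} {e : Expr} (h : e.Fits M σ) : e.eval σ < M := by
  cases e <;> first | exact h | exact h.2 | exact h.2.2

@[simp] theorem fits_div : (e / f).Fits M σ ↔ e.Fits M σ ∧ f.Fits M σ :=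
  ⟨fun h => ⟨h.1, h.2.1⟩, fun h => ⟨h.1, h.2, lt_of_le_of_lt (Nat.div_le_self _ _) h.1.eval_lt⟩⟩

@[simp] theorem fits_mod : (e % f).Fits M σ ↔ e.Fits M σ ∧ f.Fits M σ :=
  ⟨fun h => ⟨h.1, h.2.1⟩, fun h => ⟨h.1, h.2, lt_of_le_of_lt (Nat.mod_le _ _) h.1.eval_lt⟩⟩

theorem fits_lt (hM : 1 < M) : (lt e f).Fits M σ ↔ e.Fits M σ ∧ f.Fits M σ :=
  ⟨fun h => ⟨h.1, h.2.1⟩, fun h => ⟨h.1, h.2, by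
    show (lt e f).eval σ < M
    rw [Expr.eval_lt]; split <;> omega⟩⟩

theorem fits_eq (hM : 1 < M) : (eq e f).Fits M σ ↔ e.Fits M σ ∧ f.Fits M σ :=
  ⟨fun h => ⟨h.1, h.2.1⟩, fun h => ⟨h.1, h.2, by
    show (eq e f).eval σ < M
    rw [eval_eq]; split <;> omega⟩⟩

@[simp] theorem cost_const (k : ℕ) : (const k).cost = 1 := rfl
@[simp] theorem cost_reg (k : ℕ) : (reg k).cost = 1 := rfl
@[simp] theorem cost_ofNat (k : ℕ) : (no_index (OfNat.ofNat k) : Expr).cost = 1 := rfl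
@[simp] theorem cost_read (a : ℕ) : (read a e).cost = e.cost + 1 := rfl
@[simp] theorem cost_add : (e + f).cost = e.cost + f.cost + 1 := rfl
@[simp] theorem cost_sub : (e - f).cost = e.cost + f.cost + 1 := rfl
@[simp] theorem cost_mul : (e * f).cost = e.cost + f.cost + 1 := rfl
@[simp] theorem cost_div : (e / f).cost = e.cost + f.cost + 1 := rfl
@[simp] theorem cost_mod : (e % f).cost = e.cost + f.cost + 1 := rfl
@[simp] theorem cost_lt : (lt e f).cost = e.cost + f.cost + 1 := rfl
@[simp] theorem cost_eq : (eq e f).cost = e.cost + f.cost + 1 := rfl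

end Expr

infixr:60 " ;; " => Prog.seq

/-- On words with values less than `M`, the program `p` started in the state `σ` halts within
`t` steps, without overflow, in a state with the property `Q`. -/
def Run (M : ℕ) (p : Prog) (σ : State) (t : ℕ) (Q : State → Prop) : Prop :=
  ∃ s τ, s ≤ t ∧ Exec M p σ s τ ∧ Q τ

namespace Run

variable {M : ℕ} {p q : Prog} {σ : State} {s t : ℕ} {Q Q' : State → Prop}

theorem mono (h : Run M p σ s Q) (hst : s ≤ t) (hQ : ∀ τ, Q τ → Q' τ) : Run M p σ t Q' := by
  obtain ⟨u, τ, hu, he, hq⟩ := h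
  exact ⟨u, τ, hu.trans hst, he, hQ τ hq⟩

theorem seq (hst : s ≤ t) (h : Run M p σ s fun τ => Run M q τ (t - s) Q) :
    Run M (p ;; q) σ t Q := by
  obtain ⟨u, τ, hu, he, v, ρ, hv, he', hq⟩ := h
  exact ⟨u + v, ρ, by omega, .seq _ _ _ _ _ _ _ he he', hq⟩

theorem skip (h : Q σ) (ht : 1 ≤ t) : Run M .skip σ t Q := ⟨1, σ, ht, .skip σ, h⟩

theorem set {x : ℕ} {e : Expr} (he : e.Fits M σ) (ht : e.cost + 1 ≤ t)
    (h : Q ⟨Function.update σ.reg x (e.eval σ), σ.arr⟩) : Run M (.set x e) σ t Q :=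
  ⟨_, _, ht, .set x e σ he, h⟩

theorem set_seq {x : ℕ} {e : Expr} (he : e.Fits M σ) (ht : e.cost + 1 ≤ t)
    (h : Run M q ⟨Function.update σ.reg x (e.eval σ), σ.arr⟩ (t - (e.cost + 1)) Q) :
    Run M (.set x e ;; q) σ t Q := seq ht (set he le_rfl h)

theorem store {a : ℕ} {i e : Expr} (hi : i.Fits M σ) (he : e.Fits M σ)
    (ht : i.cost + e.cost + 1 ≤ t)
    (h : Q ⟨σ.reg, Function.update σ.arr a (Function.update (σ.arr a) (i.eval σ) (e.eval σ))⟩) :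
    Run M (.store a i e) σ t Q :=
  ⟨_, _, ht, .store a i e σ hi he, h⟩

theorem ite {e : Expr} (he : e.Fits M σ) (ht : e.cost + 1 ≤ t)
    (h1 : e.eval σ ≠ 0 → Run M p σ (t - (e.cost + 1)) Q)
    (h2 : e.eval σ = 0 → Run M q σ (t - (e.cost + 1)) Q) : Run M (.ite e p q) σ t Q := by
  by_cases c : e.eval σ = 0
  · obtain ⟨u, τ, hu, hx, hq⟩ := h2 c
    exact ⟨_, τ, by omega, .ite_false e p q σ τ u he c hx, hq⟩
  · obtain ⟨u, τ, hu, hx, hq⟩ := h1 c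
    exact ⟨_, τ, by omega, .ite_true e p q σ τ u he c hx, hq⟩

/-- A loop that runs as long as `k`, which decreases from `N` by one in each round, is
positive. -/
theorem loop {e : Expr} {b N : ℕ} {I : ℕ → State → Prop} (h0 : I N σ)
    (he : ∀ k σ, k ≤ N → I k σ → e.Fits M σ ∧ (e.eval σ ≠ 0 ↔ 0 < k))
    (hb : ∀ k σ, k < N → I (k + 1) σ → Run M p σ b (I k))
    (ht : N * (b + e.cost + 1) + e.cost + 1 ≤ t) : Run M (.loop e p) σ t (I 0) := by
  induction N generalizing σ t with
  | zero =>
    obtain ⟨h1, h2⟩ := he 0 σ le_rfl h0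
    exact ⟨_, σ, by omega, .loop_done e p σ h1 (by simpa using h2), h0⟩
  | succ N ih =>
    obtain ⟨h1, h2⟩ := he (N + 1) σ le_rfl h0
    obtain ⟨u, τ, hu, hx, hq⟩ := hb N σ (by omega) h0
    rw [add_mul] at ht
    obtain ⟨v, ρ, hv, hx', hq'⟩ := ih hq (fun k σ hk => he k σ (by omega))
      (fun k σ hk => hb k σ (by omega)) (le_refl _)
    exact ⟨_, ρ, by omega, .loop_step e p σ τ ρ u v h1 (by rw [h2]; omega) hx hx', hq'⟩

end Run

/-- The loop that executes `p` with the register `x` equal to `0`, `1`, …, as long as this is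
less than the value of `e`. -/
def forLoop (x : ℕ) (e : Expr) (p : Prog) : Prog :=
  .set x 0 ;; .loop (.lt (.reg x) e) (p ;; .set x (.reg x + 1))

theorem Run.forLoop {M : ℕ} {x N b t : ℕ} {e : Expr} {p : Prog} {σ : State}
    {I : ℕ → State → Prop} (hM : N + 1 < M)
    (h0 : I 0 ⟨Function.update σ.reg x 0, σ.arr⟩)
    (he : ∀ k σ, k ≤ N → I k σ → e.Fits M σ ∧ e.eval σ = N)
    (hb : ∀ k σ, k < N → σ.reg x = k → I k σ → Run M p σ b fun τ =>
      τ.reg x = k ∧ I (k + 1) ⟨Function.update τ.reg x (k + 1), τ.arr⟩)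
    (ht : N * (b + e.cost + 7) + e.cost + 5 ≤ t) :
    Run M (WordRAM.forLoop x e p) σ t (fun τ => τ.reg x = N ∧ I N τ) := by
  refine Run.set_seq (by simp; omega) (by simp; omega) ?_
  have := Run.loop (M := M) (e := .lt (.reg x) e) (p := p ;; .set x (.reg x + 1))
    (σ := ⟨Function.update σ.reg x 0, σ.arr⟩) (b := b + 4) (N := N)
    (I := fun k τ => τ.reg x = N - k ∧ I (N - k) τ) (t := t - ((0 : Expr).cost + 1))
    (by simpa using h0) ?_ ?_ ?_
  · exact this.mono le_rfl fun τ hτ => by simpa using hτ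
  · rintro k τ hk ⟨h1, h2⟩
    obtain ⟨h3, h4⟩ := he _ _ (by omega) h2
    constructor
    · rw [Expr.fits_lt _ _ _ _ (by omega)]
      exact ⟨by simp; omega, h3⟩
    · simp [h4, h1]; omega
  · rintro k τ hk ⟨h1, h2⟩
    refine Run.seq (s := b) (by omega) ((hb _ _ (by omega) h1 h2).mono le_rfl ?_)
    rintro ρ ⟨h3, h4⟩
    refine Run.set (by simp; omega) (by simp) ?_
    simp only [Expr.eval_add, Expr.eval_reg, Expr.eval_ofNat, h3]
    refine ⟨by simp; omega, ?_⟩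
    rwa [show N - k = N - (k + 1) + 1 by omega]
  · simp only [Expr.cost_lt, Expr.cost_reg, Expr.cost_ofNat]
    have : N * (b + 4 + (1 + e.cost + 1) + 1) = N * (b + e.cost + 7) := by ring
    omega

/-- Binary search, by descending powers of two, for the first offset at which a property fails.
When `test` is evaluated, register `62` holds the offset reached and register `61` holds a power
of two, with exponent in register `60`. The test tells whether the property holds in the block of
this length after the offset. The exponents start at the one in register `3`, whose power of two
is in register `4`. -/
def descend (test : Expr) : Prog :=
  .set 60 (.reg 3 + 1) ;; .set 61 (.reg 4 * 2) ;; .set 62 0 ;;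
    .loop (.reg 60) (.set 60 (.reg 60 - 1) ;; .set 61 (.reg 61 / 2) ;;
      .ite test (.set 62 (.reg 62 + .reg 61)) .skip)

theorem Run.descend {M T t : ℕ} {test : Expr} {σ : State} (P : ℕ → Prop)
    (hM : T + 2 < M) (hM' : 2 ^ (T + 2) < M) (h3 : σ.reg 3 = T) (h4 : σ.reg 4 = 2 ^ T)
    (htest : ∀ (τ : State) (k v : ℕ), k ≤ T → τ.arr = σ.arr → (∀ x < 60, τ.reg x = σ.reg x) →
      τ.reg 60 = k → τ.reg 61 = 2 ^ k → τ.reg 62 = v → v + 2 ^ k < 2 ^ (T + 1) →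
      (∀ u < v, P u) → test.Fits M τ ∧ (test.eval τ ≠ 0 ↔ ∀ u, v ≤ u → u < v + 2 ^ k → P u))
    (ht : (T + 1) * (test.cost + 15) + 20 ≤ t) :
    Run M (WordRAM.descend test) σ t fun τ => τ.arr = σ.arr ∧ (∀ x < 60, τ.reg x = σ.reg x) ∧
      τ.reg 62 < 2 ^ (T + 1) ∧ (∀ u < τ.reg 62, P u) ∧
      (τ.reg 62 + 1 < 2 ^ (T + 1) → ¬ P (τ.reg 62)) := by
  have e1 : 2 ^ (T + 1) = 2 ^ T * 2 := pow_succ ..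
  have e2 : 2 ^ (T + 2) = 2 ^ T * 4 := by rw [pow_add]; rfl
  have e3 := Nat.one_le_two_pow (n := T)
  refine Run.set_seq (by simp; omega) (by simp; omega) ?_
  refine Run.set_seq (by simp; omega) (by simp; omega) ?_
  refine Run.set_seq (by simp; omega) (by simp; omega) ?_
  have := Run.loop (M := M) (e := .reg 60) (p := .set 60 (.reg 60 - 1) ;;
      .set 61 (.reg 61 / 2) ;; .ite test (.set 62 (.reg 62 + .reg 61)) .skip)
    (σ := ⟨Function.update (Function.update (Function.update σ.reg 60 (T + 1)) 61 (2 ^ (T + 1)))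
      62 0, σ.arr⟩) (b := test.cost + 13) (N := T + 1)
    (I := fun k τ => τ.arr = σ.arr ∧ (∀ x < 60, τ.reg x = σ.reg x) ∧ τ.reg 60 = k ∧
      τ.reg 61 = 2 ^ k ∧ τ.reg 62 + 2 ^ k ≤ 2 ^ (T + 1) ∧ (∀ u < τ.reg 62, P u) ∧
      (τ.reg 62 + 2 ^ k < 2 ^ (T + 1) → ∃ u, u < τ.reg 62 + 2 ^ k ∧ ¬ P u))
    (t := t - ((Expr.reg 3 + 1).cost + 1) - ((Expr.reg 4 * 2).cost + 1) -
      ((0 : Expr).cost + 1)) ?_ ?_ ?_ ?_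
  · convert this.mono le_rfl ?_ using 2
    · simp [h3, h4, e1]
    · rintro τ ⟨h1, h2, -, -, h5, h6, h7⟩
      rw [pow_zero] at h5 h7
      refine ⟨h1, h2, by omega, h6, fun h8 h9 => ?_⟩
      obtain ⟨u, hu, hu'⟩ := h7 h8
      rcases Nat.lt_or_ge u (τ.reg 62) with c | c
      · exact hu' (h6 u c)
      · exact hu' ((show u = τ.reg 62 by omega) ▸ h9)
  · refine ⟨rfl, fun x hx => ?_, by simp, by simp, by simp, by simp, by simp⟩
    simp [Function.update, show x ≠ 60 by omega, show x ≠ 61 by omega, show x ≠ 62 by omega]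
  · rintro k τ hk ⟨-, -, h5, -⟩
    simp [h5]; omega
  · rintro k τ hk ⟨h1, h2, h5, h6, h7, h8, h9⟩
    have e4 : 2 ^ (k + 1) = 2 ^ k * 2 := pow_succ ..
    have e5 : 2 ^ (k + 1) ≤ 2 ^ (T + 1) := Nat.pow_le_pow_right (by norm_num) (by omega)
    have e6 := Nat.one_le_two_pow (n := k)
    refine Run.set_seq (by simp; omega) (by simp) ?_
    refine Run.set_seq (by simp; omega) (by simp) ?_
    have key := htest ⟨Function.update (Function.update τ.reg 60 k) 61 (2 ^ k), τ.arr⟩ k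
      (τ.reg 62) (by omega) h1
      (fun x hx => by
        simp [Function.update, show x ≠ 60 by omega, show x ≠ 61 by omega, h2 x hx])
      (by simp) (by simp) (by simp) (by omega) h8
    have est : (⟨Function.update (Function.update τ.reg 60 ((Expr.reg 60 - 1).eval τ)) 61
        ((Expr.reg 61 / 2).eval ⟨Function.update τ.reg 60 ((Expr.reg 60 - 1).eval τ), τ.arr⟩),
        τ.arr⟩ : State) = ⟨Function.update (Function.update τ.reg 60 k) 61 (2 ^ k), τ.arr⟩ := by
      simp [h5, h6, e4]
    rw [est]
    refine Run.ite key.1 (by simp) ?_ ?_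
    · intro hne
      have hall := key.2.1 hne
      refine Run.set (by simp; omega) (by simp) ?_
      refine ⟨h1, fun x hx => ?_, by simp, by simp, ?_, ?_, ?_⟩
      · simp [Function.update, show x ≠ 60 by omega, show x ≠ 61 by omega,
          show x ≠ 62 by omega, h2 x hx]
      · simp; omega
      · simp only [Expr.eval_add, Expr.eval_reg]
        intro u hu
        simp at hu
        rcases Nat.lt_or_ge u (τ.reg 62) with c | c
        · exact h8 u c
        · exact hall u c hu
      · simp only [Expr.eval_add, Expr.eval_reg]
        simp
        intro hh
        obtain ⟨u, hu, hu'⟩ := h9 (by omega)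
        exact ⟨u, by omega, hu'⟩
    · intro hz
      have hall := not_iff_not.2 key.2
      have hex := hall.1 (by simpa using hz)
      push Not at hex
      obtain ⟨u, hu1, hu2, hu3⟩ := hex
      refine Run.skip ?_ (by simp)
      refine ⟨h1, fun x hx => ?_, by simp, by simp, ?_, ?_, ?_⟩
      · simp [Function.update, show x ≠ 60 by omega, show x ≠ 61 by omega, h2 x hx]
      · simp; omega
      · simpa using h8
      · intro _
        exact ⟨u, by simpa using hu2, hu3⟩
  · simp only [Expr.cost_reg, Expr.cost_add, Expr.cost_mul, Expr.cost_ofNat]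
    have : (T + 1) * (test.cost + 13 + 1 + 1) = (T + 1) * (test.cost + 15) := by ring
    omega

end WordRAM

/-! ### Queries -/

namespace WordRAM

open HalfTurn

/-- The word, its reversal, and its complement. -/
def variant (f : ℤ → Letter) : ℕ → ℤ → Letter
  | 0 => f
  | 1 => rev f
  | _ => fun x => (f x).comp

theorem variant_periodic {f : ℤ → Letter} {n : ℕ} (hf : ∀ x, f (x + n) = f x) (z : ℕ) (x : ℤ) :
    variant f z (x + n) = variant f z x := by
  match z with
  | 0 => exact hf x
  | 1 =>
    have := hf (-1 - (x + n))
    simp only [variant, rev]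
    rw [← this]; congr 1; ring
  | _ + 2 => simp only [variant, hf]

theorem variant_mod {f : ℤ → Letter} {n : ℕ} (hf : ∀ x, f (x + n) = f x) (z x u : ℕ) :
    variant f z ((x % n : ℕ) + u) = variant f z (x + u) := by
  have key : ∀ (k : ℕ) (y : ℤ), variant f z (y + n * k) = variant f z y := by
    intro k
    induction k with
    | zero => simp
    | succ k ih =>
      intro y
      rw [← ih y, ← variant_periodic hf z (y + n * k)]; congr 1; push_cast; ring
  rw [← key (x / n)]
  congr 1
  have := Nat.mod_add_div x n
  zify at this
  push_cast
  linarith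

/-- Bounds on the length `n` of the word, on the number `T` of doublings, and on the values that
a machine word can hold, which have to include the addresses in the tables of maxima and in the
dictionaries for naming. -/
structure Bounds (M n T : ℕ) : Prop where
  pos : 0 < n
  lt_pow : n < 2 ^ T
  pow_le : 2 ^ T ≤ 2 * n
  table : 64 * ((T + 2) * n) + 1000 * n + 1000 ≤ M
  dict : (T + 2) * ((3 * n + 4) * (3 * n + 4)) + 3 * n + 4 ≤ M

namespace Bounds

variable {M n T : ℕ} (h : Bounds M n T)
include h

theorem lin : 1128 * n + 1000 ≤ M := by
  have := h.table
  rw [add_mul] at this; omega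

theorem T_le : T ≤ 2 * n := (Nat.lt_two_pow_self).le.trans h.pow_le

theorem pow_succ_le : 2 ^ (T + 1) ≤ 4 * n := by
  have := h.pow_le
  rw [pow_succ]; omega

theorem le_pow_succ : 2 * n + 2 ≤ 2 ^ (T + 1) := by
  have := h.lt_pow
  rw [pow_succ]; omega

theorem name_lt {k y : ℕ} (hk : k ≤ T + 1) (hy : y < 100 * n) : k * (3 * n) + y < M := by
  have h1 := h.table
  have h2 : k * n ≤ (T + 2) * n := Nat.mul_le_mul_right _ (by omega)
  have h3 : k * (3 * n) = 3 * (k * n) := by ring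
  omega

theorem max_lt {k y : ℕ} (hk : k ≤ T + 1) (hy : y < 100 * n) : k * (64 * n) + y < M := by
  have h1 := h.table
  have h2 : k * n ≤ (T + 2) * n := Nat.mul_le_mul_right _ (by omega)
  have h3 : k * (64 * n) = 64 * (k * n) := by ring
  omega

end Bounds

/-- The registers that hold constants. -/
structure Ctx (n T : ℕ) (ρ : ℕ → ℕ) : Prop where
  r1 : ρ 1 = n
  r2 : ρ 2 = 3 * n
  r3 : ρ 3 = T
  r4 : ρ 4 = 2 ^ T
  r5 : ρ 5 = 64 * n
  r6 : ρ 6 = 2 * n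

theorem Ctx.of_eq {n T : ℕ} {ρ ρ' : ℕ → ℕ} (h : Ctx n T ρ)
    (he : ∀ x, x < 9 → ρ' x = ρ x) : Ctx n T ρ' :=
  ⟨by rw [he 1 (by omega), h.r1], by rw [he 2 (by omega), h.r2], by rw [he 3 (by omega), h.r3],
    by rw [he 4 (by omega), h.r4], by rw [he 5 (by omega), h.r5], by rw [he 6 (by omega), h.r6]⟩

/-- The entries `k * (3 * n) + (z * n + x)`, for `k` up to `T`, of an array are names of the
factors of length `2 ^ k` of the word, its reversal and its complement: two factors have the same
name exactly if they are equal. -/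
structure NameTable (n T : ℕ) (f : ℤ → Letter) (a : ℕ → ℕ) : Prop where
  eq_iff : ∀ k ≤ T, ∀ z < 3, ∀ z' < 3, ∀ x < n, ∀ x' < n,
    (a (k * (3 * n) + (z * n + x)) = a (k * (3 * n) + (z' * n + x')) ↔
      ∀ u < 2 ^ k, variant f z ((x : ℕ) + (u : ℕ)) = variant f z' ((x' : ℕ) + (u : ℕ)))
  lt : ∀ k ≤ T, ∀ y < 3 * n, a (k * (3 * n) + y) < 3 * n + 4

/-- The entry `s` of an array is the radius of the maximal palindrome with center `s / 2`, that
is, on an interval `[i, j)` with `i + j = s`, of length at most `n`. -/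
structure RadTable (n : ℕ) (f : ℤ → Letter) (a : ℕ → ℕ) : Prop where
  le : ∀ s < 2 * n, 2 * a s + s % 2 ≤ n
  pal_iff : ∀ i j : ℕ, i ≤ j → j ≤ i + n → (Pal f i j ↔ (j - i) / 2 ≤ a ((i + j) % (2 * n)))

/-- The entry `k * (64 * n) + s`, for `k` up to `T`, of an array is the largest position that is
reached by palindromes with centers `u / 2`, for `s ≤ u < s + 2 ^ k`. A largest position is
described by its upper bounds. The range up to `32 * n` leaves room for all queries, with positions
up to `8 * n`. -/
def MaxTable (n T : ℕ) (rad a : ℕ → ℕ) : Prop :=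
  ∀ k ≤ T, ∀ s, s + 2 ^ k ≤ 32 * n → ∀ y, (a (k * (64 * n) + s) < y ↔
    ∀ u, s ≤ u → u < s + 2 ^ k → rad (u % (2 * n)) + (u + 1) / 2 < y)

/-- The tables for the word `f`, with the numbers of their arrays. -/
structure Tables (n T : ℕ) (f : ℤ → Letter) (o : ℕ) (A : ℕ → ℕ → ℕ) : Prop where
  name : NameTable n T f (A (2 + o))
  rad : RadTable n f (A (6 + o))
  max : MaxTable n T (A (6 + o)) (A (8 + o))

/-- The length of the longest common prefix of the variant `z` of the word at the position in
register `50` and the variant `z'` at the position in register `51`. The result is in register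
`62`. -/
def lce (o z z' : ℕ) : Prog :=
  descend (.eq
    (.read (2 + o) (.reg 60 * .reg 2 + (.const z * .reg 1 + (.reg 50 + .reg 62) % .reg 1)))
    (.read (2 + o) (.reg 60 * .reg 2 + (.const z' * .reg 1 + (.reg 51 + .reg 62) % .reg 1))))

theorem run_lce {M n T o z z' x x' : ℕ} {f : ℤ → Letter} {σ : State} (hb : Bounds M n T)
    (hf : ∀ x, f (x + n) = f x) (hc : Ctx n T σ.reg) (hA : NameTable n T f (σ.arr (2 + o)))
    (hz : z < 3) (hz' : z' < 3) (hx : σ.reg 50 = x) (hx' : σ.reg 51 = x')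
    (hxn : x ≤ 50 * n) (hxn' : x' ≤ 50 * n) :
    Run M (lce o z z') σ (100 * (T + 1)) fun τ =>
      τ.arr = σ.arr ∧ (∀ x < 60, τ.reg x = σ.reg x) ∧ τ.reg 62 < 2 ^ (T + 1) ∧
      (∀ u < τ.reg 62, variant f z (x + u) = variant f z' (x' + u)) ∧
      (τ.reg 62 + 1 < 2 ^ (T + 1) →
        variant f z (x + τ.reg 62) ≠ variant f z' (x' + τ.reg 62)) := by
  have hlin := hb.lin
  have hpos := hb.pos
  have hT := hb.T_le
  have hp := hb.pow_succ_le
  have hzn : z * n ≤ 2 * n := Nat.mul_le_mul_right _ (by omega)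
  have hzn' : z' * n ≤ 2 * n := Nat.mul_le_mul_right _ (by omega)
  refine Run.descend (fun u => variant f z (x + u) = variant f z' (x' + u))
    (by omega) (by rw [pow_succ]; omega) hc.r3 hc.r4 ?_ (by simp; omega)
  intro τ k v hk harr hreg h60 h61 h62 hv _
  have hm : (x + v) % n < n := Nat.mod_lt _ hpos
  have hm' : (x' + v) % n < n := Nat.mod_lt _ hpos
  have e1 : τ.reg 1 = n := by rw [hreg 1 (by omega), hc.r1]
  have e2 : τ.reg 2 = 3 * n := by rw [hreg 2 (by omega), hc.r2]
  have e50 : τ.reg 50 = x := by rw [hreg 50 (by omega), hx]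
  have e51 : τ.reg 51 = x' := by rw [hreg 51 (by omega), hx']
  have hkb := hb.name_lt (k := k) (y := 0) (by omega) (by omega)
  have b1 := hb.name_lt (k := k) (y := z * n + (x + v) % n) (by omega) (by omega)
  have b2 := hb.name_lt (k := k) (y := z' * n + (x' + v) % n) (by omega) (by omega)
  have l1 := hA.lt k hk (z * n + (x + v) % n) (by omega)
  have l2 := hA.lt k hk (z' * n + (x' + v) % n) (by omega)
  constructor
  · rw [Expr.fits_eq _ _ _ _ (by omega)]
    simp only [Expr.fits_read, Expr.fits_add, Expr.fits_mul, Expr.fits_mod, Expr.fits_reg,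
      Expr.fits_const, Expr.eval_reg, Expr.eval_const, Expr.eval_add, Expr.eval_mul,
      Expr.eval_mod, e1, e2, e50, e51, h60, h62, harr]
    refine ⟨⟨⟨⟨?_, ?_, ?_⟩, ⟨⟨?_, ?_, ?_⟩, ⟨⟨?_, ?_, ?_⟩, ?_⟩, ?_⟩, ?_⟩, ?_⟩,
      ⟨⟨⟨?_, ?_, ?_⟩, ⟨⟨?_, ?_, ?_⟩, ⟨⟨?_, ?_, ?_⟩, ?_⟩, ?_⟩, ?_⟩, ?_⟩⟩ <;> omega
  · simp only [Expr.eval_eq, Expr.eval_read, Expr.eval_reg, Expr.eval_const, Expr.eval_add,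
      Expr.eval_mul, Expr.eval_mod, e1, e2, e50, e51, h60, h62, harr]
    have key := hA.eq_iff k hk z hz z' hz' _ hm _ hm'
    have key' : (∀ u : ℕ, u < 2 ^ k → variant f z (((x + v) % n : ℕ) + (u : ℕ)) =
        variant f z' (((x' + v) % n : ℕ) + (u : ℕ))) ↔
        ∀ u : ℕ, v ≤ u → u < v + 2 ^ k → variant f z (x + u) = variant f z' (x' + u) := by
      simp only [variant_mod hf]
      constructor
      · intro h u h1 h2
        have := h (u - v) (by omega)
        push_cast [Nat.cast_sub h1] at this
        rw [show (x : ℤ) + v + (u - v) = x + u by ring,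
          show (x' : ℤ) + v + (u - v) = x' + u by ring] at this
        exact this
      · intro h u hu
        have := h (v + u) (by omega) (by omega)
        push_cast at this ⊢
        rw [add_assoc, add_assoc]; exact this
    rw [← key', ← key]
    split <;> simp_all

/-- The start of the longest palindromic suffix of the factor between the positions in registers
`50` and `51`. The result is in register `53`. -/
def longestSuffix (o : ℕ) : Prog :=
  .set 52 (.reg 50 + .reg 51) ;;
    descend (.lt (.read (8 + o) (.reg 60 * .reg 5 + (.reg 52 + .reg 62))) (.reg 51)) ;;
    .set 53 (.reg 50 + .reg 62)

theorem run_longestSuffix {M n T o x y : ℕ} {f : ℤ → Letter} {σ : State} (hb : Bounds M n T)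
    (hc : Ctx n T σ.reg) (hR : RadTable n f (σ.arr (6 + o)))
    (hX : MaxTable n T (σ.arr (6 + o)) (σ.arr (8 + o)))
    (hx : σ.reg 50 = x) (hy : σ.reg 51 = y) (hxy : x ≤ y) (hyx : y ≤ x + n)
    (hyn : y ≤ 8 * n) :
    Run M (longestSuffix o) σ (100 * (T + 1)) fun τ =>
      τ.arr = σ.arr ∧ (∀ x < 52, τ.reg x = σ.reg x) ∧ x ≤ τ.reg 53 ∧ τ.reg 53 ≤ y ∧
      Pal f (τ.reg 53) y ∧ ∀ i, x ≤ i → i < τ.reg 53 → ¬ Pal f i y := by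
  have hlin := hb.lin
  have hpos := hb.pos
  have hT := hb.T_le
  have hp := hb.pow_succ_le
  have hp' := hb.le_pow_succ
  -- a palindrome `[s - y, y)` exists exactly if the palindromes with center `s / 2` reach `y`
  have hpal : ∀ i, x ≤ i → i ≤ y → (Pal f i y ↔
      ¬ σ.arr (6 + o) ((i + y) % (2 * n)) + (i + y + 1) / 2 < y) := by
    intro i h1 h2
    rw [hR.pal_iff i y h2 (by omega)]; omega
  refine Run.set_seq (by simp; omega) (by simp; omega) ?_
  refine Run.seq (s := 100 * (T + 1) - 10) (by simp; omega) (Run.mono (Run.descend (T := T)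
    (fun u => σ.arr (6 + o) ((x + u + y) % (2 * n)) + (x + u + y + 1) / 2 < y)
    (t := 100 * (T + 1) - 10)
    (by omega) (by rw [pow_succ]; omega) (by simp [hc.r3]) (by simp [hc.r4]) ?_ (by simp; omega))
    le_rfl ?_)
  · intro τ k v hk harr hreg h60 h61 h62 hv hall
    have hvy : v ≤ y - x := by
      by_contra hcc
      have := hall (y - x) (by omega)
      rw [show x + (y - x) + y = y + y by omega] at this
      omega
    have e5 : τ.reg 5 = 64 * n := by rw [hreg 5 (by omega)]; simp [hc.r5]
    have e51 : τ.reg 51 = y := by rw [hreg 51 (by omega)]; simp [hy]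
    have e52 : τ.reg 52 = x + y := by rw [hreg 52 (by omega)]; simp [hx, hy]
    have hkb := hb.max_lt (k := k) (y := 0) (by omega) (by omega)
    have b1 := hb.max_lt (k := k) (y := x + y + v) (by omega) (by omega)
    have hpk : 2 ^ k ≤ 2 ^ (T + 1) := Nat.pow_le_pow_right (by norm_num) (by omega)
    have hmax := hX k hk (x + y + v) (by omega)
    have hval : σ.arr (8 + o) (k * (64 * n) + (x + y + v)) < M := by
      rw [hmax]
      intro u h1 h2
      have := hR.le (u % (2 * n)) (Nat.mod_lt _ (by omega))
      omega
    constructor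
    · rw [Expr.fits_lt _ _ _ _ (by omega)]
      simp only [Expr.fits_read, Expr.fits_add, Expr.fits_mul, Expr.fits_reg,
        Expr.eval_reg, Expr.eval_add, Expr.eval_mul, e5, e51, e52, h60, h62, harr]
      refine ⟨⟨⟨⟨?_, ?_, ?_⟩, ⟨?_, ?_, ?_⟩, ?_⟩, ?_⟩, ?_⟩ <;> omega
    · simp only [Expr.eval_lt, Expr.eval_read, Expr.eval_reg, Expr.eval_add, Expr.eval_mul,
        e5, e51, e52, h60, h62, harr]
      have key : (∀ u, x + y + v ≤ u → u < x + y + v + 2 ^ k →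
          σ.arr (6 + o) (u % (2 * n)) + (u + 1) / 2 < y) ↔ ∀ u, v ≤ u → u < v + 2 ^ k →
          σ.arr (6 + o) ((x + u + y) % (2 * n)) + (x + u + y + 1) / 2 < y := by
        constructor
        · intro h u h1 h2
          exact h (x + u + y) (by omega) (by omega)
        · intro h u h1 h2
          have := h (u - (x + y)) (by omega) (by omega)
          rwa [show x + (u - (x + y)) + y = u by omega] at this
      rw [← key, ← hmax y]
      split <;> simp_all
  · rintro τ ⟨harr, hreg, h1, h2, h3⟩
    have e50 : τ.reg 50 = x := by rw [hreg 50 (by omega)]; simp [hx]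
    have hle : τ.reg 62 ≤ y - x := by
      by_contra hcc
      have := h2 (y - x) (by omega)
      rw [show x + (y - x) + y = y + y by omega] at this
      omega
    refine Run.set (by simp [e50]; omega) (by simp; omega) ?_
    have e53 : (Expr.reg 50 + Expr.reg 62).eval τ = x + τ.reg 62 := by simp [e50]
    rw [e53]
    refine ⟨harr, fun r hr => ?_, ?_, ?_, ?_, ?_⟩
    · simp [Function.update, show r ≠ 53 by omega, hreg r (by omega), show r ≠ 52 by omega]
    · simp
    · simp; omega
    · simp only [Function.update_self]
      rw [hpal _ (by omega) (by omega)]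
      exact h3 (by omega)
    · simp only [Function.update_self]
      intro i hi hi'
      rw [hpal _ hi (by omega), not_not]
      have := h2 (i - x) (by omega)
      rwa [show x + (i - x) = i by omega] at this

/-- The test whether the factor between the positions `e` and `e'` is a palindrome. -/
def palTest (o : ℕ) (e e' : Expr) : Expr :=
  .lt ((e' - e) / 2) (.read (6 + o) ((e + e') % .reg 6) + 1)

theorem palTest_spec {M n T o x y : ℕ} {e e' : Expr} {f : ℤ → Letter} {σ : State}
    (hb : Bounds M n T) (hc : Ctx n T σ.reg) (hR : RadTable n f (σ.arr (6 + o)))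
    (he : e.eval σ = x) (he' : e'.eval σ = y) (hef : e.Fits M σ) (hef' : e'.Fits M σ)
    (hxy : x ≤ y) (hyx : y ≤ x + n) (hy : y ≤ 50 * n) :
    (palTest o e e').Fits M σ ∧ ((palTest o e e').eval σ ≠ 0 ↔ Pal f x y) := by
  have hlin := hb.lin
  have hpos := hb.pos
  have hr := hR.le ((x + y) % (2 * n)) (Nat.mod_lt _ (by omega))
  constructor
  · rw [palTest, Expr.fits_lt _ _ _ _ (by omega)]
    simp [he, he', hef, hef', hc.r6]
    omega
  · rw [hR.pal_iff x y hxy hyx]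
    simp [palTest, he, he', hc.r6]

/-- Whether the factor between the positions in registers `40` and `41` is a product of two
palindromes. The result is in register `42`. The tables `o'` are those of the reversed word. -/
def palPal (o o' : ℕ) : Prog :=
  .set 50 (.reg 40) ;; .set 51 (.reg 41) ;; longestSuffix o ;;
    .ite (palTest o (.reg 40) (.reg 53)) (.set 42 1)
      (.set 50 (8 * .reg 1 - .reg 41) ;; .set 51 (8 * .reg 1 - .reg 40) ;; longestSuffix o' ;;
        .ite (palTest o' (.reg 50) (.reg 53)) (.set 42 1) (.set 42 0))

theorem pal_rev_translate {f : ℤ → Letter} {n : ℕ} (hf : ∀ x, f (x + n) = f x) (c : ℕ)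
    (x y : ℤ) : Pal (rev f) (c * n - y) (c * n - x) ↔ Pal f x y := by
  have hf' : ∀ x, rev f (x + c * n) = rev f x := by
    induction c with
    | zero => simp
    | succ c ih =>
      intro x
      have := variant_periodic hf 1 (x + c * n)
      simp only [variant] at this
      rw [← ih x, ← this]; congr 1; push_cast; ring
  have hf'' : ∀ x, rev f (x + -(c * n)) = rev f x := fun x => by
    rw [← hf' (x + -(c * n))]; congr 1; ring
  constructor
  · intro h
    have := h.shift hf''
    rw [pal_rev] at this
    convert this using 1 <;> ring
  · intro h
    have : Pal (rev f) (-y) (-x) := by rw [pal_rev]; simpa using h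
    convert this.shift hf' using 1 <;> ring

theorem run_palPal {M n T o o' x y : ℕ} {f : ℤ → Letter} {σ : State} (hb : Bounds M n T)
    (hf : ∀ x, f (x + n) = f x) (hc : Ctx n T σ.reg) (hA : Tables n T f o σ.arr)
    (hA' : Tables n T (rev f) o' σ.arr)
    (hx : σ.reg 40 = x) (hy : σ.reg 41 = y) (hxy : x ≤ y) (hyx : y ≤ x + n)
    (hyn : y ≤ 8 * n) :
    Run M (palPal o o') σ (300 * (T + 1)) fun τ =>
      τ.arr = σ.arr ∧ (∀ x < 40, τ.reg x = σ.reg x) ∧ τ.reg 42 < 2 ∧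
      (τ.reg 42 ≠ 0 ↔ ∃ m : ℤ, x ≤ m ∧ m ≤ y ∧ Pal f x m ∧ Pal f m y) := by
  have hlin := hb.lin
  have hpos := hb.pos
  refine Run.set_seq (by simp; omega) (by simp; omega) ?_
  refine Run.set_seq (by simp; omega) (by simp; omega) ?_
  refine Run.seq (s := 100 * (T + 1)) (by simp; omega) (Run.mono (run_longestSuffix (x := x)
    (y := y) hb (hc.of_eq fun r hr => ?_) hA.rad hA.max (by simp [hx]) (by simp [hy]) hxy hyx hyn)
    le_rfl ?_)
  · simp [Function.update, show r ≠ 50 by omega, show r ≠ 51 by omega]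
  rintro τ ⟨harr, hreg, h1, h2, h3, h4⟩
  simp only at harr
  have hreg' : ∀ r < 42, τ.reg r = σ.reg r := fun r hr => by
    rw [hreg r (by omega)]
    simp [Function.update, show r ≠ 50 by omega, show r ≠ 51 by omega]
  have hc' : Ctx n T τ.reg := hc.of_eq fun r hr => hreg' r (by omega)
  have e40 : τ.reg 40 = x := by rw [hreg' 40 (by omega), hx]
  have e41 : τ.reg 41 = y := by rw [hreg' 41 (by omega), hy]
  have p1 := palTest_spec (o := o) (e := .reg 40) (e' := .reg 53) (x := x) (y := τ.reg 53)
    (σ := τ) hb hc' (harr ▸ hA.rad) (by simp [e40]) (by simp) (by simp [e40]; omega)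
    (by simp; omega) h1 (by omega) (by omega)
  refine Run.ite p1.1 (by simp [palTest]; omega) ?_ ?_
  · intro hp
    refine Run.set (by simp; omega) (by simp [palTest]; omega) ?_
    refine ⟨harr, fun r hr => ?_, by simp, ?_⟩
    · simp [Function.update, show r ≠ 42 by omega, hreg' r (by omega)]
    · simp only [Function.update_self, Expr.eval_ofNat, ne_eq, one_ne_zero, not_false_eq_true,
        true_iff]
      exact ⟨τ.reg 53, by omega, by omega, p1.2.1 hp, h3⟩
  intro hp
  have hnp : ¬ Pal f x (τ.reg 53) := fun h => p1.2.2 h hp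
  refine Run.set_seq (by simp [hc'.r1, e41]; omega) (by simp [palTest]; omega) ?_
  refine Run.set_seq (by simp [hc'.r1, e40]; omega) (by simp [palTest]; omega) ?_
  refine Run.seq (s := 100 * (T + 1)) (by simp [palTest]; omega) (Run.mono (run_longestSuffix
    (x := 8 * n - y) (y := 8 * n - x) hb (hc'.of_eq fun r hr => ?_) (harr ▸ hA'.rad)
    (harr ▸ hA'.max) (by simp [hc'.r1, e41]) (by simp [hc'.r1, e40]) (by omega) (by omega)
    (by omega)) le_rfl ?_)
  · simp [Function.update, show r ≠ 50 by omega, show r ≠ 51 by omega]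
  rintro ρ ⟨harr', hreg2, g1, g2, g3, g4⟩
  simp only at harr'
  have hregρ : ∀ r < 42, ρ.reg r = σ.reg r := fun r hr => by
    rw [hreg2 r (by omega), ← hreg' r hr]
    simp [Function.update, show r ≠ 50 by omega, show r ≠ 51 by omega]
  have hc'' : Ctx n T ρ.reg := hc.of_eq fun r hr => hregρ r (by omega)
  have e50 : ρ.reg 50 = 8 * n - y := by
    rw [hreg2 50 (by omega)]; simp [hc'.r1, e41]
  have p2 := palTest_spec (o := o') (e := .reg 50) (e' := .reg 53) (x := 8 * n - y)
    (y := ρ.reg 53) (σ := ρ) hb hc'' (by rw [harr', harr]; exact hA'.rad) (by simp [e50])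
    (by simp) (by simp [e50]; omega) (by simp; omega) g1 (by omega) (by omega)
  -- the prefix that corresponds to the suffix in the reversed word
  have cast1 : ((8 * n - y : ℕ) : ℤ) = ((8 : ℕ) : ℤ) * n - y := by
    push_cast [Nat.cast_sub hyn]; ring
  have cast2 : ((8 * n - x : ℕ) : ℤ) = ((8 : ℕ) : ℤ) * n - x := by
    push_cast [Nat.cast_sub (show x ≤ 8 * n by omega)]; ring
  obtain ⟨k, hk⟩ : ∃ k : ℤ, k = ((8 : ℕ) : ℤ) * n - ρ.reg 53 := ⟨_, rfl⟩
  have hk' : (ρ.reg 53 : ℤ) = ((8 : ℕ) : ℤ) * n - k := by omega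
  rw [cast2, hk', pal_rev_translate hf] at g3
  rw [cast1, hk', pal_rev_translate hf] at p2
  refine Run.ite p2.1 (by simp [palTest]; omega) ?_ ?_
  · intro hp'
    refine Run.set (by simp; omega) (by simp [palTest]; omega) ?_
    refine ⟨harr'.trans harr, fun r hr => ?_, by simp, ?_⟩
    · simp [Function.update, show r ≠ 42 by omega, hregρ r (by omega)]
    · simp only [Function.update_self, Expr.eval_ofNat, ne_eq, one_ne_zero, not_false_eq_true,
        true_iff]
      exact ⟨k, by omega, by omega, g3, p2.2.1 hp'⟩
  · intro hp'
    have hnp' : ¬ Pal f k y := fun h => p2.2.2 h hp'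
    refine Run.set (by simp; omega) (by simp [palTest]; omega) ?_
    refine ⟨harr'.trans harr, fun r hr => ?_, by simp, ?_⟩
    · simp [Function.update, show r ≠ 42 by omega, hregρ r (by omega)]
    · simp only [Function.update_self, Expr.eval_ofNat, ne_eq, not_true_eq_false, false_iff]
      rintro ⟨m, hm1, hm2, hm3, hm4⟩
      have hi : (τ.reg 53 : ℤ) ≤ m := by
        by_contra hlt
        lift m to ℕ using (by omega)
        exact h4 m (by omega) (by omega) hm4
      have hmk : m ≤ k := by
        by_contra hlt
        apply g4 ((8 : ℕ) * n - m).toNat (by omega) (by omega)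
        rw [cast2, show ((((8 : ℕ) * n - m).toNat : ℕ) : ℤ) = ((8 : ℕ) : ℤ) * n - m by omega,
          pal_rev_translate hf]
        exact hm3
      rcases pal_pal_longest hm3 hm4 h3 g3 (by omega) hi hmk (by omega) with h | h
      · exact hnp h
      · exact hnp' h

end WordRAM

/-! ### Searching for a factorization -/

namespace WordRAM

open HalfTurn

/-- On words with values less than `M`, the program `p` started in the state `σ` halts within `t`
steps and changes nothing but registers from `x` on and the answer in register `9`. The answer is
set to `1` or left alone; it is set only if `H` holds, and it is `1` in the end if `P` holds. -/
def Search (M : ℕ) (H : Prop) (x : ℕ) (p : Prog) (σ : State) (t : ℕ) (P : Prop) : Prop :=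
  Run M p σ t fun τ => τ.arr = σ.arr ∧ (∀ y < x, y ≠ 9 → τ.reg y = σ.reg y) ∧
    (τ.reg 9 = σ.reg 9 ∨ τ.reg 9 = 1 ∧ H) ∧ (P → τ.reg 9 = 1)

namespace Search

variable {M x s t : ℕ} {H P P' : Prop} {p q : Prog} {σ : State}

theorem mono (h : Search M H x p σ s P) (hst : s ≤ t) (hP : P' → P) : Search M H x p σ t P' :=
  Run.mono h hst fun _ ⟨h1, h2, h3, h4⟩ => ⟨h1, h2, h3, fun h => h4 (hP h)⟩

theorem of_le {y : ℕ} (hy : y ≤ x) (h : Search M H x p σ t P) : Search M H y p σ t P :=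
  Run.mono h le_rfl fun _ ⟨h1, h2, h3⟩ => ⟨h1, fun z hz => h2 z (hz.trans_le hy), h3⟩

theorem imp {H' : Prop} (h : Search M H x p σ t P) (hH : H → H') : Search M H' x p σ t P :=
  Run.mono h le_rfl fun _ ⟨h1, h2, h3, h4⟩ => ⟨h1, h2, h3.imp_right fun h => ⟨h.1, hH h.2⟩, h4⟩

theorem skip (hP : ¬ P) (ht : 1 ≤ t) : Search M H x .skip σ t P :=
  Run.skip ⟨rfl, fun _ _ _ => rfl, .inl rfl, fun h => (hP h).elim⟩ ht

theorem found (hH : H) (hM : 1 < M) (ht : 2 ≤ t) : Search M H x (.set 9 1) σ t P := by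
  refine Run.set (by simpa using hM) (by simpa using ht) ⟨rfl, fun y _ hy => ?_,
    .inr ⟨by simp, hH⟩, fun _ => by simp⟩
  simp [Function.update, hy]

theorem ite {e : Expr} (he : e.Fits M σ) (ht : e.cost + 1 ≤ t)
    (h1 : e.eval σ ≠ 0 → Search M H x p σ (t - (e.cost + 1)) P)
    (h2 : e.eval σ = 0 → Search M H x q σ (t - (e.cost + 1)) P) :
    Search M H x (.ite e p q) σ t P := Run.ite he ht h1 h2

theorem set {y : ℕ} {e : Expr} (hy : x ≤ y) (h9 : y ≠ 9) (he : e.Fits M σ) (ht : e.cost + 1 ≤ t)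
    (h : Search M H x q ⟨Function.update σ.reg y (e.eval σ), σ.arr⟩ (t - (e.cost + 1)) P) :
    Search M H x (.set y e ;; q) σ t P := by
  refine Run.set_seq he ht (Run.mono h le_rfl ?_)
  rintro τ ⟨h1, h2, h3, h4⟩
  refine ⟨h1, fun z hz hz' => ?_, ?_, h4⟩
  · rw [h2 z hz hz']; simp [Function.update, show z ≠ y by omega]
  · simpa [Function.update, h9.symm] using h3

theorem seq {Q : State → Prop} (hst : s ≤ t) (h : Run M p σ s fun τ => τ.arr = σ.arr ∧
      (∀ y < x, τ.reg y = σ.reg y) ∧ Q τ) (h9 : 9 < x)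
    (hq : ∀ τ, τ.arr = σ.arr → (∀ y < x, τ.reg y = σ.reg y) → Q τ →
      Search M H x q τ (t - s) P) : Search M H x (p ;; q) σ t P := by
  refine Run.seq hst (Run.mono h le_rfl ?_)
  rintro τ ⟨h1, h2, h3⟩
  refine Run.mono (hq τ h1 h2 h3) le_rfl ?_
  rintro ρ ⟨g1, g2, g3, g4⟩
  exact ⟨g1.trans h1, fun y hy hy' => (g2 y hy hy').trans (h2 y hy), by rwa [← h2 9 h9], g4⟩

theorem seq_search (hst : s ≤ t) (h : Search M H x p σ s P)
    (hq : ∀ τ, τ.arr = σ.arr → (∀ y < x, y ≠ 9 → τ.reg y = σ.reg y) →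
      Search M H x q τ (t - s) P') : Search M H x (p ;; q) σ t (P ∨ P') := by
  refine Run.seq hst (Run.mono h le_rfl ?_)
  rintro τ ⟨h1, h2, h3, h4⟩
  refine Run.mono (hq τ h1 h2) le_rfl ?_
  rintro ρ ⟨g1, g2, g3, g4⟩
  refine ⟨g1.trans h1, fun y hy hy' => (g2 y hy hy').trans (h2 y hy hy'), ?_, ?_⟩
  · rcases g3 with g | g
    · rw [g]; exact h3
    · exact .inr g
  · rintro (h | h)
    · rcases g3 with g | g
      · rw [g, h4 h]
      · exact g.1
    · exact g4 h

theorem forLoop {N b : ℕ} {e : Expr} {P : ℕ → Prop} (h9 : 9 < x) (hM : N + 1 < M)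
    (he : ∀ τ : State, τ.arr = σ.arr → (∀ y < x, y ≠ 9 → τ.reg y = σ.reg y) →
      e.Fits M τ ∧ e.eval τ = N)
    (hb : ∀ (k : ℕ) (τ : State), k < N → τ.reg x = k → τ.arr = σ.arr →
      (∀ y < x, y ≠ 9 → τ.reg y = σ.reg y) → Search M H (x + 1) p τ b (P k))
    (ht : N * (b + e.cost + 7) + e.cost + 5 ≤ t) :
    Search M H x (WordRAM.forLoop x e p) σ t (∃ k < N, P k) := by
  refine Run.mono (Run.forLoop (N := N) (b := b) (I := fun k τ => τ.arr = σ.arr ∧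
    (∀ y < x, y ≠ 9 → τ.reg y = σ.reg y) ∧ (τ.reg 9 = σ.reg 9 ∨ τ.reg 9 = 1 ∧ H) ∧
    ((∃ v < k, P v) → τ.reg 9 = 1)) hM ?_ ?_ ?_ ht) le_rfl ?_
  · refine ⟨rfl, fun y hy _ => ?_, .inl ?_, ?_⟩
    · simp [Function.update, hy.ne]
    · simp [Function.update, h9.ne]
    · rintro ⟨v, hv, -⟩; omega
  · rintro k τ - ⟨h1, h2, -⟩
    exact he τ h1 h2
  · rintro k τ hk hx ⟨h1, h2, h3, h4⟩
    refine Run.mono (hb k τ hk hx h1 h2) le_rfl ?_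
    rintro ρ ⟨g1, g2, g3, g4⟩
    refine ⟨by rw [g2 x (by omega) (by omega), hx], g1.trans h1, fun y hy hy' => ?_, ?_, ?_⟩
    · simp [Function.update, hy.ne, g2 y (by omega) hy', h2 y hy hy']
    · simp only [Function.update, h9.ne, dite_false]
      rcases g3 with g | g
      · rw [g]; exact h3
      · exact .inr g
    · simp only [Function.update, h9.ne, dite_false]
      rintro ⟨v, hv, hP⟩
      rcases Nat.lt_or_ge v k with c | c
      · rcases g3 with g | g
        · rw [g, h4 ⟨v, c, hP⟩]
        · exact g.1
      · exact g4 ((show v = k by omega) ▸ hP)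
  · rintro τ ⟨-, h⟩
    exact h

end Search

/-- The test whether there is a half-turn factorization with `B` between the positions in
registers `30` and `31` and `C` between those in registers `31` and `32`, where `C` is a
palindrome and `A` is as long as possible. -/
def check (o o' : ℕ) : Prog :=
  .ite (palTest o (.reg 30) (.reg 31))
    (.set 50 (8 * .reg 1 - .reg 30) ;; .set 51 (.reg 32) ;; lce o 1 2 ;; .set 33 (.reg 62) ;;
      .ite (.lt (.reg 30 + .reg 1) (.reg 32 + 2 * .reg 33)) .skip
        (.set 40 (.reg 32 + .reg 33) ;; .set 41 (.reg 30 + .reg 1 - .reg 33) ;; palPal o o' ;;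
          .ite (.reg 42) (.set 9 1) .skip))
    .skip

theorem periodic_mul {f : ℤ → Letter} {n : ℤ} (hf : ∀ x, f (x + n) = f x) (c : ℤ) (x : ℤ) :
    f (x + c * n) = f x := by
  induction c with
  | zero => simp
  | succ c ih => rw [← ih, ← hf (x + c * n)]; congr 1; ring
  | pred c ih => rw [← ih, ← hf (x + (-c - 1) * n)]; congr 1; ring

theorem variant_one {f : ℤ → Letter} {n : ℕ} (hf : ∀ x, f (x + n) = f x) {x c : ℕ}
    (h : x ≤ c * n) (u : ℕ) : variant f 1 ((c * n - x : ℕ) + u) = f (x - 1 - u) := by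
  simp only [variant, rev]
  rw [← periodic_mul hf c]; congr 1; push_cast [Nat.cast_sub h]; ring

theorem search_check {M n T o o' i j k : ℕ} {f : ℤ → Letter} {σ : State} (hb : Bounds M n T)
    (hs : Simple f n) (hc : Ctx n T σ.reg) (hA : Tables n T f o σ.arr)
    (hA' : Tables n T (rev f) o' σ.arr) (hi : σ.reg 30 = i) (hj : σ.reg 31 = j)
    (hk : σ.reg 32 = k) (hij : i ≤ j) (hjk : j ≤ k) (hki : k ≤ i + n) (hk5 : k ≤ 5 * n)
    (hC : Pal f j k) :
    Search M (∃ i j k a p, HT f n i j k a p) 33 (check o o') σ (500 * (T + 1))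
      (∃ a p, 0 < a ∧ HT f n i j k a p) := by
  have hlin := hb.lin
  have hpos := hb.pos
  have hp := hb.pow_succ_le
  have hp' := hb.le_pow_succ
  have hf := hs.periodic
  have p1 := palTest_spec (o := o) (e := .reg 30) (e' := .reg 31) (x := i) (y := j)
    (σ := σ) hb hc hA.rad (by simp [hi]) (by simp [hj]) (by simp [hi]; omega)
    (by simp [hj]; omega) hij (by omega) (by omega)
  refine Search.ite p1.1 (by simp [palTest]; omega) (fun hB => ?_) fun hB => ?_
  swap
  · exact Search.skip (fun ⟨a, p, _, h⟩ => p1.2.2 h.B hB) (by simp [palTest]; omega)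
  have hB := p1.2.1 hB
  refine Search.set (by omega) (by omega) (by simp [hi, hc.r1]; omega)
    (by simp [palTest]; omega) ?_
  refine Search.set (by omega) (by omega) (by simp [hk]; omega)
    (by simp [palTest]; omega) ?_
  refine Search.seq (s := 100 * (T + 1)) (by simp [palTest]; omega)
    (Run.mono (run_lce (x := 8 * n - i) (x' := k) hb hf (hc.of_eq fun r hr => ?_) hA.name
      (by omega) (by omega) (by simp [hi, hc.r1]) (by simp [hk]) (by omega) (by omega)) le_rfl
      fun τ ⟨h1, h2, h3⟩ => ⟨h1, fun y hy => h2 y (by omega), h3⟩) (by omega) ?_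
  · simp [Function.update, show r ≠ 50 by omega, show r ≠ 51 by omega]
  rintro τ harr hreg ⟨h1, h2, h3⟩
  simp only at harr
  have hreg' : ∀ r < 33, τ.reg r = σ.reg r := fun r hr => by
    rw [hreg r (by omega)]
    simp [Function.update, show r ≠ 50 by omega, show r ≠ 51 by omega]
  have hc' : Ctx n T τ.reg := hc.of_eq fun r hr => hreg' r (by omega)
  have e30 : τ.reg 30 = i := by rw [hreg' 30 (by omega), hi]
  have e32 : τ.reg 32 = k := by rw [hreg' 32 (by omega), hk]
  obtain ⟨a, ha⟩ : ∃ a, τ.reg 62 = a := ⟨_, rfl⟩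
  rw [ha] at h1 h2 h3
  simp only [variant_one hf (show i ≤ 8 * n by omega)] at h2 h3
  simp only [variant] at h2 h3
  -- the mirror image of `A` is maximal in each factorization
  have hmax : ∀ a' p, 0 < a' → HT f n i j k a' p → k + 2 * a ≤ i + n ∧ a' = a := by
    intro a' p ha' h
    have hne := h.outer_ne hs ha'
    have h5 := h.hkp
    have h6 := h.hpi
    rcases lt_trichotomy a' a with c | c | c
    · exfalso
      apply hne
      have := h2 a'.toNat (by omega)
      rw [show ((a'.toNat : ℕ) : ℤ) = a' by omega] at this
      rw [← this]; congr 1; ring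
    · exact ⟨by omega, c⟩
    · exfalso
      exact h3 (by omega) (h.A a (by omega) c)
  refine Search.set (by omega) (by omega) (by simp [ha]; omega) (by simp [palTest]; omega) ?_
  refine Search.ite ?_ (by simp [palTest]; omega) (fun hlt => ?_) fun hlt => ?_
  · rw [Expr.fits_lt _ _ _ _ (by omega)]
    simp [e30, e32, hc'.r1, ha]; omega
  · simp [e30, e32, hc'.r1, ha] at hlt
    refine Search.skip ?_ (by simp [palTest]; omega)
    rintro ⟨a', p, ha', h⟩
    have := (hmax a' p ha' h).1
    omega
  simp [e30, e32, hc'.r1, ha] at hlt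
  refine Search.set (by omega) (by omega) (by simp [e32, ha]; omega) (by simp [palTest]; omega) ?_
  refine Search.set (by omega) (by omega) (by simp [e30, ha, hc'.r1]; omega)
    (by simp [palTest]; omega) ?_
  refine Search.seq (s := 300 * (T + 1)) (by simp [palTest]; omega)
    (Run.mono (run_palPal (x := k + a) (y := i + n - a) hb hf (hc'.of_eq fun r hr => ?_)
      (harr ▸ hA) (harr ▸ hA') (by simp [e32, ha]) (by simp [e30, hc'.r1, ha]) (by omega)
      (by omega) (by omega)) le_rfl
      fun τ ⟨h1, h2, h3⟩ => ⟨h1, fun y hy => h2 y (by omega), h3⟩) (by omega) ?_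
  · simp [Function.update, show r ≠ 33 by omega, show r ≠ 40 by omega, show r ≠ 41 by omega]
  rintro ρ - - ⟨g1, g2⟩
  have cast1 : ((i + n - a : ℕ) : ℤ) = i + n - a := by omega
  rw [cast1] at g2
  push_cast at g2
  refine Search.ite (by simp; omega) (by simp [palTest]; omega) (fun hpp => ?_) fun hpp => ?_
  · obtain ⟨m, m1, m2, m3, m4⟩ := g2.1 hpp
    refine Search.found ?_ (by omega) (by simp [palTest]; omega)
    exact ⟨i, j, k, a, m, by omega, by omega, by omega, m1, m2, hB, hC, fun t ht ht' => by
      have := h2 t.toNat (by omega)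
      rwa [show ((t.toNat : ℕ) : ℤ) = t by omega] at this, m3, m4⟩
  · refine Search.skip ?_ (by simp [palTest]; omega)
    rintro ⟨a', p, ha', h⟩
    obtain ⟨-, rfl⟩ := hmax a' p ha' h
    exact g2.2 ⟨p, h.hkp, h.hpi, h.D, h.E⟩ hpp

end WordRAM

/-! ### Factorizations with long translated factors -/

namespace WordRAM

open HalfTurn

/-- With `C` between the positions in registers `12` and `13`, at most as many letters for `B` as
register `14` says, and a period `d` in register `22`, this checks the lengths of `B` that are
congruent to register `20` modulo `d` and differ from the value of `e` by about `8 * d` at most. -/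
def window (o o' : ℕ) (e : Expr) : Prog :=
  forLoop 26 17
    (.set 27 (.reg 20 % .reg 22 + .reg 22 * (e / .reg 22 + .reg 26 - 8)) ;;
      .ite (.lt (.reg 14) (.reg 27)) .skip
        (.set 30 (.reg 12 - .reg 27) ;; .set 31 (.reg 12) ;; .set 32 (.reg 13) ;; check o o'))

theorem search_window {M n T o o' j k m d v : ℕ} {e : Expr} {f : ℤ → Letter} {σ : State}
    (hb : Bounds M n T) (hs : Simple f n) (hc : Ctx n T σ.reg) (hA : Tables n T f o σ.arr)
    (hA' : Tables n T (rev f) o' σ.arr) (hj : σ.reg 12 = j) (hk : σ.reg 13 = k)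
    (hg : σ.reg 14 = n - (k - j)) (hm : σ.reg 20 = m) (hd : σ.reg 22 = d)
    (hnj : n ≤ j) (hjk : j ≤ k) (hkj : k ≤ j + n) (hk4 : k ≤ 4 * n) (hmn : m ≤ n) (hdn : d ≤ n)
    (hv : v ≤ 5 * n) (hcost : e.cost ≤ 20)
    (he : ∀ τ : State, (∀ y < 26, y ≠ 9 → τ.reg y = σ.reg y) → e.Fits M τ ∧ e.eval τ = v)
    (hC : Pal f j k) :
    Search M (∃ i j k a p, HT f n i j k a p) 26 (window o o' e) σ (9500 * (T + 1))
      (∃ i a p : ℤ, 0 < a ∧ HT f n i j k a p ∧ (j - i) % d = m % d ∧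
        (v : ℤ) / d ≤ (j - i) / d + 8 ∧ (j - i) / d ≤ (v : ℤ) / d + 8) := by
  have hlin := hb.lin
  have hpos := hb.pos
  obtain ⟨c, hc'⟩ : ∃ c, m % d = c := ⟨_, rfl⟩
  obtain ⟨q, hq⟩ : ∃ q, v / d = q := ⟨_, rfl⟩
  have hmd : c ≤ m := hc' ▸ Nat.mod_le _ _
  have hvd : q ≤ v := hq ▸ Nat.div_le_self _ _
  have hdvd : d * q ≤ v := hq ▸ Nat.mul_div_le _ _
  refine Search.mono (Search.forLoop (N := 17) (b := 500 * (T + 1) + 50) (P := fun u =>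
    ∃ a p : ℤ, c + d * (q + u - 8) ≤ n - (k - j) ∧ 0 < a ∧
      HT f n (j - (c + d * (q + u - 8) : ℕ)) j k a p)
    (by omega) (by omega) ?_ ?_ (by simp; omega)) le_rfl ?_
  · intro τ _ _
    simp; omega
  · intro u τ hu hu' harr hreg
    have e12 : τ.reg 12 = j := by rw [hreg 12 (by omega) (by omega), hj]
    have e13 : τ.reg 13 = k := by rw [hreg 13 (by omega) (by omega), hk]
    have e14 : τ.reg 14 = n - (k - j) := by rw [hreg 14 (by omega) (by omega), hg]
    have e20 : τ.reg 20 = m := by rw [hreg 20 (by omega) (by omega), hm]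
    have e22 : τ.reg 22 = d := by rw [hreg 22 (by omega) (by omega), hd]
    obtain ⟨he1, he2⟩ := he τ hreg
    have hprod : d * (q + u - 8) ≤ v + 17 * n := calc
      d * (q + u - 8) ≤ d * (q + 17) := Nat.mul_le_mul_left _ (by omega)
      _ = d * (q) + 17 * d := by ring
      _ ≤ _ := by omega
    obtain ⟨l, hl⟩ : ∃ l, c + d * (q + u - 8) = l := ⟨_, rfl⟩
    rw [hl]
    refine Search.set (by omega) (by omega) ?_ (by simp; omega) ?_
    · simp [e20, e22, hu', he1, he2, hc', hq]; omega
    have el : (Expr.reg 20 % Expr.reg 22 + Expr.reg 22 * (e / Expr.reg 22 + Expr.reg 26 - 8)).eval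
        τ = l := by simp [e20, e22, hu', he2, hc', hq, hl]
    rw [el]
    refine Search.ite ?_ (by simp; omega) (fun hlt => ?_) fun hlt => ?_
    · rw [Expr.fits_lt _ _ _ _ (by omega)]
      simp [e14]; omega
    · simp [e14] at hlt
      refine Search.skip ?_ (by simp; omega)
      rintro ⟨a, p, h, -⟩
      omega
    simp [e14] at hlt
    refine Search.set (by omega) (by omega) (by simp [e12]; omega) (by simp; omega) ?_
    refine Search.set (by omega) (by omega) (by simp [e12]; omega) (by simp; omega) ?_
    refine Search.set (by omega) (by omega) (by simp [e13]; omega) (by simp; omega) ?_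
    refine Run.mono (search_check (o := o) (o' := o') (i := j - l) (j := j) (k := k) hb hs
      (hc.of_eq fun r hr => ?_) (harr ▸ hA) (harr ▸ hA') (by simp [e12]) (by simp [e12])
      (by simp [e13]) (by omega) hjk (by omega) (by omega) hC) (by simp; omega) ?_
    · rw [← hreg r (by omega) (by omega)]
      simp [Function.update, show r ≠ 27 by omega, show r ≠ 30 by omega, show r ≠ 31 by omega,
        show r ≠ 32 by omega]
    · rintro ρ ⟨h1, h2, h3, h4⟩
      refine ⟨h1, fun y hy hy' => h2 y (by omega) hy', h3, ?_⟩
      · rintro ⟨a, p, -, ha, h⟩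
        refine h4 ⟨a, p, ha, ?_⟩
        rwa [Nat.cast_sub (by omega)]
  · rintro ⟨i, a, p, ha, h, hmod, h1, h2⟩
    have hij := h.hij
    have hkp := h.hkp
    have hpi := h.hpi
    obtain ⟨l, hl⟩ : ∃ l : ℕ, (l : ℤ) = j - i := ⟨(j - i).toNat, by omega⟩
    rw [← hl] at hmod h1 h2
    have hmod' : l % d = c := hc' ▸ (by exact_mod_cast hmod)
    have h1' : q ≤ l / d + 8 := hq ▸ (by exact_mod_cast h1)
    have h2' : l / d ≤ q + 8 := hq ▸ (by exact_mod_cast h2)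
    obtain ⟨b, hb⟩ : ∃ b, l / d = b := ⟨_, rfl⟩
    rw [hb] at h1' h2'
    have key : c + d * (q + (b + 8 - q) - 8) = l := by
      rw [show q + (b + 8 - q) - 8 = b by omega, ← hmod', ← hb]
      exact Nat.mod_add_div l d
    refine ⟨b + 8 - q, by omega, a, p, ?_, ha, ?_⟩
    · rw [key]; omega
    · rw [key, hl]; simpa using h

/-- The start of the longest palindromic suffix of the factor between the positions `e` and
`e'`. -/
def suffixOf (o : ℕ) (e e' : Expr) : Prog := .set 50 e ;; .set 51 e' ;; longestSuffix o

theorem run_suffixOf {M n T o x y : ℕ} {e e' : Expr} {f : ℤ → Letter} {σ : State}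
    (hb : Bounds M n T) (hc : Ctx n T σ.reg) (hA : Tables n T f o σ.arr)
    (hx : e.Fits M σ ∧ e.eval σ = x) (hy : ∀ v, e'.Fits M ⟨Function.update σ.reg 50 v, σ.arr⟩ ∧
      e'.eval ⟨Function.update σ.reg 50 v, σ.arr⟩ = y) (hcost : e.cost + e'.cost ≤ 20)
    (hxy : x ≤ y) (hyx : y ≤ x + n) (hyn : y ≤ 8 * n) :
    Run M (suffixOf o e e') σ (100 * (T + 1) + 22) fun τ =>
      τ.arr = σ.arr ∧ (∀ x < 50, τ.reg x = σ.reg x) ∧ x ≤ τ.reg 53 ∧ τ.reg 53 ≤ y ∧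
      Pal f (τ.reg 53) y ∧ ∀ i, x ≤ i → i < τ.reg 53 → ¬ Pal f i y := by
  refine Run.set_seq hx.1 (by omega) (Run.set_seq (hy _).1 (by omega) ?_)
  rw [hx.2, (hy _).2]
  refine Run.mono (run_longestSuffix (x := x) (y := y) hb (hc.of_eq fun r hr => ?_) hA.rad hA.max
    (by simp) (by simp) hxy hyx hyn) (by omega) ?_
  · simp [Function.update, show r ≠ 50 by omega, show r ≠ 51 by omega]
  · rintro τ ⟨h1, h2, h3⟩
    refine ⟨h1, fun r hr => ?_, h3⟩
    rw [h2 r (by omega)]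
    simp [Function.update, show r ≠ 50 by omega, show r ≠ 51 by omega]

/-- The length of the longest common prefix of two variants of the word at the positions `e` and
`e'`. -/
def lceOf (o z z' : ℕ) (e e' : Expr) : Prog := .set 50 e ;; .set 51 e' ;; lce o z z'

theorem run_lceOf {M n T o z z' x y : ℕ} {e e' : Expr} {f : ℤ → Letter} {σ : State}
    (hb : Bounds M n T) (hf : ∀ x, f (x + n) = f x) (hc : Ctx n T σ.reg)
    (hA : NameTable n T f (σ.arr (2 + o))) (hz : z < 3) (hz' : z' < 3)
    (hx : e.Fits M σ ∧ e.eval σ = x) (hy : ∀ v, e'.Fits M ⟨Function.update σ.reg 50 v, σ.arr⟩ ∧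
      e'.eval ⟨Function.update σ.reg 50 v, σ.arr⟩ = y) (hcost : e.cost + e'.cost ≤ 20)
    (hxn : x ≤ 50 * n) (hyn : y ≤ 50 * n) :
    Run M (lceOf o z z' e e') σ (100 * (T + 1) + 22) fun τ =>
      τ.arr = σ.arr ∧ (∀ x < 50, τ.reg x = σ.reg x) ∧ τ.reg 62 < 2 ^ (T + 1) ∧
      (∀ u < τ.reg 62, variant f z (x + u) = variant f z' (y + u)) ∧
      (variant f z (x + τ.reg 62) ≠ variant f z' (y + τ.reg 62) ∨ n ≤ τ.reg 62) := by
  have hp := hb.le_pow_succ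
  refine Run.set_seq hx.1 (by omega) (Run.set_seq (hy _).1 (by omega) ?_)
  rw [hx.2, (hy _).2]
  refine Run.mono (run_lce (x := x) (x' := y) hb hf (hc.of_eq fun r hr => ?_) hA hz hz'
    (by simp) (by simp) hxn hyn) (by omega) ?_
  · simp [Function.update, show r ≠ 50 by omega, show r ≠ 51 by omega]
  · rintro τ ⟨h1, h2, h3, h4, h5⟩
    refine ⟨h1, fun r hr => ?_, h3, h4, ?_⟩
    · rw [h2 r (by omega)]
      simp [Function.update, show r ≠ 50 by omega, show r ≠ 51 by omega]
    · rcases Nat.lt_or_ge (τ.reg 62) n with c | c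
      · exact .inl (h5 (by omega))
      · exact .inr c

/-- For `C` between the positions `j` and `k` in registers `12` and `13`, this computes the
longest palindrome `[j - m, j)` for which `m` is at most the value `L` of register `16`, and the
next palindrome `[j - m', j)`. The difference `d = m - m'` is a period, which continues for `r`
letters to the left of `j - d`, and perhaps for `r'` letters to the right of `k + d`. The numbers
`m`, `d`, `r` and `r'` are stored in registers `20`, `22`, `23` and `24`. -/
def periods (o : ℕ) : Prog :=
  suffixOf o (.reg 12 - .reg 16) (.reg 12) ;; .set 20 (.reg 12 - .reg 53) ;;
    suffixOf o (.reg 12 - (.reg 20 - 1)) (.reg 12) ;; .set 22 (.reg 20 - (.reg 12 - .reg 53)) ;;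
    lceOf o 1 1 (8 * .reg 1 - .reg 12) (8 * .reg 1 - (.reg 12 - .reg 22)) ;; .set 23 (.reg 62) ;;
    lceOf o 0 0 (.reg 13) (.reg 13 + .reg 22) ;; .set 24 (.reg 62)

theorem run_periods {M n T o j k L : ℕ} {f : ℤ → Letter} {σ : State}
    (hb : Bounds M n T) (hf : ∀ x, f (x + n) = f x) (hc : Ctx n T σ.reg)
    (hA : Tables n T f o σ.arr) (hj : σ.reg 12 = j)
    (hk : σ.reg 13 = k) (hL : σ.reg 16 = L) (hLn : L ≤ n) (hnj : n ≤ j) (hjk : j ≤ k)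
    (hk4 : k ≤ 4 * n) :
    Run M (periods o) σ (400 * (T + 1) + 300) fun τ => τ.arr = σ.arr ∧
      (∀ y < 20, τ.reg y = σ.reg y) ∧ ∃ m m' r r' : ℕ, m ≤ L ∧ m' ≤ m ∧
      r ≤ 4 * n ∧ r' ≤ 4 * n ∧
      τ.reg 20 = m ∧ τ.reg 22 = m - m' ∧ τ.reg 23 = r ∧ τ.reg 24 = r' ∧
      Pal f (j - m) j ∧ (∀ l : ℤ, m < l → l ≤ L → ¬ Pal f (j - l) j) ∧
      Pal f (j - m') j ∧ (∀ l : ℤ, m' < l → l < m → ¬ Pal f (j - l) j) ∧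
      (m' < m ∨ m ≤ 0) ∧ (∀ u : ℤ, 0 ≤ u → u < r → f (j - 1 - u) = f (j - (m - m') - 1 - u)) ∧
      (f (j - 1 - r) ≠ f (j - (m - m') - 1 - r) ∨ n ≤ r) ∧
      (∀ u : ℤ, 0 ≤ u → u < r' → f (k + u) = f (k + (m - m') + u)) ∧
      (f (k + r') ≠ f (k + (m - m') + r') ∨ n ≤ r') := by
  have hlin := hb.lin
  have hpos := hb.pos
  have hp := hb.pow_succ_le
  refine Run.seq (by omega) (Run.mono (run_suffixOf (x := j - L) (y := j) hb hc hA
    (by simp [hj, hL]; omega) (by simp [hj]; omega) (by simp) (by omega) (by omega) (by omega))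
    le_rfl ?_)
  rintro σ₁ ⟨ha₁, hr₁, m1, m2, m3, m4⟩
  have e12 : σ₁.reg 12 = j := by rw [hr₁ 12 (by omega), hj]
  obtain ⟨m, hm⟩ : ∃ m, m = j - σ₁.reg 53 := ⟨_, rfl⟩
  refine Run.set_seq (by simp [e12]; omega) (by simp; omega) ?_
  rw [show (Expr.reg 12 - Expr.reg 53).eval σ₁ = m by simp [e12, hm]]
  refine Run.seq (s := 100 * (T + 1) + 22) (by simp; omega) (Run.mono (run_suffixOf
    (x := j - (m - 1)) (y := j) hb (hc.of_eq fun r hr => ?_) (ha₁ ▸ hA)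
    (by simp [e12]; omega) (by simp [e12]; omega) (by simp) (by omega) (by omega) (by omega))
    le_rfl ?_)
  · simp [Function.update, show r ≠ 20 by omega, hr₁ r (by omega)]
  rintro σ₂ ⟨ha₂, hr₂, m5, m6, m7, m8⟩
  simp only at ha₂
  have f12 : σ₂.reg 12 = j := by rw [hr₂ 12 (by omega)]; simp [e12]
  have f20 : σ₂.reg 20 = m := by rw [hr₂ 20 (by omega)]; simp
  obtain ⟨m', hm'⟩ : ∃ m', m' = j - σ₂.reg 53 := ⟨_, rfl⟩
  refine Run.set_seq (by simp [f12, f20]; omega) (by simp; omega) ?_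
  rw [show (Expr.reg 20 - (Expr.reg 12 - Expr.reg 53)).eval σ₂ = m - m' by simp [f12, f20, hm']]
  have g1 : σ₂.reg 1 = n := by rw [hr₂ 1 (by omega)]; simp [hr₁ 1 (by omega), hc.r1]
  refine Run.seq (s := 100 * (T + 1) + 22) (by simp; omega) (Run.mono (run_lceOf
    (x := 8 * n - j) (y := 8 * n - (j - (m - m'))) (f := f) hb hf (hc.of_eq fun r hr => ?_)
    (by simp only [ha₂, ha₁]; exact hA.name) (by omega) (by omega)
    (by simp [f12, g1]; omega) (by simp [f12, g1]; omega) (by simp) (by omega) (by omega))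
    le_rfl ?_)
  · simp [Function.update, show r ≠ 20 by omega, show r ≠ 22 by omega, hr₂ r (by omega),
      hr₁ r (by omega)]
  rintro σ₃ ⟨ha₃, hr₃, m9, m10, m11⟩
  simp only at ha₃
  obtain ⟨r, hr⟩ : ∃ r, σ₃.reg 62 = r := ⟨_, rfl⟩
  rw [hr] at m9 m10 m11
  have h13 : σ₃.reg 13 = k := by
    rw [hr₃ 13 (by omega)]; simp [hr₂ 13 (by omega), hr₁ 13 (by omega), hk]
  have h22 : σ₃.reg 22 = m - m' := by rw [hr₃ 22 (by omega)]; simp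
  have h20 : σ₃.reg 20 = m := by rw [hr₃ 20 (by omega)]; simp [f20]
  refine Run.set_seq (by simp [hr]; omega) (by simp; omega) ?_
  rw [show (Expr.reg 62).eval σ₃ = r by simp [hr]]
  refine Run.seq (s := 100 * (T + 1) + 22) (by simp; omega) (Run.mono (run_lceOf
    (x := k) (y := k + (m - m')) (f := f) hb hf (hc.of_eq fun r hr => ?_)
    (by simp only [ha₃, ha₂, ha₁]; exact hA.name) (by omega) (by omega)
    (by simp [h13]; omega) (by simp [h13, h22]; omega) (by simp) (by omega) (by omega))
    le_rfl ?_)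
  · simp [Function.update, show r ≠ 20 by omega, show r ≠ 22 by omega, show r ≠ 23 by omega,
      hr₃ r (by omega), hr₂ r (by omega), hr₁ r (by omega)]
  rintro σ₄ ⟨ha₄, hr₄, m12, m13, m14⟩
  simp only at ha₄
  obtain ⟨r', hr'⟩ : ∃ r, σ₄.reg 62 = r := ⟨_, rfl⟩
  rw [hr'] at m12 m13 m14
  refine Run.set (by simp [hr']; omega) (by simp; omega) ?_
  rw [show (Expr.reg 62).eval σ₄ = r' by simp [hr']]
  rw [variant_one hf (by omega), variant_one hf (by omega)] at m11
  simp only [variant_one hf (show j ≤ 8 * n by omega),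
    variant_one hf (show j - (m - m') ≤ 8 * n by omega)] at m10
  simp only [variant] at m13 m14
  have cast1 : ((j - (m - m') : ℕ) : ℤ) = j - (m - m') := by omega
  have cast2 : ((k + (m - m') : ℕ) : ℤ) = k + (m - m') := by omega
  rw [cast1] at m10 m11
  rw [cast2] at m13 m14
  refine ⟨by rw [ha₄, ha₃, ha₂, ha₁], fun y hy => ?_, m, m', r, r', by omega, by omega, by omega,
    by omega, ?_, ?_, ?_, by simp, ?_, ?_, ?_, ?_, by omega, ?_, m11, ?_, m14⟩
  · simp [Function.update, show y ≠ 20 by omega, show y ≠ 22 by omega, show y ≠ 23 by omega,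
      show y ≠ 24 by omega, hr₄ y (by omega), hr₃ y (by omega), hr₂ y (by omega), hr₁ y (by omega)]
  · simp [hr₄ 20 (by omega), h20]
  · simp [hr₄ 22 (by omega), h22]
  · simp [hr₄ 23 (by omega)]
  · rwa [show (j : ℤ) - m = σ₁.reg 53 by omega]
  · intro l h1 h2 h3
    apply m4 (j - l.toNat) (by omega) (by omega)
    rwa [show ((j - l.toNat : ℕ) : ℤ) = j - l by omega]
  · rwa [show (j : ℤ) - m' = σ₂.reg 53 by omega]
  · intro l h1 h2 h3
    apply m8 (j - l.toNat) (by omega) (by omega)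
    rwa [show ((j - l.toNat : ℕ) : ℤ) = j - l by omega]
  · intro u h1 h2
    have := m10 u.toNat (by omega)
    rwa [show ((u.toNat : ℕ) : ℤ) = u by omega] at this
  · intro u h1 h2
    have := m13 u.toNat (by omega)
    rwa [show ((u.toNat : ℕ) : ℤ) = u by omega] at this

/-- With `C` between the positions in registers `12` and `13`, this searches for a factorization
for which the length of `B` has as many binary digits as register `15` says. -/
def phaseDigits (o o' : ℕ) : Prog :=
  .set 16 (.read 10 (.reg 15) - 1 - (.read 10 (.reg 15) - 1 - .reg 14)) ;; periods o ;;
    window o o' (.reg 20) ;;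
    window o o' (.reg 22 + .reg 23 - (.reg 22 + .reg 23 - .reg 14)) ;;
    window o o' (.reg 23 - .reg 24)

/-- The entries up to `T` of array `10` are the powers of two. -/
def Pows (T : ℕ) (A : ℕ → ℕ → ℕ) : Prop := ∀ t ≤ T, A 10 t = 2 ^ t

theorem search_phaseDigits {M n T o o' j k t : ℕ} {f : ℤ → Letter} {σ : State}
    (hb : Bounds M n T) (hs : Simple f n) (hc : Ctx n T σ.reg) (hA : Tables n T f o σ.arr)
    (hA' : Tables n T (rev f) o' σ.arr) (hP : Pows T σ.arr) (hj : σ.reg 12 = j)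
    (hk : σ.reg 13 = k) (hg : σ.reg 14 = n - (k - j)) (ht : σ.reg 15 = t) (htT : t ≤ T)
    (hnj : n ≤ j) (hjk : j ≤ k) (hkj : k ≤ j + n) (hk4 : k ≤ 4 * n) (hC : Pal f j k) :
    Search M (∃ i j k a p, HT f n i j k a p) 16 (phaseDigits o o') σ (30000 * (T + 1))
      (∃ i a p : ℤ, 0 < a ∧ HT f n i j k a p ∧ j - i < 2 ^ t ∧ (2 ^ t ≤ 2 * (j - i) ∨ t = 0) ∧
        ¬ ∃ d l r, Loose f n i j k d l r) := by
  have hlin := hb.lin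
  have hpos := hb.pos
  have hp := hb.pow_succ_le
  have hp' := hb.le_pow_succ
  have hT := hb.T_le
  have hf := hs.periodic
  have hpt := hP t htT
  have hpt' : 2 ^ t ≤ 2 ^ (T + 1) := Nat.pow_le_pow_right (by norm_num) (by omega)
  have hpt1 : 1 ≤ 2 ^ t := Nat.one_le_two_pow
  obtain ⟨L, hL⟩ : ∃ L, 2 ^ t - 1 - (2 ^ t - 1 - (n - (k - j))) = L := ⟨_, rfl⟩
  refine Search.set (by omega) (by omega) (by simp [ht, hpt, hg]; omega) (by simp; omega) ?_
  rw [show (Expr.read 10 (.reg 15) - 1 - (Expr.read 10 (.reg 15) - 1 - .reg 14)).eval σ = L by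
    simp [ht, hpt, hg, hL]]
  refine Search.seq (s := 400 * (T + 1) + 300) (by simp; omega) (Run.mono (run_periods
    (j := j) (k := k) (L := L) hb hf (hc.of_eq fun r hr => ?_) hA (by simp [hj]) (by simp [hk])
    (by simp) (by omega) hnj hjk hk4) le_rfl
    fun τ ⟨h1, h2, h3⟩ => ⟨h1, fun y hy => h2 y (by omega), And.intro h2 h3⟩) (by omega) ?_
  · simp [Function.update, show r ≠ 16 by omega]
  rintro τ harr - ⟨hreg, m, m', r, r', h1, h2, h3, h4, e20, e22, e23, e24, p1, p2, p3, p4, p5, p6,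
    p7, p8, p9⟩
  simp only at harr
  have hreg' : ∀ r < 16, τ.reg r = σ.reg r := fun r hr => by
    rw [hreg r (by omega)]
    simp [Function.update, show r ≠ 16 by omega]
  have hwin : ∀ (e : Expr) (v : ℕ) (ρ : State), ρ.arr = τ.arr →
      (∀ y < 26, y ≠ 9 → ρ.reg y = τ.reg y) → v ≤ 5 * n → e.cost ≤ 20 →
      (∀ ρ : State, (∀ y < 26, y ≠ 9 → ρ.reg y = τ.reg y) → e.Fits M ρ ∧ e.eval ρ = v) → _ :=
    fun e v ρ ha hr hv hcost he => search_window (o := o) (o' := o') (j := j) (k := k) (m := m)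
      (d := m - m') (v := v) (e := e) (σ := ρ) hb hs
      (hc.of_eq fun x hx => by
        rcases eq_or_ne x 9 with rfl | hx9
        · omega
        · rw [hr x (by omega) hx9, hreg' x (by omega)])
      (by rw [ha, harr]; exact hA) (by rw [ha, harr]; exact hA')
      (by rw [hr 12 (by omega) (by omega), hreg' 12 (by omega), hj])
      (by rw [hr 13 (by omega) (by omega), hreg' 13 (by omega), hk])
      (by rw [hr 14 (by omega) (by omega), hreg' 14 (by omega), hg])
      (by rw [hr 20 (by omega) (by omega), e20]) (by rw [hr 22 (by omega) (by omega), e22])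
      hnj hjk hkj hk4 (by omega) (by omega) hv hcost
      (fun ρ' hρ' => he ρ' fun y hy hy' => (hρ' y hy hy').trans (hr y hy hy')) hC
  have e14 : τ.reg 14 = n - (k - j) := by rw [hreg' 14 (by omega), hg]
  have w1 := hwin (.reg 20) m τ rfl (fun _ _ _ => rfl) (by omega) (by simp) fun ρ hρ => by
    simp [hρ 20 (by omega) (by omega), e20]; omega
  have w2 := fun ρ ha hr => hwin (.reg 22 + .reg 23 - (.reg 22 + .reg 23 - .reg 14))
    (m - m' + r - (m - m' + r - (n - (k - j)))) ρ ha hr (by omega) (by simp) fun ρ hρ => by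
    simp [hρ 22 (by omega) (by omega), hρ 23 (by omega) (by omega), hρ 14 (by omega) (by omega),
      e22, e23, e14]
    omega
  have w3 := fun ρ ha hr => hwin (.reg 23 - .reg 24) (r - r') ρ ha hr (by omega) (by simp)
    fun ρ hρ => by
    simp [hρ 24 (by omega) (by omega), hρ 23 (by omega) (by omega), e24, e23]
    omega
  have hall := Search.seq_search (s := 9500 * (T + 1)) (t := 28500 * (T + 1)) (by omega) w1
    fun ρ ha hr => (Search.seq_search (s := 9500 * (T + 1)) (by omega) (w2 ρ ha hr)
      fun ρ' ha' hr' => (w3 ρ' (ha'.trans ha)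
        fun y hy hy' => (hr' y hy hy').trans (hr y hy hy')).mono (by omega) fun h => h)
  refine Run.mono hall (by simp; omega) ?_
  rintro ρ ⟨g1, g2, g3, g4⟩
  refine ⟨g1, fun y hy hy' => g2 y (by omega) hy', g3, ?_⟩
  rintro ⟨i, a, p, ha, h, hlt, hge, hnl⟩
  apply g4
  by_contra hno
  simp only [not_or, not_exists, not_and] at hno
  obtain ⟨hno1, hno2, hno3⟩ := hno
  have hij := h.hij
  have hkp := h.hkp
  have hpi := h.hpi
  obtain ⟨X, hX⟩ : ∃ X, 2 ^ t = X := ⟨_, rfl⟩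
  have hX' : (2 : ℤ) ^ t = X := by exact_mod_cast hX
  rw [hX] at hL
  rw [hX'] at hlt hge
  have hc1 : ((m - m' : ℕ) : ℤ) = m - m' := by omega
  have hc2 : ((m - m' + r - (m - m' + r - (n - (k - j))) : ℕ) : ℤ) =
    min ((m : ℤ) - m' + r) (n - (k - j)) := by omega
  have hc3 : ((r - r' : ℕ) : ℤ) = max 0 ((m : ℤ) - m' + r - (m - m' + r')) := by omega
  rw [hc1] at hno1 hno2 hno3
  rw [hc2] at hno2
  rw [hc3] at hno3
  refine hnl (exists_loose_of_far hs h (L := L) (m := m) (m' := m') (r := r) (r' := r') ?_ ?_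
    (by omega) p1 p2 p3 p4 (by omega) (by omega) (by omega) p6
    (p7.imp_right Int.ofNat_le.2) p8 (p9.imp_right Int.ofNat_le.2) ?_)
  · omega
  · rcases hge with hge | rfl
    · left
      omega
    · right
      rw [pow_zero] at hX
      omega
  · rintro u (rfl | rfl | rfl) hmod
    · have := hno1 i a p ha h hmod
      omega
    · have := hno2 i a p ha h hmod
      omega
    · have := hno3 i a p ha h hmod
      omega

end WordRAM

namespace WordRAM

open HalfTurn

namespace RadTable

variable {n : ℕ} {f : ℤ → Letter} {a : ℕ → ℕ} (h : RadTable n f a)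
include h

theorem pal {s : ℕ} (hs : s < 2 * n) :
    Pal f (s / 2 + 2 * n - a s : ℕ) ((s + 1) / 2 + 2 * n + a s : ℕ) := by
  have hle := h.le s hs
  rw [h.pal_iff _ _ (by omega) (by omega), show s / 2 + 2 * n - a s +
    ((s + 1) / 2 + 2 * n + a s) = s + 2 * n + 2 * n by omega, Nat.add_mod_right,
    Nat.add_mod_right, Nat.mod_eq_of_lt hs]
  omega

theorem maximal {s j k : ℕ} (hs : s < 2 * n) (hj : s / 2 + 2 * n - a s = j)
    (hk : (s + 1) / 2 + 2 * n + a s = k) :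
    (n : ℤ) - 1 ≤ k - j ∨ f (j - 1) ≠ f k := by
  have hle := h.le s hs
  by_contra! hc
  have hp := (h.pal hs).outer
  rw [hj, hk] at hp
  have hp := hp hc.2
  rw [show (j : ℤ) - 1 = (j - 1 : ℕ) by omega, show (k : ℤ) + 1 = (k + 1 : ℕ) by omega,
    h.pal_iff _ _ (by omega) (by omega), show j - 1 + (k + 1) = s + 2 * n + 2 * n by omega,
    Nat.add_mod_right, Nat.add_mod_right, Nat.mod_eq_of_lt hs] at hp
  omega

theorem eq_of_maximal {j k : ℕ} (hj : 1 ≤ j) (hjk : j ≤ k) (hkj : k ≤ j + n) (hn : 0 < n)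
    (hp : Pal f j k) (hmax : (n : ℤ) - 1 ≤ k - j ∨ f (j - 1) ≠ f k) :
    a ((j + k) % (2 * n)) = (k - j) / 2 := by
  have h1 := (h.pal_iff j k hjk hkj).1 hp
  have h2 := h.le ((j + k) % (2 * n)) (Nat.mod_lt _ (by omega))
  have h3 : (j + k) % (2 * n) % 2 = (j + k) % 2 := Nat.mod_mod_of_dvd _ ⟨n, rfl⟩
  by_contra hne
  have hp' := (h.pal_iff (j - 1) (k + 1) (by omega) (by omega)).2
    (by rw [show j - 1 + (k + 1) = j + k by omega]; omega)
  have := hp' (j - 1) (by omega) (by omega)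
  rw [show ((j - 1 : ℕ) : ℤ) + (k + 1 : ℕ) - 1 - (j - 1) = k by omega] at this
  rcases hmax with c | c
  · omega
  · exact c this

end RadTable

theorem exists_center {n : ℕ} (hn : 0 < n) (x : ℤ) :
    ∃ c s : ℤ, x + 2 * (c * n) = 4 * n + s ∧ 0 ≤ s ∧ s < 2 * n := by
  have h0 := Int.emod_nonneg x (b := 2 * n) (by omega)
  have h1 := Int.emod_lt_of_pos x (b := 2 * n) (by omega)
  have h2 := Int.emod_add_mul_ediv x (2 * n)
  refine ⟨2 - x / (2 * n), x % (2 * n), ?_, h0, h1⟩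
  linarith

/-- The search for the factorizations in which `A` is not empty and the palindrome `B` is not
loose. It considers each maximal palindrome as `C`. -/
def phaseTranslated (o o' : ℕ) : Prog :=
  forLoop 10 (.reg 6)
    (.set 11 (.read (6 + o) (.reg 10)) ;; .set 12 (.reg 10 / 2 + 2 * .reg 1 - .reg 11) ;;
      .set 13 ((.reg 10 + 1) / 2 + 2 * .reg 1 + .reg 11) ;;
      .set 14 (.reg 1 - (.reg 13 - .reg 12)) ;; forLoop 15 (.reg 3 + 1) (phaseDigits o o'))

theorem search_phaseTranslated {M n T o o' : ℕ} {f : ℤ → Letter} {σ : State}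
    (hb : Bounds M n T) (hs : Simple f n) (hc : Ctx n T σ.reg) (hA : Tables n T f o σ.arr)
    (hA' : Tables n T (rev f) o' σ.arr) (hP : Pows T σ.arr) :
    Search M (∃ i j k a p, HT f n i j k a p) 10 (phaseTranslated o o') σ
      (61000 * (n * ((T + 1) * (T + 1))))
      (∃ i j k a p : ℤ, 0 < a ∧ HT f n i j k a p ∧ ¬ ∃ d l r, Loose f n i j k d l r) := by
  have hlin := hb.lin
  have hpos := hb.pos
  have hT := hb.T_le
  have hT1 : T + 1 ≤ (T + 1) * (T + 1) := Nat.le_mul_of_pos_left _ (by omega)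
  have hX1 : (T + 1) * (T + 1) ≤ n * ((T + 1) * (T + 1)) := Nat.le_mul_of_pos_left _ hpos
  refine Search.mono (Search.forLoop (N := 2 * n) (b := 30100 * ((T + 1) * (T + 1)))
    (P := fun s => ∃ j k : ℕ, s / 2 + 2 * n - σ.arr (6 + o) s = j ∧
      (s + 1) / 2 + 2 * n + σ.arr (6 + o) s = k ∧ ∃ i a p : ℤ, 0 < a ∧ HT f n i j k a p ∧
      ¬ ∃ d l r, Loose f n i j k d l r) (by omega) (by omega) ?_ ?_ ?_) le_rfl ?_
  · intro τ _ hτ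
    simp [hτ 6 (by omega) (by omega), hc.r6]; omega
  · intro s τ hs2 hs10 harr hreg
    have e1 : τ.reg 1 = n := by rw [hreg 1 (by omega) (by omega), hc.r1]
    have hle := hA.rad.le s hs2
    have hpal := hA.rad.pal hs2
    obtain ⟨r, hr⟩ : ∃ r, σ.arr (6 + o) s = r := ⟨_, rfl⟩
    rw [hr] at hle hpal ⊢
    obtain ⟨j, hj⟩ : ∃ j, s / 2 + 2 * n - r = j := ⟨_, rfl⟩
    obtain ⟨k, hk⟩ : ∃ k, (s + 1) / 2 + 2 * n + r = k := ⟨_, rfl⟩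
    rw [hj, hk] at hpal
    refine Search.set (by omega) (by omega) (by simp [hs10, harr, hr]; omega) (by simp; omega) ?_
    rw [show (Expr.read (6 + o) (.reg 10)).eval τ = r by simp [hs10, harr, hr]]
    refine Search.set (by omega) (by omega) (by simp [hs10, e1]; omega) (by simp; omega) ?_
    refine Search.set (by omega) (by omega) (by simp [hs10, e1]; omega) (by simp; omega) ?_
    refine Search.set (by omega) (by omega) (by simp [hs10, e1, hj, hk]; omega)
      (by simp; omega) ?_
    refine Search.mono (Search.of_le (show 11 ≤ 15 by omega) (Search.forLoop (x := 15)
      (N := T + 1) (b := 30000 * (T + 1))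
      (t := 30020 * ((T + 1) * (T + 1)))
      (P := fun t => ∃ i a p : ℤ, 0 < a ∧ HT f n i j k a p ∧ j - i < 2 ^ t ∧
        (2 ^ t ≤ 2 * (j - i) ∨ t = 0) ∧ ¬ ∃ d l r, Loose f n i j k d l r)
      (by omega) (by omega) ?_ ?_ ?_)) (by simp; omega) ?_
    · intro ρ _ hρ
      have : ρ.reg 3 = T := by
        rw [hρ 3 (by omega) (by omega)]; simp [hreg 3 (by omega) (by omega), hc.r3]
      simp [this]; omega
    · intro t ρ ht ht15 harrρ hregρ
      simp only at harrρ
      have hall : ∀ x < 10, x ≠ 9 → ρ.reg x = σ.reg x := fun x hx hx' => by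
        rw [hregρ x (by omega) hx']
        simp [Function.update, show x ≠ 11 by omega, show x ≠ 12 by omega, show x ≠ 13 by omega,
          show x ≠ 14 by omega, hreg x hx hx']
      exact search_phaseDigits hb hs (hc.of_eq fun x hx => hall x (by omega) (by omega))
        (by rw [harrρ, harr]; exact hA) (by rw [harrρ, harr]; exact hA')
        (by rw [harrρ, harr]; exact hP)
        (by rw [hregρ 12 (by omega) (by omega)]; simp [hs10, e1, hj])
        (by rw [hregρ 13 (by omega) (by omega)]; simp [hs10, e1, hk])
        (by rw [hregρ 14 (by omega) (by omega)]; simp [hs10, e1, hk, hj])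
        ht15 (by omega) (by omega) (by omega) (by omega) (by omega) hpal
    · simp only [Expr.cost_add, Expr.cost_reg, Expr.cost_ofNat]
      have : (T + 1) * (30000 * (T + 1) + (1 + 1 + 1) + 7) =
        30000 * ((T + 1) * (T + 1)) + 10 * (T + 1) := by ring
      omega
    · rintro ⟨j', k', rfl, rfl, i, a, p, ha, h, hnl⟩
      rw [hj, hk] at h hnl
      have hij := h.hij
      have hkp := h.hkp
      have hpi := h.hpi
      have h5 := Nat.lt_size_self (j - i).toNat
      have h6 : Nat.size (j - i).toNat ≤ T := by
        rw [Nat.size_le]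
        have := hb.lt_pow
        omega
      refine ⟨Nat.size (j - i).toNat, by omega, i, a, p, ha, h, ?_, ?_, hnl⟩
      · zify at h5; omega
      · rcases Nat.eq_zero_or_pos (Nat.size (j - i).toNat) with c | c
        · exact .inr c
        · left
          have h7 := (Nat.lt_size (m := Nat.size (j - i).toNat - 1) (n := (j - i).toNat)).1
            (by omega)
          have h8 : 2 ^ Nat.size (j - i).toNat = 2 ^ (Nat.size (j - i).toNat - 1) * 2 := by
            rw [← pow_succ]; congr 1; omega
          zify at h7 h8
          omega
  · simp only [Expr.cost_reg]
    have : 2 * n * (30100 * ((T + 1) * (T + 1)) + 1 + 7) =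
      60200 * (n * ((T + 1) * (T + 1))) + 16 * n := by ring
    have : n * 1 ≤ n * ((T + 1) * (T + 1)) := Nat.mul_le_mul_left _ (by omega)
    omega
  · rintro ⟨i, j, k, a, p, ha, h, hnl⟩
    obtain ⟨c, s, hcs, hs0, hs1⟩ := exists_center hpos (j + k)
    have hper := periodic_mul hs.periodic c
    have h' := h.translate hper
    have hmax := h'.maximal_C hs ha
    have hnl' : ¬ ∃ d l r, Loose f n (i + c * n) (j + c * n) (k + c * n) d l r := by
      rintro ⟨d, l, r, hl⟩
      apply hnl
      have := hl.translate (periodic_mul hs.periodic (-c))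
      rw [show i + c * n + -c * n = i by ring, show j + c * n + -c * n = j by ring,
        show k + c * n + -c * n = k by ring] at this
      exact ⟨d, l, r, this⟩
    have h1 := h'.hij
    have h2 := h'.hjk
    have h3 := h'.hkp
    have h4 := h'.hpi
    obtain ⟨J, hJ⟩ : ∃ J : ℕ, j + c * n = J := ⟨(j + c * n).toNat, by omega⟩
    obtain ⟨K, hK⟩ : ∃ K : ℕ, k + c * n = K := ⟨(k + c * n).toNat, by omega⟩
    rw [hJ, hK] at h' hnl' hmax
    rw [hJ] at h1 h2
    rw [hK] at h2 h3
    lift s to ℕ using hs0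
    have hrad := hA.rad.eq_of_maximal (j := J) (k := K) (by omega) (by omega) (by omega) hpos
      h'.C (.inr hmax)
    rw [show J + K = s + 2 * n + 2 * n by omega, Nat.add_mod_right,
      Nat.add_mod_right, Nat.mod_eq_of_lt (by omega)] at hrad
    exact ⟨s, by omega, J, K, by omega, by omega, _, a, _, ha, h', hnl'⟩

end WordRAM

/-! ### Factorizations into four palindromes -/

namespace WordRAM

open HalfTurn

/-- This searches for a factorization into four palindromes that starts at the position in
register `x`. -/
def cut (o o' x : ℕ) : Prog :=
  forLoop 30 (.reg 1 + 1)
    (.set 40 (.reg x) ;; .set 41 (.reg x + .reg 30) ;; palPal o o' ;;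
      .ite (.reg 42)
        (.set 40 (.reg x + .reg 30) ;; .set 41 (.reg x + .reg 1) ;; palPal o o' ;;
          .ite (.reg 42) (.set 9 1) .skip)
        .skip)

theorem search_cut {M n T o o' x q : ℕ} {f : ℤ → Letter} {σ : State}
    (hb : Bounds M n T) (hf : ∀ x, f (x + n) = f x) (hc : Ctx n T σ.reg)
    (hA : Tables n T f o σ.arr) (hA' : Tables n T (rev f) o' σ.arr) (h9 : 9 < x) (hx : x < 30)
    (hq : σ.reg x = q) (hqn : q ≤ 5 * n) :
    Search M (∃ i j k a p, HT f n i j k a p) 30 (cut o o' x) σ (1400 * (n * (T + 1)))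
      (∃ j k p : ℤ, HT f n q j k 0 p) := by
  have hlin := hb.lin
  have hpos := hb.pos
  have hX1 : T + 1 ≤ n * (T + 1) := Nat.le_mul_of_pos_left _ hpos
  have hX2 : n * 1 ≤ n * (T + 1) := Nat.mul_le_mul_left _ (by omega)
  refine Search.mono (Search.forLoop (N := n + 1) (b := 600 * (T + 1) + 30)
    (P := fun k => ∃ j p : ℤ, HT f n q j (q + k) 0 p) (by omega) (by omega) ?_ ?_ ?_) le_rfl ?_
  · intro τ _ hτ
    simp [hτ 1 (by omega) (by omega), hc.r1]; omega
  · intro k τ hk hk30 harr hreg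
    have hcτ : Ctx n T τ.reg := hc.of_eq fun r hr => hreg r (by omega) (by omega)
    have e1 := hcτ.r1
    have ex : τ.reg x = q := by rw [hreg x hx (by omega), hq]
    refine Search.set (by omega) (by omega) (by simp [ex]; omega) (by simp) ?_
    refine Search.set (by omega) (by omega)
      (by simp [Function.update, show x ≠ 40 by omega, ex, hk30]; omega) (by simp) ?_
    refine Search.seq (s := 300 * (T + 1)) (by simp; omega) (Run.mono (run_palPal (x := q)
      (y := q + k) hb hf (hcτ.of_eq fun r hr => ?_) (harr ▸ hA) (harr ▸ hA') (by simp [ex])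
      (by simp [Function.update, show x ≠ 40 by omega, ex, hk30]) (by omega) (by omega)
      (by omega)) le_rfl
      fun τ ⟨h1, h2, h3⟩ => ⟨h1, fun y hy => h2 y (by omega), h3⟩) (by omega) ?_
    · simp [Function.update, show r ≠ 40 by omega, show r ≠ 41 by omega]
    rintro ρ harr' hreg' ⟨g1, g2⟩
    simp only at harr'
    have hall : ∀ r < 31, ρ.reg r = τ.reg r := fun r hr => by
      rw [hreg' r hr]; simp [Function.update, show r ≠ 40 by omega, show r ≠ 41 by omega]
    refine Search.ite (by simp; omega) (by simp; omega) (fun h1 => ?_) fun h1 => ?_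
    swap
    · refine Search.skip ?_ (by simp; omega)
      rintro ⟨j, p, h⟩
      have := g2.2 ⟨j, h.hij, by push_cast; exact h.hjk, h.B, by push_cast; exact h.C⟩
      exact this h1
    obtain ⟨m, hm1, hm2, hm3, hm4⟩ := g2.1 h1
    refine Search.set (by omega) (by omega)
      (by simp [hall x (by omega), hall 30 (by omega), ex, hk30]; omega) (by simp; omega) ?_
    refine Search.set (by omega) (by omega)
      (by simp [Function.update, show x ≠ 40 by omega, hall x (by omega), hall 1 (by omega), ex,
        e1]; omega) (by simp; omega) ?_
    refine Search.seq (s := 300 * (T + 1)) (by simp; omega) (Run.mono (run_palPal (x := q + k)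
      (y := q + n) hb hf (hcτ.of_eq fun r hr => ?_) (by simp only [harr', harr]; exact hA)
      (by simp only [harr', harr]; exact hA')
      (by simp [hall x (by omega), hall 30 (by omega), ex, hk30])
      (by simp [Function.update, show x ≠ 40 by omega, hall x (by omega), hall 1 (by omega), ex,
        e1]) (by omega) (by omega) (by omega)) le_rfl
      fun τ ⟨h1, h2, h3⟩ => ⟨h1, fun y hy => h2 y (by omega), h3⟩) (by omega) ?_
    · simp [Function.update, show r ≠ 40 by omega, show r ≠ 41 by omega, hall r (by omega)]
    rintro ρ' - - ⟨g3, g4⟩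
    push_cast at g4 hm2 hm4
    refine Search.ite (by simp; omega) (by simp; omega) (fun h2 => ?_) fun h2 => ?_
    · obtain ⟨p, hp1, hp2, hp3, hp4⟩ := g4.1 h2
      exact Search.found ⟨q, m, q + k, 0, p, hm1, hm2, le_rfl, by simpa using hp1,
        by simpa using hp2, hm3, hm4, fun t h1 h2 => by omega, by simpa using hp3,
        by simpa using hp4⟩ (by omega) (by simp; omega)
    · refine Search.skip ?_ (by simp; omega)
      rintro ⟨j, p, h⟩
      exact g4.2 ⟨p, by simpa using h.hkp, by simpa using h.hpi, by simpa using h.D,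
        by simpa using h.E⟩ h2
  · simp only [Expr.cost_add, Expr.cost_reg, Expr.cost_ofNat]
    have : (n + 1) * (600 * (T + 1) + 30 + (1 + 1 + 1) + 7) =
      600 * (n * (T + 1)) + 600 * (T + 1) + 40 * n + 40 := by ring
    omega
  · rintro ⟨j, k, p, h⟩
    have h1 := h.hij
    have h2 := h.hjk
    have h3 := h.hkp
    have h4 := h.hpi
    refine ⟨(k - q).toNat, by omega, j, p, ?_⟩
    rwa [show (q : ℤ) + (k - q).toNat = k by omega]

/-- The maximal palindrome with center `u / 2`, of length at least `n / 4`, has its center in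
the block `b`, one of eight. -/
def LongIn (n b : ℕ) (rad : ℕ → ℕ) (u : ℕ) : Prop :=
  b * n ≤ 4 * u ∧ 4 * u < (b + 1) * n ∧ n ≤ 4 * (2 * rad u + u % 2)

/-- For the palindromes with property `LongIn`, where `b` is in register `10`, this finds the
start of the first one, the end of the last one, and the start of a longest one. They are stored
in registers `20`, `21` and `23`, and the length of the longest in register `22`. -/
def scan (o : ℕ) : Prog :=
  .set 20 0 ;; .set 21 0 ;; .set 22 0 ;; .set 23 0 ;;
    forLoop 11 (.reg 6)
      (.set 12 (.read (6 + o) (.reg 11)) ;; .set 13 (.reg 11 / 2 + 2 * .reg 1 - .reg 12) ;;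
        .set 14 ((.reg 11 + 1) / 2 + 2 * .reg 1 + .reg 12) ;;
        .set 15 (2 * .reg 12 + .reg 11 % 2) ;;
        .ite (.lt (.reg 10 * .reg 1) (4 * .reg 11 + 1) *
            (.lt (4 * .reg 11) ((.reg 10 + 1) * .reg 1) * .lt (.reg 1) (4 * .reg 15 + 1)))
          (.ite (.reg 22) .skip (.set 20 (.reg 13)) ;; .set 21 (.reg 14) ;;
            .ite (.lt (.reg 22) (.reg 15)) (.set 22 (.reg 15) ;; .set 23 (.reg 13)) .skip)
          .skip)

/-- What `scan` has found among the centers less than `N / 2`. -/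
def Scanned (n b N : ℕ) (rad ρ : ℕ → ℕ) : Prop :=
  ((∀ u < N, ¬ LongIn n b rad u) ∧ ρ 20 = 0 ∧ ρ 21 = 0 ∧ ρ 22 = 0 ∧ ρ 23 = 0) ∨
  ∃ u₁ u₂ u₃, u₁ < N ∧ u₂ < N ∧ u₃ < N ∧ LongIn n b rad u₁ ∧ LongIn n b rad u₂ ∧
    LongIn n b rad u₃ ∧ ρ 20 = u₁ / 2 + 2 * n - rad u₁ ∧
    ρ 21 = (u₂ + 1) / 2 + 2 * n + rad u₂ ∧ ρ 22 = 2 * rad u₃ + u₃ % 2 ∧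
    ρ 23 = u₃ / 2 + 2 * n - rad u₃ ∧
    ∀ u < N, LongIn n b rad u → u₁ ≤ u ∧ u ≤ u₂ ∧ 2 * rad u + u % 2 ≤ 2 * rad u₃ + u₃ % 2

theorem Scanned.skip {n b N : ℕ} {rad ρ ρ' : ℕ → ℕ} (h : Scanned n b N rad ρ)
    (hN : ¬ LongIn n b rad N) (hρ : ∀ x, 20 ≤ x → x < 24 → ρ' x = ρ x) :
    Scanned n b (N + 1) rad ρ' := by
  unfold Scanned
  rw [hρ 20 (by omega) (by omega), hρ 21 (by omega) (by omega), hρ 22 (by omega) (by omega),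
    hρ 23 (by omega) (by omega)]
  rcases h with ⟨h, h'⟩ | ⟨u₁, u₂, u₃, h1, h2, h3, g1, g2, g3, r1, r2, r3, r4, h⟩
  · refine .inl ⟨fun u hu hL => ?_, h'⟩
    rcases Nat.lt_succ_iff_lt_or_eq.1 hu with c | rfl
    · exact h u c hL
    · exact hN hL
  · refine .inr ⟨u₁, u₂, u₃, by omega, by omega, by omega, g1, g2, g3, r1, r2, r3, r4,
      fun u hu hL => ?_⟩
    rcases Nat.lt_succ_iff_lt_or_eq.1 hu with c | rfl
    · exact h u c hL
    · exact (hN hL).elim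

theorem Scanned.step {n b N : ℕ} {rad ρ ρ' : ℕ → ℕ} (hn : 0 < n) (h : Scanned n b N rad ρ)
    (hN : LongIn n b rad N)
    (h20 : ρ' 20 = if ρ 22 = 0 then N / 2 + 2 * n - rad N else ρ 20)
    (h21 : ρ' 21 = (N + 1) / 2 + 2 * n + rad N)
    (h22 : ρ' 22 = if ρ 22 < 2 * rad N + N % 2 then 2 * rad N + N % 2 else ρ 22)
    (h23 : ρ' 23 = if ρ 22 < 2 * rad N + N % 2 then N / 2 + 2 * n - rad N else ρ 23) :
    Scanned n b (N + 1) rad ρ' := by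
  have hpos := hN.2.2
  right
  rcases h with ⟨h, r1, r2, r3, r4⟩ | ⟨u₁, u₂, u₃, h1, h2, h3, g1, g2, g3, r1, r2, r3, r4, h⟩
  · rw [if_pos r3] at h20
    rw [if_pos (by omega)] at h22 h23
    refine ⟨N, N, N, by omega, by omega, by omega, hN, hN, hN, h20, h21, h22, h23,
      fun u hu hL => ?_⟩
    rcases Nat.lt_succ_iff_lt_or_eq.1 hu with c | rfl
    · exact (h u c hL).elim
    · omega
  · have := g3.2.2
    rw [if_neg (by omega)] at h20
    by_cases c : ρ 22 < 2 * rad N + N % 2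
    · rw [if_pos c] at h22 h23
      refine ⟨u₁, N, N, by omega, by omega, by omega, g1, hN, hN, h20.trans r1, h21, h22, h23,
        fun u hu hL => ?_⟩
      rcases Nat.lt_succ_iff_lt_or_eq.1 hu with c' | rfl
      · have := h u c' hL
        omega
      · omega
    · rw [if_neg c] at h22 h23
      refine ⟨u₁, N, u₃, by omega, by omega, by omega, g1, hN, g3, h20.trans r1, h21,
        h22.trans r3, h23.trans r4, fun u hu hL => ?_⟩
      rcases Nat.lt_succ_iff_lt_or_eq.1 hu with c' | rfl
      · have := h u c' hL
        omega
      · omega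

theorem run_scan {M n T o b : ℕ} {f : ℤ → Letter} {σ : State}
    (hb : Bounds M n T) (hc : Ctx n T σ.reg) (hR : RadTable n f (σ.arr (6 + o)))
    (hb10 : σ.reg 10 = b) (hb8 : b < 8) :
    Run M (scan o) σ (200 * n + 20) fun τ => τ.arr = σ.arr ∧ (∀ y < 11, τ.reg y = σ.reg y) ∧
      Scanned n b (2 * n) (σ.arr (6 + o)) τ.reg := by
  have hlin := hb.lin
  have hpos := hb.pos
  have hbn : b * n ≤ 8 * n := Nat.mul_le_mul_right _ (by omega)
  have hbn' : (b + 1) * n ≤ 8 * n := Nat.mul_le_mul_right _ (by omega)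
  obtain ⟨rad, hrad⟩ : ∃ rad, σ.arr (6 + o) = rad := ⟨_, rfl⟩
  rw [hrad] at hR ⊢
  refine Run.set_seq (by simp; omega) (by simp) ?_
  refine Run.set_seq (by simp; omega) (by simp) ?_
  refine Run.set_seq (by simp; omega) (by simp) ?_
  refine Run.set_seq (by simp; omega) (by simp) ?_
  refine Run.mono (Run.forLoop (N := 2 * n) (b := 80) (I := fun k τ => τ.arr = σ.arr ∧
    (∀ y < 11, τ.reg y = σ.reg y) ∧ Scanned n b k rad τ.reg) (by omega) ?_ ?_ ?_
    (by simp; omega)) le_rfl fun τ hτ => hτ.2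
  · refine ⟨rfl, fun y hy => ?_, .inl ⟨fun u hu => by omega, by simp, by simp, by simp, by simp⟩⟩
    simp [Function.update, show y ≠ 11 by omega, show y ≠ 20 by omega, show y ≠ 21 by omega,
      show y ≠ 22 by omega, show y ≠ 23 by omega]
  · rintro k τ - ⟨-, hreg, -⟩
    simp [hreg 6 (by omega), hc.r6]; omega
  · rintro s τ hs hs11 ⟨harr, hreg, hI⟩
    have e1 : τ.reg 1 = n := by rw [hreg 1 (by omega), hc.r1]
    have e10 : τ.reg 10 = b := by rw [hreg 10 (by omega), hb10]
    have hle := hR.le s hs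
    have h22 : τ.reg 22 < M := by
      rcases hI with ⟨-, -, -, h, -⟩ | ⟨u₁, u₂, u₃, -, -, h3, -, -, -, -, -, h, -⟩
      · omega
      · have := hR.le u₃ (by omega)
        omega
    refine Run.set_seq (by simp [hs11, harr, hrad]; omega) (by simp) ?_
    rw [show (Expr.read (6 + o) (.reg 11)).eval τ = rad s by simp [hs11, harr, hrad]]
    refine Run.set_seq (by simp [hs11, e1]; omega) (by simp) ?_
    refine Run.set_seq (by simp [hs11, e1]; omega) (by simp) ?_
    refine Run.set_seq (by simp [hs11]; omega) (by simp) ?_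
    obtain ⟨r, hr⟩ : ∃ r, rad s = r := ⟨_, rfl⟩
    -- the state after the four assignments
    obtain ⟨ρ, hρ, h12, h13, h14, h15, hρo⟩ : ∃ ρ : ℕ → ℕ,
        ρ = Function.update (Function.update (Function.update (Function.update τ.reg 12 r)
          13 (s / 2 + 2 * n - r)) 14 ((s + 1) / 2 + 2 * n + r)) 15 (2 * r + s % 2) ∧
        ρ 12 = r ∧ ρ 13 = s / 2 + 2 * n - r ∧ ρ 14 = (s + 1) / 2 + 2 * n + r ∧
        ρ 15 = 2 * r + s % 2 ∧ ∀ x, (x < 12 ∨ 15 < x) → ρ x = τ.reg x := by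
      refine ⟨_, rfl, by simp, by simp, by simp, by simp, fun x hx => ?_⟩
      simp [Function.update, show x ≠ 12 by omega, show x ≠ 13 by omega, show x ≠ 14 by omega,
        show x ≠ 15 by omega]
    refine Eq.subst (motive := fun st => Run M _ st _ _)
      (a := (⟨ρ, τ.arr⟩ : State)) (by simp [hρ, hr, hs11, e1]) ?_
    have f1 : ρ 1 = n := by rw [hρo 1 (by omega), e1]
    have f10 : ρ 10 = b := by rw [hρo 10 (by omega), e10]
    have f11 : ρ 11 = s := by rw [hρo 11 (by omega), hs11]
    have f22 := hρo 22 (by omega)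
    have hlong : LongIn n b rad s ↔ b * n < 4 * s + 1 ∧ 4 * s < (b + 1) * n ∧
        n < 4 * (2 * r + s % 2) + 1 := by
      rw [LongIn, hr]; omega
    rw [hr] at hle
    refine Run.ite ?_ (by simp) (fun hg => ?_) fun hg => ?_
    · simp only [Expr.fits_mul, Expr.fits_lt _ _ _ _ (show 1 < M by omega)]
      simp [f1, f10, f11, h15]
      split_ifs <;> omega
    · have hl : LongIn n b rad s := by
        rw [hlong]
        simp [f1, f10, f11, h15] at hg
        omega
      refine Run.seq (s := 6) (Q := _) (by simp) (Run.mono (Q := fun θ => θ.arr = σ.arr ∧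
        θ.reg 20 = (if τ.reg 22 = 0 then s / 2 + 2 * n - rad s else τ.reg 20) ∧
        ∀ x, x ≠ 20 → θ.reg x = ρ x) ?_ le_rfl ?_)
      · refine Run.ite (by simpa [f22] using h22) (by simp) (fun h0 => ?_) fun h0 => ?_
        · refine Run.skip ⟨harr, ?_, fun _ _ => rfl⟩ (by simp)
          simp [f22] at h0
          simp [h0, hρo 20 (by omega)]
        · refine Run.set (by simp [h13]; omega) (by simp) ⟨harr, ?_, fun x hx => ?_⟩
          · simp [f22] at h0
            simp [h0, h13, hr]
          · simp [Function.update, hx]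
      rintro θ ⟨k1, k2, k3⟩
      refine Run.set_seq (by simp [k3 14, h14]; omega) (by simp) ?_
      rw [show (Expr.reg 14).eval θ = (s + 1) / 2 + 2 * n + r by simp [k3 14, h14]]
      refine Run.ite ?_ (by simp) (fun hlt => ?_) fun hlt => ?_
      · rw [Expr.fits_lt _ _ _ _ (by omega)]
        simp [k3 22, k3 15, h15, f22, h22]; omega
      · simp [k3 22, k3 15, h15, f22] at hlt
        refine Run.set_seq (by simp [k3 15, h15]; omega) (by simp) ?_
        refine Run.set (by simp [k3 13, h13]; omega) (by simp) ?_
        refine ⟨by simp [k3 11, f11], k1, fun y hy => ?_, hI.step hpos hl ?_ ?_ ?_ ?_⟩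
        · simp [Function.update, show y ≠ 11 by omega, show y ≠ 21 by omega,
            show y ≠ 22 by omega, show y ≠ 23 by omega, k3 y (by omega), hρo y (by omega),
            hreg y hy]
        · simp [k2]
        · simp [hr]
        · simp [k3 15, h15, hr, hlt]
        · simp [k3 13, h13, hr, hlt]
      · simp [k3 22, k3 15, h15, f22] at hlt
        refine Run.skip ?_ (by simp)
        refine ⟨by simp [k3 11, f11], k1, fun y hy => ?_, hI.step hpos hl ?_ ?_ ?_ ?_⟩
        · simp [Function.update, show y ≠ 11 by omega, show y ≠ 21 by omega, k3 y (by omega),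
            hρo y (by omega), hreg y hy]
        · simp [k2]
        · simp [hr]
        · simp [k3 22, f22, hr, not_lt.2 hlt]
        · simp [k3 23, hρo 23 (by omega), hr, not_lt.2 hlt]
    · have hl : ¬ LongIn n b rad s := by
        rw [hlong]
        intro hh
        simp [f1, f10, f11, h15, hh.1, hh.2.1, hh.2.2] at hg
      refine Run.skip ⟨by simp [f11], harr, fun y hy => ?_, hI.skip hl fun x h1 h2 => ?_⟩ (by simp)
      · simp [Function.update, show y ≠ 11 by omega, hρo y (by omega), hreg y hy]
      · simp [Function.update, show x ≠ 11 by omega, hρo x (by omega)]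

/-- The search for the factorizations into four palindromes. One of the palindromes can be
assumed to be maximal and of length at least `n / 4`. In each block, there are three candidates
for the start or the end of such a palindrome. -/
def phaseUntranslated (o o' : ℕ) : Prog :=
  forLoop 10 8 (scan o ;; cut o o' 20 ;; cut o o' 21 ;; cut o o' 23)

theorem search_phaseUntranslated {M n T o o' : ℕ} {f : ℤ → Letter} {σ : State}
    (hb : Bounds M n T) (hs : Simple f n) (hc : Ctx n T σ.reg) (hA : Tables n T f o σ.arr)
    (hA' : Tables n T (rev f) o' σ.arr) :
    Search M (∃ i j k a p, HT f n i j k a p) 10 (phaseUntranslated o o') σ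
      (40000 * (n * (T + 1))) (∃ i j k p : ℤ, HT f n i j k 0 p) := by
  have hlin := hb.lin
  have hpos := hb.pos
  have hf := hs.periodic
  have hX1 : T + 1 ≤ n * (T + 1) := Nat.le_mul_of_pos_left _ hpos
  have hX2 : n * 1 ≤ n * (T + 1) := Nat.mul_le_mul_left _ (by omega)
  obtain ⟨rad, hrad⟩ : ∃ rad, σ.arr (6 + o) = rad := ⟨_, rfl⟩
  refine Search.mono (Search.forLoop (N := 8) (b := 4500 * (n * (T + 1)))
    (P := fun b => ∀ ρ, Scanned n b (2 * n) rad ρ → ∃ q, (q = ρ 20 ∨ q = ρ 21 ∨ q = ρ 23) ∧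
      ∃ j k p : ℤ, HT f n q j k 0 p) (by omega) (by omega) ?_ ?_ ?_) le_rfl ?_
  · intro τ _ _
    simp; omega
  · intro b τ hb8 hb10 harr hreg
    refine Search.seq (s := 200 * n + 20) (by omega) (Run.mono (run_scan (b := b) (o := o) hb
      (hc.of_eq fun r hr => hreg r (by omega) (by omega)) (by rw [harr]; exact hA.rad) hb10 hb8)
      le_rfl fun _ h => h) (by omega) ?_
    intro ρ harrρ hregρ hsc
    rw [harr, hrad] at hsc
    have hq : ρ.reg 20 ≤ 5 * n ∧ ρ.reg 21 ≤ 5 * n ∧ ρ.reg 23 ≤ 5 * n := by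
      rcases hsc with ⟨-, h⟩ | ⟨u₁, u₂, u₃, h1, h2, h3, -, -, -, r1, r2, r3, r4, -⟩
      · omega
      · have := hA.rad.le u₂ h2
        rw [hrad] at this
        omega
    have hcut : ∀ x, 9 < x → x < 30 → ρ.reg x ≤ 5 * n → ∀ θ : State, θ.arr = ρ.arr →
        (∀ y < 30, y ≠ 9 → θ.reg y = ρ.reg y) → Search M (∃ i j k a p, HT f n i j k a p) 30
          (cut o o' x) θ (1400 * (n * (T + 1))) (∃ j k p : ℤ, HT f n (ρ.reg x) j k 0 p) :=
      fun x h9 hx hqx θ harrθ hregθ => search_cut (q := ρ.reg x) hb hf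
        (hc.of_eq fun r hr => by
          rw [hregθ r (by omega) (by omega), hregρ r (by omega), hreg r (by omega) (by omega)])
        (by rw [harrθ, harrρ, harr]; exact hA) (by rw [harrθ, harrρ, harr]; exact hA')
        h9 hx (by rw [hregθ x hx (by omega)]) hqx
    have hall := Search.seq_search (s := 1400 * (n * (T + 1))) (t := 4200 * (n * (T + 1)))
      (by omega) (hcut 20 (by omega) (by omega) hq.1 ρ rfl fun _ _ _ => rfl)
      fun θ ha hr => (Search.seq_search (s := 1400 * (n * (T + 1))) (by omega)
        (hcut 21 (by omega) (by omega) hq.2.1 θ ha hr)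
        fun θ' ha' hr' => (hcut 23 (by omega) (by omega) hq.2.2 θ' (ha'.trans ha)
          fun y hy hy' => (hr' y hy hy').trans (hr y hy hy')).mono (by omega) fun h => h)
    refine (hall.of_le (show 11 ≤ 30 by omega)).mono (by omega) fun h => ?_
    obtain ⟨q, rfl | rfl | rfl, hh⟩ := h ρ.reg hsc
    · exact .inl hh
    · exact .inr (.inl hh)
    · exact .inr (.inr hh)
  · simp only [Expr.cost_ofNat]
    omega
  · rintro ⟨i, j, k, p, h⟩
    obtain ⟨i, j, k, p, h, hl, hmax⟩ := exists_long_maximal hs ⟨i, j, k, p, h⟩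
    obtain ⟨c, s, hcs, hs0, hs1⟩ := exists_center hpos (i + j)
    have hper := periodic_mul hf c
    have h' := h.translate hper
    have h1 := h'.hij
    have h2 := h'.hjk
    have h3 := h'.hkp
    have h4 := h'.hpi
    obtain ⟨I, hI⟩ : ∃ I : ℕ, i + c * n = I := ⟨(i + c * n).toNat, by omega⟩
    obtain ⟨J, hJ⟩ : ∃ J : ℕ, j + c * n = J := ⟨(j + c * n).toNat, by omega⟩
    have hmax' : (n : ℤ) - 1 ≤ J - I ∨ f (I - 1) ≠ f J := by
      rcases hmax with hm | hm
      · left; omega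
      · right
        rwa [← hI, ← hJ, show i + c * n - 1 = i - 1 + c * n by ring, hper, hper]
    rw [hI, hJ] at h'
    rw [hI, hJ] at h1
    rw [hI] at h4
    rw [hJ] at h2
    lift s to ℕ using hs0
    have hrads := hA.rad.eq_of_maximal (j := I) (k := J) (by omega) (by omega) (by omega) hpos
      h'.B hmax'
    rw [show I + J = s + 2 * n + 2 * n by omega, Nat.add_mod_right,
      Nat.add_mod_right, Nat.mod_eq_of_lt (by omega), hrad] at hrads
    have hlong : LongIn n (4 * s / n) rad s := by
      have hpar : s % 2 = (J - I) % 2 := by omega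
      refine ⟨Nat.div_mul_le_self _ _, ?_, by omega⟩
      have := Nat.lt_div_mul_add hpos (a := 4 * s)
      rw [add_mul]; omega
    refine ⟨4 * s / n, by rw [Nat.div_lt_iff_lt_mul hpos]; omega, fun ρ hsc => ?_⟩
    rcases hsc with ⟨hno, -⟩ | ⟨u₁, u₂, u₃, l1, l2, l3, g1, g2, g3, r1, r2, r3, r4, hbest⟩
    · exact (hno s (by omega) hlong).elim
    obtain ⟨b1, b2, b3⟩ := hbest s (by omega) hlong
    have b4 := (hbest u₁ l1 g1).2.2
    have b5 := (hbest u₂ l2 g2).2.2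
    have eI : s / 2 + 2 * n - rad s = I := by omega
    have eJ : J = I + (2 * rad s + s % 2) := by omega
    have key : ∀ u < 2 * n, ∃ x y : ℕ, u / 2 + 2 * n - rad u = x ∧
        (u + 1) / 2 + 2 * n + rad u = y ∧ x + y = u + 4 * n ∧ y = x + (2 * rad u + u % 2) ∧
        Pal f x y ∧ ((n : ℤ) - 1 ≤ y - x ∨ f (x - 1) ≠ f y) := by
      intro u hu
      have := hA.rad.le u hu
      have hpal := hA.rad.pal hu
      have hmx := hA.rad.maximal hu rfl rfl
      rw [hrad] at this hpal hmx
      exact ⟨_, _, rfl, rfl, by omega, by omega, hpal, hmx⟩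
    obtain ⟨x₁, y₁, c1, c2, c3, c4, hpal₁, hmx₁⟩ := key u₁ l1
    obtain ⟨x₂, y₂, d1, d2, d3, d4, hpal₂, hmx₂⟩ := key u₂ l2
    obtain ⟨x₃, y₃, e1, e2, e3, e4, hpal₃, hmx₃⟩ := key u₃ l3
    rw [c1] at r1
    rw [d2] at r2
    rw [e1] at r4
    have heq : s = u₃ → x₃ = I := fun h => by rw [← e1, ← eI, h]
    obtain ⟨q1, q2, q3⟩ := hlong
    obtain ⟨s1, s2, s3⟩ := g1
    obtain ⟨t1, t2, t3⟩ := g2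
    obtain ⟨v1, v2, v3⟩ := g3
    rw [add_mul] at q2 s2 t2 v2
    generalize 2 * rad s + s % 2 = m₀ at *
    generalize 2 * rad u₁ + u₁ % 2 = m₁ at *
    generalize 2 * rad u₂ + u₂ % 2 = m₂ at *
    generalize 2 * rad u₃ + u₃ % 2 = m₃ at *
    clear c1 c2 d1 d2 e1 e2
    rcases lt_trichotomy s u₃ with hlt | hlt | hlt
    · have := left_eq_of_longest hs h'.B hpal₁ hpal₃ hmax' hmx₁ (by omega) (by omega) (by omega)
        (by omega) (by omega) (by omega) (by omega)
      exact ⟨_, .inl rfl, J, _, _, by rw [r1, ← this]; exact h'⟩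
    · exact ⟨_, .inr (.inr rfl), J, _, _, by rw [r4, heq hlt]; exact h'⟩
    · have := right_eq_of_longest hs h'.B hpal₂ hpal₃ hmax' hmx₂ (by omega) (by omega) (by omega)
        (by omega) (by omega) (by omega) (by omega)
      refine ⟨_, .inr (.inl rfl), k + c * n, p + c * n, I + n, ?_⟩
      rw [r2, ← this]
      exact ⟨h2, by simpa using h'.hkp, le_rfl, by simpa using h4, by omega, h'.C,
        by simpa using h'.D, fun t h1 h2 => by omega, by simpa using h'.E,
        by simpa using h'.B.shift hf⟩

end WordRAM

/-! ### Naming the factors -/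

namespace WordRAM

open HalfTurn

theorem Run.store_seq {M t a : ℕ} {i e : Expr} {q : Prog} {σ : State} {Q : State → Prop}
    (hi : i.Fits M σ) (he : e.Fits M σ) (ht : i.cost + e.cost + 1 ≤ t)
    (h : Run M q ⟨σ.reg, Function.update σ.arr a (Function.update (σ.arr a) (i.eval σ)
      (e.eval σ))⟩ (t - (i.cost + e.cost + 1)) Q) : Run M (.store a i e ;; q) σ t Q :=
  Run.seq ht (Run.store hi he le_rfl h)

/-- The first `n` entries of an array are the codes of the letters of the word. -/
def Codes (n : ℕ) (f : ℤ → Letter) (a : ℕ → ℕ) : Prop := ∀ x < n, a x = (f x).code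

theorem Letter.code_lt (a : Letter) : a.code < 4 := by cases a <;> decide

theorem Letter.code_inj {a b : Letter} : a.code = b.code ↔ a = b := by
  cases a <;> cases b <;> decide

theorem Letter.code_comp (a : Letter) : a.comp.code = (a.code + 2) % 4 := by cases a <;> rfl

/-- Registers less than `11`, and all arrays but `a`, are the same in two states. -/
def SameBut (a : ℕ) (σ τ : State) : Prop :=
  (∀ y < 11, τ.reg y = σ.reg y) ∧ ∀ b, b ≠ a → τ.arr b = σ.arr b

theorem SameBut.refl (a : ℕ) (σ : State) : SameBut a σ σ := ⟨fun _ _ => rfl, fun _ _ => rfl⟩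

theorem SameBut.trans {a : ℕ} {σ τ ρ : State} (h : SameBut a σ τ) (h' : SameBut a τ ρ) :
    SameBut a σ ρ :=
  ⟨fun y hy => (h'.1 y hy).trans (h.1 y hy), fun b hb => (h'.2 b hb).trans (h.2 b hb)⟩

theorem SameBut.set {a x v : ℕ} {σ τ : State} (h : SameBut a σ τ) (hx : 11 ≤ x) :
    SameBut a σ ⟨Function.update τ.reg x v, τ.arr⟩ :=
  ⟨fun y hy => by simp [show y ≠ x by omega, h.1 y hy], h.2⟩

theorem SameBut.store {a : ℕ} {b : ℕ → ℕ} {σ τ : State} (h : SameBut a σ τ) :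
    SameBut a σ ⟨τ.reg, Function.update τ.arr a b⟩ :=
  ⟨h.1, fun c hc => by simp [hc, h.2 c hc]⟩

theorem SameBut.ctx {a n T : ℕ} {σ τ : State} (h : SameBut a σ τ) (hc : Ctx n T σ.reg) :
    Ctx n T τ.reg := hc.of_eq fun x hx => h.1 x (by omega)

/-- The names of the factors of length one: the codes of the letters. -/
def letterNames (o : ℕ) : Prog :=
  forLoop 11 (.reg 1)
    (.store (2 + o) (.reg 11) (.read o (.reg 11)) ;;
      .store (2 + o) (.reg 1 + .reg 11) (.read o (.reg 1 - 1 - .reg 11)) ;;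
      .store (2 + o) (2 * .reg 1 + .reg 11) ((.read o (.reg 11) + 2) % 4))

theorem run_letterNames {M n T o : ℕ} {f : ℤ → Letter} {σ : State} (hb : Bounds M n T)
    (hf : ∀ x, f (x + n) = f x) (hc : Ctx n T σ.reg) (hw : Codes n f (σ.arr o)) :
    Run M (letterNames o) σ (50 * n + 10) fun τ => SameBut (2 + o) σ τ ∧
      NameTable n 0 f (τ.arr (2 + o)) := by
  have hlin := hb.lin
  have hpos := hb.pos
  refine Run.mono (Run.forLoop (N := n) (b := 30) (I := fun k τ => SameBut (2 + o) σ τ ∧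
    ∀ z < 3, ∀ x < k, τ.arr (2 + o) (z * n + x) = (variant f z x).code) (by omega) ?_ ?_ ?_
    (by simp; omega)) le_rfl ?_
  · exact ⟨(SameBut.refl _ _).set le_rfl, fun z _ x hx => by omega⟩
  · rintro k τ - ⟨h, -⟩
    have := (h.ctx hc).r1
    simp [this]; omega
  · rintro k τ hk h11 ⟨h, hI⟩
    have e1 := (h.ctx hc).r1
    have ho : τ.arr o = σ.arr o := h.2 o (by omega)
    have w1 := hw k hk
    have w2 := hw (n - 1 - k) (by omega)
    have l1 := Letter.code_lt (f k)
    have l2 := Letter.code_lt (f (n - 1 - k : ℕ))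
    refine Run.store_seq (by simp [h11]; omega) (by simp [h11, ho, w1]; omega) (by simp) ?_
    refine Run.store_seq (by simp [h11, e1]; omega)
      (by simp [h11, e1, ho, w2]; omega) (by simp) ?_
    refine Run.store (by simp [h11, e1]; omega)
      (by simp [h11, e1, ho, w1]; omega) (by simp) ?_
    refine ⟨by simpa using h11, (h.store.store.store).set le_rfl, fun z hz x hx => ?_⟩
    have v1 : variant f 1 k = f (n - 1 - k : ℕ) := by
      simp only [variant, rev]
      rw [← hf]; congr 1; omega
    simp [h11, e1, Function.update_apply, ho, w1, w2]
    rcases Nat.lt_succ_iff_lt_or_eq.1 hx with c | rfl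
    · have := hI z hz x c
      interval_cases z
      · rw [if_neg (by omega), if_neg (by omega), if_neg (by omega), this]
      · rw [if_neg (by omega), if_neg (by omega), if_neg (by omega), this]
      · rw [if_neg (by omega), if_neg (by omega), if_neg (by omega), this]
    · interval_cases z
      · rw [if_neg (by omega), if_neg (by omega), if_pos (by omega)]; rfl
      · rw [if_neg (by omega), if_pos (by omega), v1]
      · rw [if_pos (by omega), ← Letter.code_comp]; rfl
  · rintro τ ⟨-, h, hI⟩
    refine ⟨h, ⟨fun k hk z hz z' hz' x hx x' hx' => ?_, fun k hk y hy => ?_⟩⟩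
    · obtain rfl : k = 0 := by omega
      simp only [zero_mul, zero_add, hI z hz x hx, hI z' hz' x' hx', Letter.code_inj, pow_zero,
        Nat.lt_one_iff, forall_eq, Nat.cast_zero, add_zero]
    · obtain rfl : k = 0 := by omega
      have h1 : y / n < 3 := by rw [Nat.div_lt_iff_lt_mul hpos]; omega
      have := hI (y / n) h1 (y % n) (Nat.mod_lt _ hpos)
      rw [Nat.div_add_mod'] at this
      rw [zero_mul, zero_add, this]
      have := Letter.code_lt (variant f (y / n) (y % n : ℕ))
      omega

theorem mul_add_inj {S a b a' b' : ℕ} (hb : b < S) (hb' : b' < S)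
    (h : a * S + b = a' * S + b') : a = a' ∧ b = b' := by
  have h1 : (a * S + b) / S = a := by
    rw [mul_comm, Nat.mul_add_div (by omega), Nat.div_eq_of_lt hb, add_zero]
  have h2 : (a' * S + b') / S = a' := by
    rw [mul_comm, Nat.mul_add_div (by omega), Nat.div_eq_of_lt hb', add_zero]
  have : a = a' := by rw [← h1, h, h2]
  subst this
  exact ⟨rfl, by omega⟩

/-- The factor that follows the factor number `y`, when both have length `2 ^ t`. -/
def partner (n t y : ℕ) : ℕ := y - y % n + (y + 2 ^ t) % n

theorem partner_lt {n t y : ℕ} (hn : 0 < n) (hy : y < 3 * n) : partner n t y < 3 * n := by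
  have h1 := Nat.mod_lt (y + 2 ^ t) hn
  have h2 := Nat.div_add_mod' y n
  have h3 : y / n < 3 := by rw [Nat.div_lt_iff_lt_mul hn]; omega
  have h4 : y / n * n ≤ 2 * n := Nat.mul_le_mul_right _ (by omega)
  unfold partner
  omega

/-- The names for length `2 ^ (t + 1)`, from those for length `2 ^ t`: the pairs of names of
consecutive factors have to be replaced by names. The name of a pair is its first occurrence. The
array `4 + o` stores the first occurrences, increased by one. -/
def pairNames (o : ℕ) : Prog :=
  forLoop 13 (.reg 2)
    (.set 14 (.read (2 + o) (.reg 12 * .reg 2 + .reg 13)) ;;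
      .set 15 (.read (2 + o) (.reg 12 * .reg 2 + (.reg 13 - .reg 13 % .reg 1 +
        (.reg 13 + .read 10 (.reg 12)) % .reg 1))) ;;
      .set 16 ((.reg 12 * (.reg 2 + 4) + .reg 14) * (.reg 2 + 4) + .reg 15) ;;
      .ite (.read (4 + o) (.reg 16)) .skip (.store (4 + o) (.reg 16) (.reg 13 + 1)) ;;
      .store (2 + o) ((.reg 12 + 1) * .reg 2 + .reg 13) (.read (4 + o) (.reg 16) - 1))

/-- The entry for the pair `(a, b)` of names on level `t`. -/
def pairKey (n t a b : ℕ) : ℕ := (t * (3 * n + 4) + a) * (3 * n + 4) + b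

theorem pairKey_inj {n t a b t' a' b' : ℕ} (ha : a < 3 * n + 4) (hb : b < 3 * n + 4)
    (ha' : a' < 3 * n + 4) (hb' : b' < 3 * n + 4) (h : pairKey n t a b = pairKey n t' a' b') :
    t = t' ∧ a = a' ∧ b = b' := by
  obtain ⟨h1, h2⟩ := mul_add_inj hb hb' h
  obtain ⟨h3, h4⟩ := mul_add_inj ha ha' h1
  exact ⟨h3, h4, h2⟩

theorem pairKey_lt {M n T t a b : ℕ} (hbd : Bounds M n T) (ht : t ≤ T) (ha : a < 3 * n + 4)
    (hb : b < 3 * n + 4) : pairKey n t a b < M ∧ t * (3 * n + 4) + a < M ∧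
      (t * (3 * n + 4) + a) * (3 * n + 4) < M := by
  have h0 := hbd.dict
  have h1 : (t * (3 * n + 4) + a) ≤ (T + 1) * (3 * n + 4) := by
    have : t * (3 * n + 4) ≤ T * (3 * n + 4) := Nat.mul_le_mul_right _ ht
    rw [add_mul]; omega
  have h2 : (t * (3 * n + 4) + a) * (3 * n + 4) ≤ (T + 1) * (3 * n + 4) * (3 * n + 4) :=
    Nat.mul_le_mul_right _ h1
  have h3 : (t * (3 * n + 4) + a) ≤ (t * (3 * n + 4) + a) * (3 * n + 4) :=
    Nat.le_mul_of_pos_right _ (by omega)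
  have h4 : (T + 2) * ((3 * n + 4) * (3 * n + 4)) = (T + 1) * (3 * n + 4) * (3 * n + 4) +
    (3 * n + 4) * (3 * n + 4) := by ring
  unfold pairKey
  omega

/-- The state of the naming of pairs on level `t`, after `m` factors. -/
structure PairNames (n t m : ℕ) (N N' D : ℕ → ℕ) : Prop where
  same : ∀ x < (t + 1) * (3 * n), N' x = N x
  zero : ∀ t' > t, ∀ a < 3 * n + 4, ∀ b < 3 * n + 4, D (pairKey n t' a b) = 0
  first : ∀ a < 3 * n + 4, ∀ b < 3 * n + 4, D (pairKey n t a b) = 0 ∨ ∃ y < m,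
    D (pairKey n t a b) = y + 1 ∧ N (t * (3 * n) + y) = a ∧ N (t * (3 * n) + partner n t y) = b
  eq : ∀ y < m, D (pairKey n t (N (t * (3 * n) + y)) (N (t * (3 * n) + partner n t y))) =
    N' ((t + 1) * (3 * n) + y) + 1

theorem PairNames.nameTable {n t : ℕ} {f : ℤ → Letter} {N N' D : ℕ → ℕ} (hn : 0 < n)
    (hf : ∀ x, f (x + n) = f x) (hN : NameTable n t f N) (h : PairNames n t (3 * n) N N' D) :
    NameTable n (t + 1) f N' := by
  have hlt : ∀ y < 3 * n, N (t * (3 * n) + y) < 3 * n + 4 := hN.lt t le_rfl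
  have hidx : ∀ z < 3, ∀ x < n, z * n + x < 3 * n := fun z hz x hx => by
    have : z * n ≤ 2 * n := Nat.mul_le_mul_right _ (by omega)
    omega
  have hsame : ∀ k ≤ t, ∀ y < 3 * n, N' (k * (3 * n) + y) = N (k * (3 * n) + y) := by
    intro k hk y hy
    apply h.same
    have : k * (3 * n) ≤ t * (3 * n) := Nat.mul_le_mul_right _ hk
    rw [add_mul]; omega
  -- the new names are those of the pairs
  have hnew : ∀ y < 3 * n, ∀ y' < 3 * n,
      (N' ((t + 1) * (3 * n) + y) = N' ((t + 1) * (3 * n) + y') ↔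
        N (t * (3 * n) + y) = N (t * (3 * n) + y') ∧
        N (t * (3 * n) + partner n t y) = N (t * (3 * n) + partner n t y')) := by
    intro y hy y' hy'
    have h1 := h.eq y hy
    have h2 := h.eq y' hy'
    constructor
    · intro e
      rcases h.first _ (hlt y hy) _ (hlt _ (partner_lt (t := t) hn hy)) with c | ⟨u, -, c, c1, c2⟩
      · omega
      rcases h.first _ (hlt y' hy') _ (hlt _ (partner_lt (t := t) hn hy')) with
        c' | ⟨u', -, c', c1', c2'⟩
      · omega
      obtain rfl : u = u' := by omega
      exact ⟨c1.symm.trans c1', c2.symm.trans c2'⟩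
    · rintro ⟨e1, e2⟩
      rw [e1, e2] at h1
      omega
  constructor
  · intro k hk z hz z' hz' x hx x' hx'
    rcases Nat.lt_succ_iff_lt_or_eq.1 (Nat.lt_succ_of_le hk) with c | rfl
    · rw [hsame k (by omega) _ (hidx z hz x hx), hsame k (by omega) _ (hidx z' hz' x' hx')]
      exact hN.eq_iff k (by omega) z hz z' hz' x hx x' hx'
    · have hp : ∀ z x, x < n → partner n t (z * n + x) = z * n + (x + 2 ^ t) % n := by
        intro z x hx
        have : (z * n + x) % n = x := by
          rw [add_comm, Nat.add_mul_mod_self_right, Nat.mod_eq_of_lt hx]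
        rw [partner, this, add_assoc (z * n), Nat.mul_add_mod']; omega
      rw [hnew _ (hidx z hz x hx) _ (hidx z' hz' x' hx'), hp z x hx, hp z' x' hx',
        hN.eq_iff t le_rfl z hz z' hz' x hx x' hx',
        hN.eq_iff t le_rfl z hz z' hz' _ (Nat.mod_lt _ hn) _ (Nat.mod_lt _ hn)]
      simp only [variant_mod hf, pow_succ]
      constructor
      · rintro ⟨h1, h2⟩ u hu
        rcases Nat.lt_or_ge u (2 ^ t) with c | c
        · exact h1 u c
        · have := h2 (u - 2 ^ t) (by omega)
          rw [show ((x + 2 ^ t : ℕ) : ℤ) + (u - 2 ^ t : ℕ) = x + u by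
              rw [← Nat.cast_add, ← Nat.cast_add]; congr 1; omega,
            show ((x' + 2 ^ t : ℕ) : ℤ) + (u - 2 ^ t : ℕ) = x' + u by
              rw [← Nat.cast_add, ← Nat.cast_add]; congr 1; omega] at this
          exact this
      · intro h
        refine ⟨fun u hu => h u (by omega), fun u hu => ?_⟩
        have := h (2 ^ t + u) (by omega)
        push_cast at this ⊢
        rwa [add_assoc, add_assoc]
  · intro k hk y hy
    rcases Nat.lt_succ_iff_lt_or_eq.1 (Nat.lt_succ_of_le hk) with c | rfl
    · rw [hsame k (by omega) y hy]
      exact hN.lt k (by omega) y hy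
    · have h1 := h.eq y hy
      rcases h.first _ (hlt y hy) _ (hlt _ (partner_lt (t := t) hn hy)) with c | ⟨u, hu, c, -, -⟩
      · omega
      · omega

/-- Registers less than `11`, and all arrays but `a` and `b`, are the same in two states. -/
def SameBut₂ (a b : ℕ) (σ τ : State) : Prop :=
  (∀ y < 11, τ.reg y = σ.reg y) ∧ ∀ c, c ≠ a → c ≠ b → τ.arr c = σ.arr c

theorem PairNames.step {n t m a b : ℕ} {N N' D D' : ℕ → ℕ} (h : PairNames n t m N N' D)
    (ha : a < 3 * n + 4) (hb : b < 3 * n + 4) (hNa : N (t * (3 * n) + m) = a)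
    (hNb : N (t * (3 * n) + partner n t m) = b)
    (hD : D (pairKey n t a b) ≠ 0 ∧ D' = D ∨
      D (pairKey n t a b) = 0 ∧ D' = Function.update D (pairKey n t a b) (m + 1))
    (hN : ∀ y < m, N (t * (3 * n) + y) < 3 * n + 4 ∧
      N (t * (3 * n) + partner n t y) < 3 * n + 4) :
    PairNames n t (m + 1) N (Function.update N' ((t + 1) * (3 * n) + m)
      (D' (pairKey n t a b) - 1)) D' := by
  have hne : D' (pairKey n t a b) ≠ 0 := by
    rcases hD with ⟨h1, rfl⟩ | ⟨-, rfl⟩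
    · exact h1
    · simp
  -- entries that are not `0` do not change
  have hkeep : ∀ k, D k ≠ 0 → D' k = D k := by
    intro k hk
    rcases hD with ⟨-, rfl⟩ | ⟨h1, rfl⟩
    · rfl
    · rw [Function.update_of_ne]
      rintro rfl
      exact hk h1
  refine ⟨fun x hx => ?_, fun t' ht' a' ha' b' hb' => ?_, fun a' ha' b' hb' => ?_,
    fun y hy => ?_⟩
  · rw [Function.update_of_ne (by omega), h.same x hx]
  · rcases hD with ⟨-, rfl⟩ | ⟨-, rfl⟩
    · exact h.zero t' ht' a' ha' b' hb'
    · rw [Function.update_of_ne, h.zero t' ht' a' ha' b' hb']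
      intro e
      have := (pairKey_inj ha' hb' ha hb e).1
      omega
  · rcases hD with ⟨-, rfl⟩ | ⟨-, rfl⟩
    · rcases h.first a' ha' b' hb' with c | ⟨y, hy, c⟩
      · exact .inl c
      · exact .inr ⟨y, by omega, c⟩
    · by_cases e : pairKey n t a' b' = pairKey n t a b
      · obtain ⟨-, rfl, rfl⟩ := pairKey_inj ha' hb' ha hb e
        exact .inr ⟨m, by omega, by simp, hNa, hNb⟩
      · rw [Function.update_of_ne e]
        rcases h.first a' ha' b' hb' with c | ⟨y, hy, c⟩
        · exact .inl c
        · exact .inr ⟨y, by omega, c⟩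
  · rcases Nat.lt_succ_iff_lt_or_eq.1 hy with c | rfl
    · rw [Function.update_of_ne (by omega), ← h.eq y c, hkeep]
      rw [h.eq y c]; omega
    · rw [hNa, hNb, Function.update_self]; omega

theorem run_pairNames {M n T o t : ℕ} {f : ℤ → Letter} {σ : State} (hb : Bounds M n T)
    (hc : Ctx n T σ.reg) (hP : Pows T σ.arr) (hN : NameTable n t f (σ.arr (2 + o)))
    (ho : o < 2) (ht : t < T) (h12 : σ.reg 12 = t)
    (hD : ∀ t' ≥ t, ∀ a < 3 * n + 4, ∀ b < 3 * n + 4, σ.arr (4 + o) (pairKey n t' a b) = 0) :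
    Run M (pairNames o) σ (300 * n + 10) fun τ => τ.reg 12 = t ∧ SameBut₂ (2 + o) (4 + o) σ τ ∧
      PairNames n t (3 * n) (σ.arr (2 + o)) (τ.arr (2 + o)) (τ.arr (4 + o)) := by
  have hlin := hb.lin
  have hpos := hb.pos
  have hp := hb.pow_succ_le
  have hT := hb.T_le
  have hpt := hP t ht.le
  have hpt' : 2 ^ t ≤ 2 ^ (T + 1) := Nat.pow_le_pow_right (by norm_num) (by omega)
  refine Run.mono (Run.forLoop (N := 3 * n) (b := 80) (I := fun m τ => τ.reg 12 = t ∧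
    SameBut₂ (2 + o) (4 + o) σ τ ∧
    PairNames n t m (σ.arr (2 + o)) (τ.arr (2 + o)) (τ.arr (4 + o))) (by omega) ?_ ?_ ?_
    (by simp; omega)) le_rfl fun τ hτ => hτ.2
  · refine ⟨by simp [h12], ⟨fun y hy => ?_, fun _ _ _ => rfl⟩, fun _ _ => rfl,
      fun t' h => hD t' h.le, fun a ha b hb' => .inl (hD t le_rfl a ha b hb'),
      fun y hy => by omega⟩
    simp [show y ≠ 13 by omega]
  · rintro k τ - ⟨-, h, -⟩
    simp [h.1 2 (by omega), hc.r2]; omega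
  · rintro m τ hm h13 ⟨e12, h, hI⟩
    have e1 : τ.reg 1 = n := by rw [h.1 1 (by omega), hc.r1]
    have e2 : τ.reg 2 = 3 * n := by rw [h.1 2 (by omega), hc.r2]
    have e10 : τ.arr 10 t = 2 ^ t := by rw [h.2 10 (by omega) (by omega), hpt]
    have hpl := partner_lt (t := t) hpos hm
    have hmn := Nat.mod_le m n
    have hpm := Nat.mod_lt (m + 2 ^ t) hpos
    have b0 := hb.name_lt (k := t) (y := m) (by omega) (by omega)
    have b1 := hb.name_lt (k := t) (y := partner n t m) (by omega) (by omega)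
    have b2 := hb.name_lt (k := t + 1) (y := m) (by omega) (by omega)
    have hs1 := hI.same (t * (3 * n) + m) (by rw [add_mul]; omega)
    have hs2 := hI.same (t * (3 * n) + partner n t m) (by rw [add_mul]; omega)
    obtain ⟨a, ha⟩ : ∃ a, σ.arr (2 + o) (t * (3 * n) + m) = a := ⟨_, rfl⟩
    obtain ⟨b, hb'⟩ : ∃ b, σ.arr (2 + o) (t * (3 * n) + partner n t m) = b := ⟨_, rfl⟩
    have ha' : a < 3 * n + 4 := ha ▸ hN.lt t le_rfl m hm
    have hbl : b < 3 * n + 4 := hb' ▸ hN.lt t le_rfl _ hpl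
    rw [ha] at hs1
    rw [hb'] at hs2
    obtain ⟨k1, k2, k3⟩ := pairKey_lt hb ht.le ha' hbl
    refine Run.set_seq (by simp [e12, e2, h13, hs1]; omega) (by simp) ?_
    rw [show (Expr.read (2 + o) (.reg 12 * .reg 2 + .reg 13)).eval τ = a by
      simp [e12, e2, h13, hs1]]
    have hidx : t * (3 * n) + (m - m % n + (m + 2 ^ t) % n) =
      t * (3 * n) + partner n t m := rfl
    refine Run.set_seq ?_ (by simp) ?_
    · simp [e12, e1, e2, h13, e10]
      rw [hidx, hs2]; unfold partner at b1; omega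
    rw [show (Expr.read (2 + o) (.reg 12 * .reg 2 + (.reg 13 - .reg 13 % .reg 1 +
        (.reg 13 + .read 10 (.reg 12)) % .reg 1))).eval
          ⟨Function.update τ.reg 14 a, τ.arr⟩ = b by
      simp [e12, e1, e2, h13, e10]
      rw [hidx, hs2]]
    have hS : t * (3 * n + 4) ≤ t * (3 * n + 4) + a := by omega
    refine Run.set_seq ?_ (by simp) ?_
    · simp [e12, e2]
      unfold pairKey at k1
      omega
    rw [show ((Expr.reg 12 * (.reg 2 + 4) + .reg 14) * (.reg 2 + 4) + .reg 15).eval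
        ⟨Function.update (Function.update τ.reg 14 a) 15 b, τ.arr⟩ = pairKey n t a b by
      simp [e12, e2, pairKey]]
    -- the state after the four assignments
    obtain ⟨ρ, hρ, h16, hρo⟩ : ∃ ρ : ℕ → ℕ, ρ = Function.update (Function.update (Function.update
        τ.reg 14 a) 15 b) 16 (pairKey n t a b) ∧ ρ 16 = pairKey n t a b ∧
        ∀ x < 14, ρ x = τ.reg x := by
      refine ⟨_, rfl, by simp, fun x hx => ?_⟩
      simp [show x ≠ 14 by omega, show x ≠ 15 by omega, show x ≠ 16 by omega]
    rw [← hρ]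
    have f2 := hρo 2 (by omega)
    have f12 := hρo 12 (by omega)
    have f13 := hρo 13 (by omega)
    have hDM : τ.arr (4 + o) (pairKey n t a b) < M := by
      rcases hI.first a ha' b hbl with c | ⟨y, hy, c, -⟩ <;> omega
    refine Run.seq (s := 12) (by simp) (Run.mono (Q := fun θ => θ.reg = ρ ∧
      (∀ c, c ≠ 4 + o → θ.arr c = τ.arr c) ∧ θ.arr (4 + o) (pairKey n t a b) < M ∧
      (τ.arr (4 + o) (pairKey n t a b) ≠ 0 ∧ θ.arr (4 + o) = τ.arr (4 + o) ∨
        τ.arr (4 + o) (pairKey n t a b) = 0 ∧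
        θ.arr (4 + o) = Function.update (τ.arr (4 + o)) (pairKey n t a b) (m + 1)))
      ?_ le_rfl ?_)
    · refine Run.ite (by simp [h16]; omega) (by simp) (fun h0 => ?_) fun h0 => ?_
      · simp [h16] at h0
        exact Run.skip ⟨rfl, fun _ _ => rfl, hDM, .inl ⟨h0, rfl⟩⟩ (by simp)
      · simp [h16] at h0
        refine Run.store (by simp [h16]; omega) (by simp [f13, h13]; omega) (by simp)
          ⟨rfl, fun c hc => ?_, ?_, .inr ⟨h0, ?_⟩⟩
        · simp [hc]
        · simp [h16, f13, h13]; omega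
        · simp [h16, f13, h13]
    rintro θ ⟨q1, q2, q3, q4⟩
    have q5 : θ.arr (2 + o) = τ.arr (2 + o) := q2 _ (by omega)
    have q6 : (t + 1) * (3 * n) + m < M := b2
    refine Run.store ?_ (by simp [q1, h16]; omega) (by simp) ?_
    · simp [q1, f12, f2, f13, e12, e2, h13]
      have : t + 1 ≤ (t + 1) * (3 * n) := Nat.le_mul_of_pos_right _ (by omega)
      omega
    refine ⟨by simp [q1, f13, h13], by simp [q1, f12, e12], ⟨fun y hy => ?_, fun c h1 h2 => ?_⟩,
      ?_⟩
    · simp [q1, show y ≠ 13 by omega, hρo y (by omega), h.1 y hy]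
    · simp [h1, q2 c h2, h.2 c h1 h2]
    · have := hI.step ha' hbl ha hb' q4 fun y hy => ⟨hN.lt t le_rfl y (by omega),
        hN.lt t le_rfl _ (partner_lt hpos (by omega))⟩
      simpa [q1, h16, f12, f2, f13, e12, e2, h13, q5] using this

/-- The names for all lengths `2 ^ t` with `t` up to the value of register `3`. -/
def names (o : ℕ) : Prog := letterNames o ;; forLoop 12 (.reg 3) (pairNames o)

theorem run_names {M n T o : ℕ} {f : ℤ → Letter} {σ : State} (hb : Bounds M n T)
    (hf : ∀ x, f (x + n) = f x) (hc : Ctx n T σ.reg) (hw : Codes n f (σ.arr o))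
    (hP : Pows T σ.arr) (ho : o < 2) (hD : ∀ x, σ.arr (4 + o) x = 0) :
    Run M (names o) σ (400 * (n * (T + 1))) fun τ => SameBut₂ (2 + o) (4 + o) σ τ ∧
      NameTable n T f (τ.arr (2 + o)) := by
  have hlin := hb.lin
  have hpos := hb.pos
  have hT := hb.T_le
  have hX : n * (T + 1) = n * T + n := by ring
  have hX1 : T * 1 ≤ T * n := Nat.mul_le_mul_left _ (by omega)
  have hX2 : T * n = n * T := mul_comm _ _
  refine Run.seq (s := 50 * n + 10) (by omega) (Run.mono (run_letterNames hb hf hc hw) le_rfl ?_)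
  rintro τ ⟨h, h0⟩
  refine Run.mono (Run.forLoop (N := T) (b := 300 * n + 10) (I := fun t τ =>
    SameBut₂ (2 + o) (4 + o) σ τ ∧ NameTable n t f (τ.arr (2 + o)) ∧
    ∀ t' ≥ t, ∀ a < 3 * n + 4, ∀ b < 3 * n + 4, τ.arr (4 + o) (pairKey n t' a b) = 0)
    (by omega) ?_ ?_ ?_ ?_) le_rfl fun τ hτ => ⟨hτ.2.1, hτ.2.2.1⟩
  · refine ⟨⟨fun y hy => ?_, fun c h1 _ => h.2 c h1⟩, h0, fun t _ a _ b _ => ?_⟩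
    · simp [show y ≠ 12 by omega, h.1 y hy]
    · rw [← hD (pairKey n t a b)]; simp [h.2 (4 + o) (by omega)]
  · rintro t τ - ⟨h, -⟩
    simp [h.1 3 (by omega), hc.r3]; omega
  · rintro t τ ht h12 ⟨h, h1, h2⟩
    refine Run.mono (run_pairNames hb (hc.of_eq fun x hx => h.1 x (by omega))
      (fun t ht => by rw [h.2 10 (by omega) (by omega), hP t ht]) h1 ho ht h12 h2) le_rfl ?_
    rintro ρ ⟨g1, g2, g3⟩
    refine ⟨g1, ⟨fun y hy => ?_, fun c h1 h2 => ?_⟩, g3.nameTable hpos hf h1,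
      fun t' ht' => g3.zero t' ht'⟩
    · simp [show y ≠ 12 by omega, g2.1 y hy, h.1 y hy]
    · rw [← h.2 c h1 h2, ← g2.2 c h1 h2]
  · simp only [Expr.cost_reg]
    have : T * (300 * n + 10 + 1 + 7) = 300 * (n * T) + 18 * T := by ring
    omega

end WordRAM

/-! ### Tables of palindromes -/

namespace WordRAM

open HalfTurn

theorem pal_iff_center {f : ℤ → Letter} {i j : ℤ} (hij : i ≤ j) :
    Pal f i j ↔ ∀ u : ℤ, 0 ≤ u → u < (j - i) / 2 → f ((i + j) / 2 - 1 - u) =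
      f ((i + j + 1) / 2 + u) := by
  constructor
  · intro h u h1 h2
    rw [h _ (by omega) (by omega)]; congr 1; omega
  · intro h t h1 h2
    rcases lt_or_ge t ((i + j) / 2) with c | c
    · have := h ((i + j) / 2 - 1 - t) (by omega) (by omega)
      rw [show (i + j) / 2 - 1 - ((i + j) / 2 - 1 - t) = t by omega] at this
      rw [this]; congr 1; omega
    · rcases lt_or_ge t ((i + j + 1) / 2) with c' | c'
      · congr 1; omega
      · have := h (t - (i + j + 1) / 2) (by omega) (by omega)
        rw [show (i + j + 1) / 2 + (t - (i + j + 1) / 2) = t by omega] at this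
        rw [← this]; congr 1; omega

/-- The radii of the maximal palindromes, by center. -/
def radii (o : ℕ) : Prog :=
  forLoop 11 (.reg 6)
    (lceOf o 1 0 (8 * .reg 1 - .reg 11 / 2) ((.reg 11 + 1) / 2) ;;
      .store (6 + o) (.reg 11) (.reg 62 - (.reg 62 - (.reg 1 - .reg 11 % 2) / 2)))

theorem run_radii {M n T o : ℕ} {f : ℤ → Letter} {σ : State} (hb : Bounds M n T)
    (hf : ∀ x, f (x + n) = f x) (hc : Ctx n T σ.reg) (hN : NameTable n T f (σ.arr (2 + o))) :
    Run M (radii o) σ (400 * (n * (T + 1))) fun τ => SameBut (6 + o) σ τ ∧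
      RadTable n f (τ.arr (6 + o)) := by
  have hlin := hb.lin
  have hpos := hb.pos
  have hp := hb.pow_succ_le
  have hX1 : T + 1 ≤ n * (T + 1) := Nat.le_mul_of_pos_left _ hpos
  have hX2 : n * 1 ≤ n * (T + 1) := Nat.mul_le_mul_left _ (by omega)
  refine Run.mono (Run.forLoop (N := 2 * n) (b := 100 * (T + 1) + 50) (I := fun k τ =>
    SameBut (6 + o) σ τ ∧ ∀ s < k, 2 * τ.arr (6 + o) s + s % 2 ≤ n ∧
      ∀ h : ℕ, 2 * h + s % 2 ≤ n → (h ≤ τ.arr (6 + o) s ↔ ∀ u : ℤ, 0 ≤ u → u < h →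
        f ((s / 2 : ℕ) - 1 - u) = f (((s + 1) / 2 : ℕ) + u))) (by omega) ?_ ?_ ?_ ?_) le_rfl ?_
  · exact ⟨(SameBut.refl _ _).set le_rfl, fun s hs => by omega⟩
  · rintro k τ - ⟨h, -⟩
    simp [(h.ctx hc).r6]; omega
  · rintro s τ hs h11 ⟨h, hI⟩
    have hcτ := h.ctx hc
    have e1 := hcτ.r1
    refine Run.seq (s := 100 * (T + 1) + 22) (by omega) (Run.mono (run_lceOf (f := f)
      (x := 8 * n - s / 2) (y := (s + 1) / 2) hb hf hcτ
      (by rw [h.2 (2 + o) (by omega)]; exact hN) (by omega) (by omega) (by simp [h11, e1]; omega)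
      (by simp [h11]; omega) (by simp) (by omega) (by omega)) le_rfl ?_)
    rintro ρ ⟨h1, h2, h3, h4, h5⟩
    have f11 : ρ.reg 11 = s := by rw [h2 11 (by omega), h11]
    have f1 : ρ.reg 1 = n := by rw [h2 1 (by omega), e1]
    simp only [variant_one hf (show s / 2 ≤ 8 * n by omega)] at h4 h5
    simp only [variant] at h4 h5
    obtain ⟨r, hr⟩ : ∃ r, ρ.reg 62 = r := ⟨_, rfl⟩
    rw [hr] at h3 h4 h5
    refine Run.store (by simp [f11]; omega) (by simp [f11, f1, hr]; omega) (by simp) ?_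
    refine ⟨f11, (SameBut.store ⟨fun y hy => (h2 y (by omega)).trans (h.1 y hy),
      fun b hb => by rw [h1, h.2 b hb]⟩).set le_rfl, fun s' hs' => ?_⟩
    rcases Nat.lt_succ_iff_lt_or_eq.1 hs' with c | rfl
    · simp [f11, c.ne, h1]
      exact hI s' c
    · simp only [Expr.eval_reg, Expr.eval_sub, Expr.eval_div, Expr.eval_mod, Expr.eval_ofNat, f11,
        f1, hr, Function.update_self]
      refine ⟨by omega, fun l hl => ⟨fun hlr u hu hul => ?_, fun hall => ?_⟩⟩
      · have := h4 u.toNat (by omega)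
        rwa [show ((u.toNat : ℕ) : ℤ) = u by omega] at this
      · by_contra hlt
        rcases h5 with c | c
        · exact c (hall r (by omega) (by omega))
        · omega
  · simp only [Expr.cost_reg]
    have : 2 * n * (100 * (T + 1) + 50 + 1 + 7) = 200 * (n * (T + 1)) + 116 * n := by ring
    omega
  · rintro τ ⟨-, h, hI⟩
    refine ⟨h, fun s hs => (hI s hs).1, fun i j hij hji => ?_⟩
    have hs := Nat.mod_lt (i + j) (show 0 < 2 * n by omega)
    have hpar : (i + j) % (2 * n) % 2 = (i + j) % 2 := Nat.mod_mod_of_dvd _ ⟨n, rfl⟩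
    rw [(hI _ hs).2 _ (by omega), pal_iff_center (by omega)]
    obtain ⟨s, hs'⟩ : ∃ s, (i + j) % (2 * n) = s := ⟨_, rfl⟩
    obtain ⟨c, hcdef⟩ : ∃ c, (i + j) / (2 * n) = c := ⟨_, rfl⟩
    have hdiv := Nat.mod_add_div (i + j) (2 * n)
    rw [hs', hcdef, mul_assoc] at hdiv
    rw [hs']
    have hcast : ((j : ℤ) - i) / 2 = ((j - i) / 2 : ℕ) := by omega
    rw [hcast]
    have g1 : ((i : ℤ) + j) / 2 = (s / 2 : ℕ) + (n * c : ℕ) := by omega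
    have g2 : ((i : ℤ) + j + 1) / 2 = ((s + 1) / 2 : ℕ) + (n * c : ℕ) := by omega
    have hper := periodic_mul hf c
    refine forall_congr' fun u => imp_congr_right fun _ => imp_congr_right fun _ => ?_
    rw [g1, g2, ← hper (((s / 2 : ℕ) : ℤ) - 1 - u), ← hper ((((s + 1) / 2 : ℕ) : ℤ) + u)]
    rw [Nat.cast_mul,
      show ((s / 2 : ℕ) : ℤ) + (n : ℤ) * c - 1 - u = ((s / 2 : ℕ) : ℤ) - 1 - u + c * n by ring,
      show (((s + 1) / 2 : ℕ) : ℤ) + (n : ℤ) * c + u = (((s + 1) / 2 : ℕ) : ℤ) + u + c * n by ring]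

/-- The positions that the maximal palindromes reach. -/
def reach (o : ℕ) : Prog :=
  forLoop 11 (32 * .reg 1)
    (.store (8 + o) (.reg 11) (.read (6 + o) (.reg 11 % .reg 6) + (.reg 11 + 1) / 2))

/-- The maxima for blocks of length `2 ^ (t + 1)`, from those for blocks of length `2 ^ t`. -/
def pairMaxima (o : ℕ) : Prog :=
  forLoop 13 (32 * .reg 1)
    (.set 14 (.read (8 + o) (.reg 12 * .reg 5 + .reg 13)) ;;
      .set 15 (.read (8 + o) (.reg 12 * .reg 5 + (.reg 13 + .read 10 (.reg 12)))) ;;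
      .store (8 + o) ((.reg 12 + 1) * .reg 5 + .reg 13) (.reg 14 + (.reg 15 - .reg 14)))

/-- The table of the maxima for blocks of lengths `2 ^ t` with `t` up to the value of register
`3`. -/
def maxima (o : ℕ) : Prog := reach o ;; forLoop 12 (.reg 3) (pairMaxima o)

theorem run_reach {M n T o : ℕ} {f : ℤ → Letter} {σ : State} (hb : Bounds M n T)
    (hc : Ctx n T σ.reg) (hR : RadTable n f (σ.arr (6 + o))) (hX : ∀ x, σ.arr (8 + o) x = 0) :
    Run M (reach o) σ (1000 * n) fun τ => SameBut (8 + o) σ τ ∧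
      MaxTable n 0 (τ.arr (6 + o)) (τ.arr (8 + o)) ∧ ∀ x, τ.arr (8 + o) x ≤ 20 * n := by
  have hlin := hb.lin
  have hpos := hb.pos
  refine Run.mono (Run.forLoop (N := 32 * n) (b := 14) (I := fun k τ => SameBut (8 + o) σ τ ∧
    (∀ s < k, τ.arr (8 + o) s = σ.arr (6 + o) (s % (2 * n)) + (s + 1) / 2) ∧
    ∀ x, τ.arr (8 + o) x ≤ 20 * n) (by omega) ?_ ?_ ?_ (by simp; omega)) le_rfl ?_
  · exact ⟨(SameBut.refl _ _).set le_rfl, fun s hs => by omega, fun x => by simp [hX]⟩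
  · rintro k τ - ⟨h, -⟩
    simp [(h.ctx hc).r1]; omega
  · rintro s τ hs h11 ⟨h, hI, hle⟩
    have e6 := (h.ctx hc).r6
    have hr := hR.le (s % (2 * n)) (Nat.mod_lt _ (by omega))
    have h6 : τ.arr (6 + o) = σ.arr (6 + o) := h.2 _ (by omega)
    refine Run.store (by simp [h11]; omega) (by simp [h11, e6, h6]; omega) (by simp) ?_
    refine ⟨h11, h.store.set le_rfl, fun s' hs' => ?_, fun x => ?_⟩
    · simp [h11, e6, h6]
      rcases Nat.lt_succ_iff_lt_or_eq.1 hs' with c | rfl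
      · rw [Function.update_of_ne c.ne, hI s' c]
      · rw [Function.update_self]
    · simp [h11, e6, h6, Function.update_apply]
      split
      · omega
      · exact hle x
  · rintro τ ⟨-, h, hI, hle⟩
    refine ⟨h, fun k hk s hs y => ?_, hle⟩
    obtain rfl : k = 0 := by omega
    have h6 : τ.arr (6 + o) = σ.arr (6 + o) := h.2 _ (by omega)
    rw [pow_zero] at hs ⊢
    rw [zero_mul, zero_add, hI s (by omega), h6]
    constructor
    · intro hlt u h1 h2
      obtain rfl : u = s := by omega
      exact hlt
    · intro hall
      exact hall s le_rfl (by omega)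

theorem run_pairMaxima {M n T o t : ℕ} {σ : State} (hb : Bounds M n T)
    (hc : Ctx n T σ.reg) (hP : Pows T σ.arr) (ho : o < 2) (ht : t < T) (h12 : σ.reg 12 = t)
    (hX : MaxTable n t (σ.arr (6 + o)) (σ.arr (8 + o))) (hle : ∀ x, σ.arr (8 + o) x ≤ 20 * n) :
    Run M (pairMaxima o) σ (2000 * n) fun τ => τ.reg 12 = t ∧ SameBut (8 + o) σ τ ∧
      MaxTable n (t + 1) (τ.arr (6 + o)) (τ.arr (8 + o)) ∧ ∀ x, τ.arr (8 + o) x ≤ 20 * n := by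
  have hlin := hb.lin
  have hpos := hb.pos
  have hp := hb.pow_succ_le
  have hT := hb.T_le
  have hpt := hP t ht.le
  have hpt' : 2 ^ t ≤ 2 ^ (T + 1) := Nat.pow_le_pow_right (by norm_num) (by omega)
  obtain ⟨A, hA⟩ : ∃ A, σ.arr (8 + o) = A := ⟨_, rfl⟩
  rw [hA] at hX hle
  refine Run.mono (Run.forLoop (N := 32 * n) (b := 40) (I := fun m τ => τ.reg 12 = t ∧
    SameBut (8 + o) σ τ ∧ (∀ x < (t + 1) * (64 * n), τ.arr (8 + o) x = A x) ∧
    (∀ x, τ.arr (8 + o) x ≤ 20 * n) ∧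
    ∀ s < m, τ.arr (8 + o) ((t + 1) * (64 * n) + s) =
      max (A (t * (64 * n) + s)) (A (t * (64 * n) + (s + 2 ^ t)))) (by omega) ?_ ?_ ?_
    (by simp; omega)) le_rfl ?_
  · exact ⟨by simp [h12], (SameBut.refl _ _).set (by omega), fun x _ => by simp [hA],
      fun x => by simp [hA, hle], fun s hs => by omega⟩
  · rintro k τ - ⟨-, h, -⟩
    simp [(h.ctx hc).r1]; omega
  · rintro s τ hs h13 ⟨e12, h, hsame, hle', hI⟩
    have e1 := (h.ctx hc).r1
    have e5 := (h.ctx hc).r5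
    have e10 : τ.arr 10 t = 2 ^ t := by rw [h.2 10 (by omega), hpt]
    have b0 := hb.max_lt (k := t) (y := s) (by omega) (by omega)
    have b1 := hb.max_lt (k := t) (y := s + 2 ^ t) (by omega) (by omega)
    have b2 := hb.max_lt (k := t + 1) (y := s) (by omega) (by omega)
    have hs1 := hsame (t * (64 * n) + s) (by rw [add_mul]; omega)
    have hs2 := hsame (t * (64 * n) + (s + 2 ^ t)) (by rw [add_mul]; omega)
    have l1 := hle (t * (64 * n) + s)
    have l2 := hle (t * (64 * n) + (s + 2 ^ t))
    obtain ⟨a, ha⟩ : ∃ a, A (t * (64 * n) + s) = a := ⟨_, rfl⟩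
    obtain ⟨b, hb'⟩ : ∃ b, A (t * (64 * n) + (s + 2 ^ t)) = b := ⟨_, rfl⟩
    rw [ha] at hs1 l1
    rw [hb'] at hs2 l2
    refine Run.set_seq (by simp [e12, e5, h13, hs1]; omega) (by simp) ?_
    rw [show (Expr.read (8 + o) (.reg 12 * .reg 5 + .reg 13)).eval τ = a by
      simp [e12, e5, h13, hs1]]
    refine Run.set_seq (by simp [e12, e5, h13, hs2, e10]; omega) (by simp) ?_
    rw [show (Expr.read (8 + o) (.reg 12 * .reg 5 + (.reg 13 + .read 10 (.reg 12)))).eval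
      ⟨Function.update τ.reg 14 a, τ.arr⟩ = b by simp [e12, e5, h13, hs2, e10]]
    have : t + 1 ≤ (t + 1) * (64 * n) := Nat.le_mul_of_pos_right _ (by omega)
    refine Run.store (by simp [e12, e5, h13]; omega) (by simp; omega) (by simp) ?_
    refine ⟨by simp [h13], by simp [e12], ((h.set (by omega)).set (by omega)).store.set (by omega),
      fun x hx => ?_, fun x => ?_, fun s' hs' => ?_⟩
    · simp [e12, e5, h13]
      rw [Function.update_of_ne (by omega), hsame x hx]
    · simp [e12, e5, h13, Function.update_apply]
      split
      · omega
      · exact hle' x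
    · simp [e12, e5, h13]
      rcases Nat.lt_succ_iff_lt_or_eq.1 hs' with c | rfl
      · rw [Function.update_of_ne (by omega), hI s' c]
      · rw [Function.update_self, ha, hb']; omega
  · rintro τ ⟨-, e12, h, hsame, hle', hI⟩
    refine ⟨e12, h, fun k hk s hs y => ?_, hle'⟩
    rw [h.2 (6 + o) (by omega)]
    have hk1 : 1 ≤ 2 ^ k := Nat.one_le_two_pow
    have ht1 : 1 ≤ 2 ^ t := Nat.one_le_two_pow
    rcases Nat.lt_succ_iff_lt_or_eq.1 (Nat.lt_succ_of_le hk) with c | rfl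
    · rw [hsame, hX k (by omega) s hs y]
      have : (k + 1) * (64 * n) ≤ (t + 1) * (64 * n) := Nat.mul_le_mul_right _ (by omega)
      rw [add_mul] at this
      omega
    · have e2 : 2 ^ (t + 1) = 2 ^ t + 2 ^ t := by rw [pow_succ]; omega
      rw [e2] at hs ⊢
      rw [hI s (by omega), max_lt_iff, hX t le_rfl s (by omega), hX t le_rfl (s + 2 ^ t) (by omega)]
      constructor
      · rintro ⟨h1, h2⟩ u hu hu'
        rcases Nat.lt_or_ge u (s + 2 ^ t) with c | c
        · exact h1 u hu c
        · exact h2 u c (by omega)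
      · intro hall
        exact ⟨fun u h1 h2 => hall u h1 (by omega), fun u h1 h2 => hall u (by omega) (by omega)⟩

theorem run_maxima {M n T o : ℕ} {f : ℤ → Letter} {σ : State} (hb : Bounds M n T)
    (hc : Ctx n T σ.reg) (hP : Pows T σ.arr) (ho : o < 2) (hR : RadTable n f (σ.arr (6 + o)))
    (hX : ∀ x, σ.arr (8 + o) x = 0) :
    Run M (maxima o) σ (4000 * (n * (T + 1))) fun τ => SameBut (8 + o) σ τ ∧
      MaxTable n T (τ.arr (6 + o)) (τ.arr (8 + o)) := by
  have hlin := hb.lin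
  have hpos := hb.pos
  have hT := hb.T_le
  have hX' : n * (T + 1) = n * T + n := by ring
  have hX1 : T * 1 ≤ T * n := Nat.mul_le_mul_left _ (by omega)
  have hX2 : T * n = n * T := mul_comm _ _
  refine Run.seq (s := 1000 * n) (by omega) (Run.mono (run_reach hb hc hR hX) le_rfl ?_)
  rintro τ ⟨h, h0, hle⟩
  refine Run.mono (Run.forLoop (N := T) (b := 2000 * n) (I := fun t τ =>
    SameBut (8 + o) σ τ ∧ MaxTable n t (τ.arr (6 + o)) (τ.arr (8 + o)) ∧
    ∀ x, τ.arr (8 + o) x ≤ 20 * n) (by omega) ?_ ?_ ?_ ?_) le_rfl fun τ hτ => ⟨hτ.2.1, hτ.2.2.1⟩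
  · exact ⟨h.set (by omega), h0, hle⟩
  · rintro t τ - ⟨h, -⟩
    simp [(h.ctx hc).r3]; omega
  · rintro t τ ht h12 ⟨h, h1, h2⟩
    refine Run.mono (run_pairMaxima hb (h.ctx hc)
      (fun t ht => by rw [h.2 10 (by omega), hP t ht]) ho ht h12 h1 h2) le_rfl ?_
    rintro ρ ⟨g1, g2, g3, g4⟩
    exact ⟨g1, (h.trans g2).set (by omega), g3, g4⟩
  · simp only [Expr.cost_reg]
    have : T * (2000 * n + 1 + 7) = 2000 * (n * T) + 8 * T := by ring
    omega

end WordRAM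

/-! ### The decision procedure -/

namespace WordRAM

open HalfTurn

/-- The constants in registers `1` to `6`, the powers of two in array `10`, and the reversed word
in array `1`. -/
def setup : Prog :=
  .set 1 (.reg 0) ;; .set 2 (3 * .reg 1) ;; .set 5 (64 * .reg 1) ;; .set 6 (2 * .reg 1) ;;
    .set 3 0 ;; .set 4 1 ;; .store 10 0 1 ;;
    .loop (.lt (.reg 4) (.reg 1 + 1))
      (.set 3 (.reg 3 + 1) ;; .set 4 (.reg 4 * 2) ;; .store 10 (.reg 3) (.reg 4)) ;;
    forLoop 11 (.reg 1) (.store 1 (.reg 11) (.read 0 (.reg 1 - 1 - .reg 11)))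

/-- The state from which the tables are computed. -/
structure Ready (n T : ℕ) (f : ℤ → Letter) (σ : State) : Prop where
  ctx : Ctx n T σ.reg
  answer : σ.reg 9 = 0
  pows : Pows T σ.arr
  codes : Codes n f (σ.arr 0)
  codes_rev : Codes n (rev f) (σ.arr 1)
  zero : ∀ a, a ≠ 0 → a ≠ 1 → a ≠ 10 → ∀ x, σ.arr a x = 0

theorem run_setup {M : ℕ} {w : List Letter} (hb : Bounds M w.length (Nat.log 2 w.length + 1)) :
    Run M setup (input w) (200 * w.length)
      (Ready w.length (Nat.log 2 w.length + 1) (wordFun w)) := by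
  have hlin := hb.lin
  have hpos := hb.pos
  obtain ⟨n, hn⟩ : ∃ n, w.length = n := ⟨_, rfl⟩
  obtain ⟨T, hT⟩ : ∃ T, Nat.log 2 n + 1 = T := ⟨_, rfl⟩
  rw [hn] at hb hlin hpos ⊢
  rw [hT] at hb ⊢
  have hTn := hb.T_le
  have hTle := hb.pow_le
  have hcodes : Codes n (wordFun w) ((input w).arr 0) := fun x hx => by
    rw [wordFun_natCast (show x < w.length by omega)]
    simp [input, List.getElem?_eq_getElem (show x < w.length by omega)]
  have hr0 : (input w).reg 0 = n := by simp [input, hn]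
  have hzero : ∀ a, a ≠ 0 → ∀ x, (input w).arr a x = 0 := fun a ha x => by simp [input, ha]
  have hr9 : (input w).reg 9 = 0 := by simp [input]
  refine Run.set_seq (by simp [hr0]; omega) (by simp; omega) ?_
  refine Run.set_seq (by simp [hr0]; omega) (by simp; omega) ?_
  refine Run.set_seq (by simp [hr0]; omega) (by simp; omega) ?_
  refine Run.set_seq (by simp [hr0]; omega) (by simp; omega) ?_
  refine Run.set_seq (by simp; omega) (by simp; omega) ?_
  refine Run.set_seq (by simp; omega) (by simp; omega) ?_
  refine Run.store_seq (by simp; omega) (by simp; omega) (by simp; omega) ?_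
  refine Run.seq (s := 60 * n + 20) (by simp; omega) (Run.mono (Run.loop (N := T) (b := 15)
    (I := fun k τ => τ.reg 1 = n ∧ τ.reg 2 = 3 * n ∧ τ.reg 5 = 64 * n ∧ τ.reg 6 = 2 * n ∧
      τ.reg 9 = 0 ∧ τ.reg 3 = T - k ∧ τ.reg 4 = 2 ^ (T - k) ∧
      (∀ a, a ≠ 10 → τ.arr a = (input w).arr a) ∧ ∀ t ≤ T - k, τ.arr 10 t = 2 ^ t)
    ?_ ?_ ?_ (by simp; omega)) le_rfl ?_)
  · refine ⟨by simp [hr0], by simp [hr0], by simp [hr0], by simp [hr0], by simp [hr9], by simp,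
      by simp, fun a ha => by simp [ha], fun t ht => ?_⟩
    obtain rfl : t = 0 := by omega
    simp
  · rintro k τ hk ⟨r1, r2, r5, r6, r9, r3, r4, harr, hpow⟩
    have hp : 2 ^ (T - k) ≤ 2 ^ T := Nat.pow_le_pow_right (by norm_num) (by omega)
    constructor
    · rw [Expr.fits_lt _ _ _ _ (by omega)]
      simp [r4, r1]; omega
    · have : (2 ^ (T - k) < n + 1) ↔ 0 < k := by
        constructor
        · intro h
          by_contra hk0
          obtain rfl : k = 0 := by omega
          have := hb.lt_pow
          rw [Nat.sub_zero] at h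
          omega
        · intro h
          have h1 : 2 ^ (T - k) ≤ 2 ^ (Nat.log 2 n) := Nat.pow_le_pow_right (by norm_num) (by omega)
          have h2 := Nat.pow_log_le_self 2 (x := n) (by omega)
          omega
      simp [r4, r1] at this ⊢
      exact this
  · rintro k τ hk ⟨r1, r2, r5, r6, r9, r3, r4, harr, hpow⟩
    have e : T - k = T - (k + 1) + 1 := by omega
    have e' : 2 ^ (T - k) = 2 ^ (T - (k + 1)) * 2 := by rw [e, pow_succ]
    have hp : 2 ^ (T - k) ≤ 2 ^ T := Nat.pow_le_pow_right (by norm_num) (by omega)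
    refine Run.set_seq (by simp [r3]; omega) (by simp) ?_
    refine Run.set_seq (by simp [r4]; omega) (by simp) ?_
    refine Run.store (by simp [r3]; omega) (by simp [r4]; omega) (by simp) ?_
    refine ⟨by simp [r1], by simp [r2], by simp [r5], by simp [r6], by simp [r9],
      by simp [r3]; omega, by simp [r4, e'], fun a ha => by simp [ha, harr a ha], fun t ht => ?_⟩
    simp [r3, r4, ← e, ← e', Function.update_apply]
    split_ifs with c
    · rw [c]
    · exact hpow t (by omega)
  · rintro τ ⟨r1, r2, r5, r6, r9, r3, r4, harr, hpow⟩
    rw [Nat.sub_zero] at r3 r4 hpow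
    refine Run.mono (Run.forLoop (N := n) (b := 15) (I := fun k ρ =>
      (∀ y < 11, ρ.reg y = τ.reg y) ∧ (∀ a, a ≠ 1 → ρ.arr a = τ.arr a) ∧
      ∀ x < k, ρ.arr 1 x = (rev (wordFun w) x).code) (by omega) ?_ ?_ ?_ (by simp; omega)) le_rfl ?_
    · exact ⟨fun y hy => by simp [show y ≠ 11 by omega], fun _ _ => rfl, fun x hx => by omega⟩
    · rintro k ρ - ⟨h, -⟩
      simp [h 1 (by omega), r1]; omega
    · rintro k ρ hk h11 ⟨h, h1, h2⟩
      have e1 : ρ.reg 1 = n := by rw [h 1 (by omega), r1]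
      have e0 : ρ.arr 0 (n - 1 - k) = (wordFun w (n - 1 - k : ℕ)).code := by
        rw [h1 0 (by omega), harr 0 (by omega), hcodes _ (by omega)]
      have := Letter.code_lt (wordFun w (n - 1 - k : ℕ))
      refine Run.store (by simp [h11]; omega) (by simp [h11, e1, e0]; omega) (by simp) ?_
      refine ⟨h11, fun y hy => by simp [show y ≠ 11 by omega, h y hy],
        fun a ha => by simp [ha, h1 a ha], fun x hx => ?_⟩
      simp only [Function.update_self, Expr.eval_reg, Expr.eval_read, Expr.eval_sub,
        Expr.eval_ofNat, h11, e1, e0]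
      rcases Nat.lt_succ_iff_lt_or_eq.1 hx with c | rfl
      · rw [Function.update_of_ne c.ne, h2 x c]
      · rw [Function.update_self, rev, ← wordFun_periodic w (-1 - x)]
        congr 2; omega
    · rintro ρ ⟨-, h, h1, h2⟩
      refine ⟨⟨?_, ?_, ?_, ?_, ?_, ?_⟩, ?_, fun t ht => ?_, ?_, h2, fun a h3 h4 h5 x => ?_⟩
      · rw [h 1 (by omega), r1]
      · rw [h 2 (by omega), r2]
      · rw [h 3 (by omega), r3]
      · rw [h 4 (by omega), r4]
      · rw [h 5 (by omega), r5]
      · rw [h 6 (by omega), r6]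
      · rw [h 9 (by omega), r9]
      · rw [h1 10 (by omega), hpow t ht]
      · rw [h1 0 (by omega), harr 0 (by omega)]; exact hcodes
      · rw [h1 a h4, harr a h5, hzero a h3]

/-- The tables for the word in array `o`. -/
def tables (o : ℕ) : Prog := names o ;; radii o ;; maxima o

theorem run_tables {M n T o : ℕ} {f : ℤ → Letter} {σ : State} (hb : Bounds M n T)
    (hf : ∀ x, f (x + n) = f x) (hc : Ctx n T σ.reg) (hw : Codes n f (σ.arr o))
    (hP : Pows T σ.arr) (ho : o < 2) (hD : ∀ x, σ.arr (4 + o) x = 0)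
    (hX : ∀ x, σ.arr (8 + o) x = 0) :
    Run M (tables o) σ (4800 * (n * (T + 1))) fun τ => (∀ y < 11, τ.reg y = σ.reg y) ∧
      (∀ c, c ≠ 2 + o → c ≠ 4 + o → c ≠ 6 + o → c ≠ 8 + o → τ.arr c = σ.arr c) ∧
      Tables n T f o τ.arr := by
  refine Run.seq (s := 400 * (n * (T + 1))) (by omega)
    (Run.mono (run_names hb hf hc hw hP ho hD) le_rfl ?_)
  rintro σ₁ ⟨h1, g1⟩
  refine Run.seq (s := 400 * (n * (T + 1))) (by omega) (Run.mono (run_radii hb hf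
    (hc.of_eq fun x hx => h1.1 x (by omega)) g1) le_rfl ?_)
  rintro σ₂ ⟨h2, g2⟩
  refine Run.mono (run_maxima hb (hc.of_eq fun x hx => ?_) (fun t ht => ?_) ho g2 fun x => ?_)
    (by omega) ?_
  · rw [h2.1 x (by omega), h1.1 x (by omega)]
  · rw [h2.2 10 (by omega), h1.2 10 (by omega) (by omega), hP t ht]
  · rw [h2.2 (8 + o) (by omega), h1.2 (8 + o) (by omega) (by omega), hX]
  · rintro σ₃ ⟨h3, g3⟩
    refine ⟨fun y hy => ?_, fun c c1 c2 c3 c4 => ?_, ?_, ?_, g3⟩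
    · rw [h3.1 y hy, h2.1 y hy, h1.1 y hy]
    · rw [h3.2 c c4, h2.2 c c3, h1.2 c c1 c2]
    · rw [h3.2 (2 + o) (by omega), h2.2 (2 + o) (by omega)]; exact g1
    · rw [h3.2 (6 + o) (by omega)]; exact g2

/-- The program that decides whether the input has a half-turn factorization. -/
def decider : Prog :=
  setup ;; tables 0 ;; tables 1 ;;
    (phaseTranslated 0 1 ;; phaseTranslated 1 0 ;; phaseUntranslated 0 1) ;; .set 0 (.reg 9)

theorem run_decider {M : ℕ} {w : List Letter} (hw : w ≠ [])
    (hs : Simple (wordFun w) w.length) (hb : Bounds M w.length (Nat.log 2 w.length + 1)) :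
    Run M decider (input w)
      (200000 * (w.length * ((Nat.log 2 w.length + 2) * (Nat.log 2 w.length + 2))))
      fun τ => (HasHalfTurnFactorization w → τ.reg 0 = 1) ∧
        (¬ HasHalfTurnFactorization w → τ.reg 0 = 0) := by
  have hlin := hb.lin
  have hpos := hb.pos
  rw [hasHalfTurnFactorization_iff hw]
  have hset := run_setup hb
  obtain ⟨n, hn⟩ : ∃ n, w.length = n := ⟨_, rfl⟩
  obtain ⟨T, hT⟩ : ∃ T, Nat.log 2 n + 1 = T := ⟨_, rfl⟩
  obtain ⟨f, hfd⟩ : ∃ f, wordFun w = f := ⟨_, rfl⟩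
  rw [hn] at hb hlin hpos hs hset ⊢
  rw [hT] at hb hset
  rw [show Nat.log 2 n + 2 = T + 1 by omega]
  rw [hfd] at hs hset ⊢
  have hf := hs.periodic
  have hf' := hs.rev.periodic
  have hX1 : T + 1 ≤ (T + 1) * (T + 1) := Nat.le_mul_of_pos_left _ (by omega)
  have hX2 : n * (T + 1) ≤ n * ((T + 1) * (T + 1)) := Nat.mul_le_mul_left _ hX1
  have hX3 : n * 1 ≤ n * (T + 1) := Nat.mul_le_mul_left _ (by omega)
  refine Run.seq (s := 200 * n) (by omega) (Run.mono hset le_rfl ?_)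
  intro σ₁ h
  refine Run.seq (s := 4800 * (n * (T + 1))) (by omega) (Run.mono (run_tables (o := 0) hb hf h.ctx
    h.codes h.pows (by omega) (h.zero 4 (by omega) (by omega) (by omega))
    (h.zero 8 (by omega) (by omega) (by omega))) le_rfl ?_)
  rintro σ₂ ⟨g1, g2, g3⟩
  have hc₂ : Ctx n T σ₂.reg := h.ctx.of_eq fun x hx => g1 x (by omega)
  refine Run.seq (s := 4800 * (n * (T + 1))) (by omega) (Run.mono (run_tables (o := 1) hb hf' hc₂
    ?_ ?_ (by omega) ?_ ?_) le_rfl ?_)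
  · rw [g2 1 (by omega) (by omega) (by omega) (by omega)]; exact h.codes_rev
  · intro t ht
    rw [g2 10 (by omega) (by omega) (by omega) (by omega), h.pows t ht]
  · rw [g2 5 (by omega) (by omega) (by omega) (by omega)]
    exact h.zero 5 (by omega) (by omega) (by omega)
  · rw [g2 9 (by omega) (by omega) (by omega) (by omega)]
    exact h.zero 9 (by omega) (by omega) (by omega)
  rintro σ₃ ⟨k1, k2, k3⟩
  have hc : Ctx n T σ₃.reg := hc₂.of_eq fun x hx => k1 x (by omega)
  have hA : Tables n T f 0 σ₃.arr := by
    refine ⟨?_, ?_, ?_⟩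
    · rw [k2 2 (by omega) (by omega) (by omega) (by omega)]; exact g3.name
    · rw [k2 6 (by omega) (by omega) (by omega) (by omega)]; exact g3.rad
    · rw [k2 6 (by omega) (by omega) (by omega) (by omega),
        k2 8 (by omega) (by omega) (by omega) (by omega)]
      exact g3.max
  have hA' : Tables n T (rev (rev f)) 0 σ₃.arr := by rwa [rev_rev]
  have hP : Pows T σ₃.arr := fun t ht => by
    rw [k2 10 (by omega) (by omega) (by omega) (by omega),
      g2 10 (by omega) (by omega) (by omega) (by omega), h.pows t ht]
  have h9 : σ₃.reg 9 = 0 := by rw [k1 9 (by omega), g1 9 (by omega), h.answer]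
  have hctx : ∀ τ : State, (∀ y < 10, y ≠ 9 → τ.reg y = σ₃.reg y) → Ctx n T τ.reg :=
    fun τ hτ => hc.of_eq fun x hx => hτ x (by omega) (by omega)
  have hrev : (∃ i j k a p, HT (rev f) n i j k a p) → ∃ i j k a p, HT f n i j k a p := by
    rintro ⟨i, j, k, a, p, hh⟩
    have := hh.reverse hf'
    rw [rev_rev] at this
    exact ⟨_, _, _, _, _, this⟩
  have hall := Search.seq_search (t := 162000 * (n * ((T + 1) * (T + 1)))) (by omega)
    (search_phaseTranslated hb hs hc hA k3 hP) fun τ ha hr =>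
      (Search.seq_search (by omega)
        ((search_phaseTranslated hb hs.rev (hctx τ hr) (ha ▸ k3) (ha ▸ hA') (ha ▸ hP)).imp hrev)
        fun ρ ha' hr' => (search_phaseUntranslated (o := 0) (o' := 1) hb hs
          (hctx ρ fun y hy hy' => (hr' y hy hy').trans (hr y hy hy'))
          (by rw [ha', ha]; exact hA) (by rw [ha', ha]; exact k3)).mono (by omega) fun h => h)
  refine Run.seq (s := 162000 * (n * ((T + 1) * (T + 1)))) (by omega) (Run.mono hall le_rfl ?_)
  rintro τ ⟨-, -, hans, hP⟩
  have hlt : τ.reg 9 < M := by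
    rcases hans with c | c <;> omega
  refine Run.set (by simpa using hlt) (by simp; omega) ⟨fun hex => ?_, fun hno => ?_⟩
  · simp only [Expr.eval_reg, Function.update_self]
    apply hP
    by_cases hpos : ∃ i j k a p, 0 < a ∧ HT f n i j k a p
    · obtain ⟨i, j, k, a, p, ha, g, rfl | rfl, hht, hnl⟩ := exists_not_loose hs hpos
      · exact .inl ⟨i, j, k, a, p, ha, hht, hnl⟩
      · exact .inr (.inl ⟨i, j, k, a, p, ha, hht, hnl⟩)
    · obtain ⟨i, j, k, a, p, hht⟩ := hex
      rcases eq_or_lt_of_le hht.ha with rfl | c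
      · exact .inr (.inr ⟨i, j, k, p, hht⟩)
      · exact (hpos ⟨i, j, k, a, p, c, hht⟩).elim
  · simp only [Expr.eval_reg, Function.update_self]
    rcases hans with c | c
    · rw [c, h9]
    · exact (hno c.2).elim

/-- Words of `20 (⌊log₂ n⌋ + 1)` bits suffice, as all values are at most of the order of
`n ^ 3`. -/
theorem bounds_pow {n : ℕ} (hn : 0 < n) :
    Bounds (2 ^ (20 * (Nat.log 2 n + 1))) n (Nat.log 2 n + 1) := by
  obtain ⟨X, hX⟩ : ∃ X, 2 ^ (Nat.log 2 n + 1) = X := ⟨_, rfl⟩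
  have h1 : n < X := hX ▸ Nat.lt_pow_succ_log_self (by norm_num) n
  have h2 : X ≤ 2 * n := by
    rw [← hX, pow_succ]
    have := Nat.pow_log_le_self 2 (x := n) (by omega)
    omega
  have h3 : Nat.log 2 n + 1 < X := hX ▸ Nat.lt_two_pow_self
  have hM : 2 ^ (20 * (Nat.log 2 n + 1)) = X ^ 20 := by rw [← hX, ← pow_mul, mul_comm]
  have hX2 : 2 ≤ X := by omega
  have h4 : 2 ^ 17 * X ^ 3 ≤ X ^ 20 := by
    calc 2 ^ 17 * X ^ 3 ≤ X ^ 17 * X ^ 3 := Nat.mul_le_mul_right _ (Nat.pow_le_pow_left hX2 17)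
      _ = X ^ 20 := by rw [← pow_add]
  have h5 : X ^ 2 ≤ X ^ 3 := Nat.pow_le_pow_right (by omega) (by norm_num)
  have h6 : X ≤ X ^ 2 := by rw [sq]; exact Nat.le_mul_of_pos_left _ (by omega)
  refine ⟨hn, by rw [hX]; exact h1, by rw [hX]; exact h2, ?_, ?_⟩
  · rw [hM]
    have : (Nat.log 2 n + 1 + 2) * n ≤ (2 * X) * X := Nat.mul_le_mul (by omega) h1.le
    have e : (2 * X) * X = 2 * X ^ 2 := by ring
    omega
  · rw [hM]
    have : (Nat.log 2 n + 1 + 2) * ((3 * n + 4) * (3 * n + 4)) ≤ (2 * X) * ((7 * X) * (7 * X)) :=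
      Nat.mul_le_mul (by omega) (Nat.mul_le_mul (by omega) (by omega))
    have e : (2 * X) * ((7 * X) * (7 * X)) = 98 * X ^ 3 := by ring
    omega

/-- The running time of the program is in `O(n log² n)`. -/
theorem isBigO_time : (fun n : ℕ =>
      ((200000 * (n * ((Nat.log 2 n + 2) * (Nat.log 2 n + 2))) : ℕ) : ℝ)) =O[Filter.atTop]
    fun n : ℕ => (n : ℝ) * Real.log n ^ 2 := by
  refine Asymptotics.IsBigO.of_bound (200000 * 36) ?_
  filter_upwards [Filter.eventually_ge_atTop 2] with n hn
  have hn0 : (0 : ℝ) < n := by positivity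
  have hl2 : (1 / 2 : ℝ) < Real.log 2 := by linarith [Real.log_two_gt_d9]
  have hln : Real.log 2 ≤ Real.log n :=
    Real.log_le_log (by norm_num) (by exact_mod_cast hn)
  have hlog : (Nat.log 2 n : ℝ) * Real.log 2 ≤ Real.log n := by
    rw [← Real.log_pow]
    refine Real.log_le_log (by positivity) ?_
    exact_mod_cast Nat.pow_log_le_self 2 (by omega)
  have hL : (0 : ℝ) ≤ Nat.log 2 n := by positivity
  have hle : (Nat.log 2 n : ℝ) + 2 ≤ 6 * Real.log n := by nlinarith
  rw [Real.norm_of_nonneg (by positivity), Real.norm_of_nonneg (by positivity)]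
  push_cast
  have : ((Nat.log 2 n : ℝ) + 2) * (Nat.log 2 n + 2) ≤ (6 * Real.log n) * (6 * Real.log n) :=
    mul_le_mul hle hle (by positivity) (by linarith)
  calc (200000 : ℝ) * (n * ((Nat.log 2 n + 2) * (Nat.log 2 n + 2)))
      ≤ 200000 * (n * ((6 * Real.log n) * (6 * Real.log n))) := by gcongr
    _ = _ := by ring

end WordRAM

theorem mainTheorem2 :
    ∃ (p : WordRAM.Prog) (c : ℕ) (T : ℕ → ℕ),
      Asymptotics.IsBigO Filter.atTop (fun n : ℕ => (T n : ℝ))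
        (fun n : ℕ => (n : ℝ) * Real.log (n : ℝ) ^ 2) ∧
      WordRAM.DecidesWithin p c T (fun w => ∃ P : Polyomino, P.IsBoundaryWord w)
        HasHalfTurnFactorization := by
  refine ⟨WordRAM.decider, 20, fun n => 200000 * (n * ((Nat.log 2 n + 2) * (Nat.log 2 n + 2))),
    WordRAM.isBigO_time, ?_⟩
  rintro w ⟨P, hP⟩
  have hw := HalfTurn.ne_nil_of_isBoundaryWord hP
  obtain ⟨t, τ, ht, hx, hq⟩ := WordRAM.run_decider hw (HalfTurn.simple_of_isBoundaryWord hP)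
    (WordRAM.bounds_pow (List.length_pos_iff.2 hw))
  exact ⟨t, τ, hx, ht, hq⟩
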